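/- Let $\mathfrak g$ be a finite-dimensional complex semisimple Lie algebra with a Cartan subalgebra $\mathfrak h$ and a Borel subalgebra $\mathfrak b=\mathfrak h\oplus\mathfrak n$, given by a set $\Pi$ of simple roots; let $\bar{\mathfrak b}=\mathfrak h\oplus\bar{\mathfrak n}$ be the opposite Borel subalgebra, $\rho$ the half-sum of the positive roots, and $\tau$ a transpose antiautomorphism of $\mathfrak g$, that is, an antiautomorphism which is the identity on $\mathfrak h$ (it interchanges $\mathfrak g_\alpha$ and $\mathfrak g_{-\alpha}$), extended to $U(\mathfrak g)$. Let $\eta:\mathfrak n\to\mathbb C$ be a Lie algebra homomorphism, $\Pi_\eta=\{\alpha\in\Pi:\eta|_{\mathfrak g_\alpha}\ne0\}$, $\Sigma_\eta$ the root system generated by $\Pi_\eta$, $\rho_\eta$ the half-sum of its positive roots, $\mathfrak l_\eta=\mathfrak h\oplus\bigoplus_{\alpha\in\Sigma_\eta}\mathfrak g_\alpha$, $\mathfrak n_\eta=\mathfrak l_\eta\cap\mathfrak n$, $\bar{\mathfrak n}_\eta=\mathfrak l_\eta\cap\bar{\mathfrak n}$, $\mathfrak n^\eta$ the sum of the root spaces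 for the positive roots outside $\Sigma_\eta$, and $\mathfrak p_\eta=\mathfrak l_\eta\oplus\mathfrak n^\eta$. Let $Z(\mathfrak l_\eta)$ be the centre of $U(\mathfrak l_\eta)$ and let $p_\eta:Z(\mathfrak l_\eta)\to U(\mathfrak h)$ be the projection to the first summand of $U(\mathfrak l_\eta)=U(\mathfrak h)\oplus(\bar{\mathfrak n}_\eta U(\mathfrak l_\eta)+U(\mathfrak l_\eta)\mathfrak n_\eta)$. Let $\lambda\in\mathfrak h^*$, let $A$ be a commutative local $\mathbb C$-algebra with maximal ideal $\mathfrak m$, and let $\varphi:U(\mathfrak h)\to A$ be an algebra homomorphism with $\varphi(\mathfrak h)\subseteq\mathfrak m$. For $\mu\in\mathfrak h^*$ write $\mu+\varphi:U(\mathfrak h)\to A$ for the algebra homomorphism with $H\mapsto\mu(H)+\varphi(H)$ for $H\in\mathfrak h$. Define the $(\mathfrak g,A)$-bimodules $$M_A(\lambda)=U(\mathfrak g)\otimes_{U(\mathfrak b)}A_{\lambda-\rho},\qquad M_A(\lambda,\eta)=U(\mathfrak g)\otimes_{U(\mathfrak p_\eta)}U(\mathfrak l_\eta)\otimes_{Z(\mathfrak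 l_\eta)\otimes U(\mathfrak n_\eta)}A_{\lambda-\rho+\rho_\eta,\eta},$$ where $\mathfrak h$ acts on $A_{\lambda-\rho}=A$ by $\lambda-\rho+\varphi$ and $\mathfrak n$ by $0$; where $z\otimes u$ acts on $A_{\lambda-\rho+\rho_\eta,\eta}=A$ by $(\lambda-\rho+\varphi)(p_\eta(z))\,\eta(u)$; and where $\mathfrak n^\eta$ acts by $0$ on $U(\mathfrak l_\eta)\otimes A_{\lambda-\rho+\rho_\eta,\eta}$. Put $\underline v=1\otimes1\in M_A(\lambda)$ and $\underline w=1\otimes1\otimes1\in M_A(\lambda,\eta)$. For $A=\mathbb C$ and $\varphi=$ evaluation at $0$, denote these modules and generators by $M(\lambda)$, $M(\lambda,\eta)$, $v$, $w$. For a $U(\mathfrak g)$-module $V$ let $(V)_\eta$ be the set of $x\in V$ for which there is a $k$ with $(X-\eta(X))^kx=0$ for all $X\in\mathfrak n$. Define $$M_A^\vee(\lambda,\eta)=\big(\operatorname{Hom}_{U(\bar{\mathfrak b})}(U(\mathfrak g),A_{\lambda-\rho})\big)_\eta,$$ where $\mathfrak h$ acts on $A_{\lambda-\rho}=A$ by $\lambda-\rho+\varphi$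 and $\bar{\mathfrak n}$ by $0$, and $U(\mathfrak g)$ acts on the $\operatorname{Hom}$ by $(x\cdot G)(u)=G(ux)$. An $A$-contravariant pairing is an $A$-bilinear map $(\cdot,\cdot)_A:M_A(\lambda,\eta)\times M_A(\lambda)\to A$ with $(ux,y)_A=(x,\tau(u)y)_A$ for all $u\in U(\mathfrak g)$; these pairings form an $A$-module $\Psi_A$. Then: 1. There is a unique complex contravariant pairing $\langle\cdot,\cdot\rangle:M(\lambda,\eta)\times M(\lambda)\to\mathbb C$ with $\langle w,v\rangle=1$, and every complex contravariant pairing is a multiple of it. 2. There is a unique $\langle\cdot,\cdot\rangle_A\in\Psi_A$ with $\langle\underline w,\underline v\rangle_A=1$. It lifts $\langle\cdot,\cdot\rangle$: for all $u,u'\in U(\mathfrak g)$, $\langle u\underline w,u'\underline v\rangle_A$ and $\langle uw,u'v\rangle$ have the same image in $A/\mathfrak m$; and $\langle\underline w,u'\underline v\rangle_A=\langle w,u'v\rangle$ for $u'\in U(\bar{\mathfrak n})$. 3. $\Psi_A$ is a free $A$-module of rank one with basis $\langle\cdot,\cdot\rangle_A$, i.e. $A\to\Psi_A$, $a\mapsto\langle\cdot,\cdot\rangle_A\,a$,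 is an isomorphism. 4. Let $U(\mathfrak g)$ act on $\operatorname{Hom}_A(M_A(\lambda),A)$ by $(x\cdot F)(y)=F(\tau(x)y)$. There is an isomorphism of $(\mathfrak g,A)$-bimodules $\Theta:\operatorname{Hom}_A(M_A(\lambda),A)\to\operatorname{Hom}_{U(\bar{\mathfrak b})}(U(\mathfrak g),A_{\lambda-\rho})$ with $\Theta(F)(u)=F(\tau(u)\underline v)$, and $\psi_\eta(m)=\Theta(\langle m,\cdot\rangle_A)$ defines a homomorphism of $(\mathfrak g,A)$-bimodules $\psi_\eta:M_A(\lambda,\eta)\to M_A^\vee(\lambda,\eta)$. -/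

import Mathlib

open scoped TensorProduct

attribute [local instance 100] LieRing.ofAssociativeRing

/-- Notation for the universal enveloping algebra. -/
local notation "U(" L ")" => UniversalEnvelopingAlgebra ℂ L

/-- The canonical map from a Lie algebra to its enveloping algebra. -/
local notation "ιU" => UniversalEnvelopingAlgebra.ι ℂ

noncomputable section

namespace WhittakerPairing

open LieAlgebra LieAlgebra.IsKilling Module

/-! ### Tensor products over a noncommutative ring -/

section BalTensor

attribute [local instance] RestrictScalars.moduleOrig

variable {A : Type*} [CommRing A] [Algebra ℂ A] {S : Type*} [Ring S] [Algebra ℂ S]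
  {M : Type*} [AddCommGroup M] [Module A M] {R : Type*}

/-- The left `S`-submodule of `S ⊗_ℂ M` spanned by all `s j(r) ⊗ m - s ⊗ r m`, where `r : R` acts on
`M` by `op r`. -/
def balRel (j : R → S) (op : R → Module.End A M) :
    Submodule S (S ⊗[ℂ] RestrictScalars ℂ A M) :=
  Submodule.span S {t | ∃ (s : S) (r : R) (m : M),
    t = (s * j r) ⊗ₜ[ℂ] ((RestrictScalars.addEquiv ℂ A M).symm m) -
      s ⊗ₜ[ℂ] ((RestrictScalars.addEquiv ℂ A M).symm (op r m))}

/-- The balanced tensor product `S ⊗_R M`: the quotient of `S ⊗_ℂ M` by the relations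
`s r ⊗ m = s ⊗ r m`. Here `M` is a `ℂ`-vector space through the `A`-module structure. The index `R`
may be any set of elements which generates (as an algebra, or as a vector space) the ring
over which the tensor product is balanced: the relations for the generators
imply those for the ring. -/
def BalTensor (j : R → S) (op : R → Module.End A M) : Type _ :=
  (S ⊗[ℂ] RestrictScalars ℂ A M) ⧸ balRel j op

namespace BalTensor

variable (j : R → S) (op : R → Module.End A M)

instance : AddCommGroup (BalTensor j op) :=
  inferInstanceAs (AddCommGroup ((S ⊗[ℂ] RestrictScalars ℂ A M) ⧸ balRel j op))

/-- `S` acts by left multiplication on the first factor. -/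
instance : Module S (BalTensor j op) :=
  inferInstanceAs (Module S ((S ⊗[ℂ] RestrictScalars ℂ A M) ⧸ balRel j op))

/-- The class of `s ⊗ m`. -/
def tmul (s : S) (m : M) : BalTensor j op :=
  (balRel j op).mkQ (s ⊗ₜ[ℂ] ((RestrictScalars.addEquiv ℂ A M).symm m))

/-- Multiplication by `a : A` on the second factor of `S ⊗_ℂ M`. -/
def preAct (a : A) : (S ⊗[ℂ] RestrictScalars ℂ A M) →ₗ[S] (S ⊗[ℂ] RestrictScalars ℂ A M) :=
  TensorProduct.AlgebraTensorModule.lTensor S S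
    ((LinearMap.lsmul A (RestrictScalars ℂ A M) a).restrictScalars ℂ)

lemma preAct_tmul (a : A) (s : S) (m : RestrictScalars ℂ A M) :
    preAct a (s ⊗ₜ[ℂ] m) = s ⊗ₜ[ℂ] (a • m) := rfl

lemma balRel_le (a : A) : balRel j op ≤ (balRel j op).comap (preAct a) := by
  refine Submodule.span_le.2 ?_
  rintro _ ⟨s, r, m, rfl⟩
  refine Submodule.subset_span ⟨s, r, a • m, ?_⟩
  rw [map_sub, preAct_tmul, preAct_tmul, (op r).map_smul]
  rfl

/-- Multiplication by `a : A` on the second factor of `S ⊗_R M`. -/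
def act (a : A) : BalTensor j op →ₗ[S] BalTensor j op :=
  (balRel j op).mapQ (balRel j op) (preAct a) (balRel_le j op a)

lemma act_tmul (a : A) (s : S) (m : M) : act j op a (tmul j op s m) = tmul j op s (a • m) := rfl

lemma ext_tmul {f g : BalTensor j op →ₗ[S] BalTensor j op}
    (h : ∀ s m, f (tmul j op s m) = g (tmul j op s m)) : f = g := by
  refine LinearMap.ext fun x => ?_
  obtain ⟨t, rfl⟩ := (balRel j op).mkQ_surjective x
  induction t using TensorProduct.induction_on with
  | zero => exact (map_zero f).trans (map_zero g).symm
  | tmul s m => exact h s m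
  | add x y hx hy =>
    have hf := map_add f ((balRel j op).mkQ x) ((balRel j op).mkQ y)
    have hg := map_add g ((balRel j op).mkQ x) ((balRel j op).mkQ y)
    rw [map_add]
    exact hf.trans ((congrArg₂ (· + ·) hx hy).trans hg.symm)

lemma tmul_add (s : S) (m m' : M) :
    tmul j op s (m + m') = tmul j op s m + tmul j op s m' := by
  unfold tmul
  rw [map_add, TensorProduct.tmul_add, map_add]
  rfl

/-- `A` acts on the second factor. -/
instance : Module A (BalTensor j op) where
  smul a x := act j op a x
  one_smul x := LinearMap.congr_fun (f := act j op 1) (g := LinearMap.id)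
    (ext_tmul j op fun s m => by rw [act_tmul, one_smul]; rfl) x
  mul_smul a c x := LinearMap.congr_fun (f := act j op (a * c)) (g := act j op a ∘ₗ act j op c)
    (ext_tmul j op fun s m => by
      rw [LinearMap.comp_apply, act_tmul, act_tmul, act_tmul, mul_smul]) x
  smul_zero a := map_zero (act j op a)
  smul_add a := map_add (act j op a)
  add_smul a c x := LinearMap.congr_fun (f := act j op (a + c)) (g := act j op a + act j op c)
    (ext_tmul j op fun s m => by
      rw [LinearMap.add_apply, act_tmul, act_tmul, act_tmul, add_smul, tmul_add]) x
  zero_smul x := LinearMap.congr_fun (f := act j op 0) (g := 0)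
    (ext_tmul j op fun s m => by
      rw [act_tmul, zero_smul, LinearMap.zero_apply]
      unfold tmul
      rw [map_zero, TensorProduct.tmul_zero, map_zero]
      rfl) x

lemma smul_tmul_left (s s' : S) (m : M) : s • tmul j op s' m = tmul j op (s * s') m := rfl

lemma smul_tmul_right (a : A) (s : S) (m : M) : a • tmul j op s m = tmul j op s (a • m) := rfl

instance : SMulCommClass S A (BalTensor j op) where
  smul_comm s a x := ((act j op a).map_smul s x).symm

end BalTensor

end BalTensor

/-! ### The semisimple Lie algebra and its subalgebras -/

variable {𝔤 : Type*} [LieRing 𝔤] [LieAlgebra ℂ 𝔤]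

/-- The algebra homomorphism `U(𝔞) → U(𝔠)` induced by an inclusion `𝔞 ≤ 𝔠` of subalgebras of `𝔤`. -/
def inclU {𝔞 𝔠 : LieSubalgebra ℂ 𝔤} (h : 𝔞 ≤ 𝔠) : U(𝔞) →ₐ[ℂ] U(𝔠) :=
  UniversalEnvelopingAlgebra.lift ℂ ((ιU : 𝔠 →ₗ⁅ℂ⁆ U(𝔠)).comp (LieSubalgebra.inclusion h))

/-- The transpose antiautomorphism of `𝔤`: a linear bijection `τ` with `τ[x, y] = [τ y, τ x]` which
is the identity on the Cartan subalgebra `H`. Such a `τ` necessarily satisfies `τ² = 1` and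
interchanges the root spaces of `α` and `-α`; these are exactly the maps with `τ(e_α) = f_α`,
`τ(f_α) = e_α` (`α` simple) and `τ|_H = id` for the different choices of Chevalley generators. -/
structure Transpose (H : LieSubalgebra ℂ 𝔤) where
  toEquiv : 𝔤 ≃ₗ[ℂ] 𝔤
  map_lie : ∀ x y : 𝔤, toEquiv ⁅x, y⁆ = ⁅toEquiv y, toEquiv x⁆
  map_cartan : ∀ x ∈ H, toEquiv x = x

/-- The transpose as an algebra homomorphism from `U(𝔤)` to its opposite algebra. -/
def Transpose.toOp {H : LieSubalgebra ℂ 𝔤} (τ : Transpose H) : U(𝔤) →ₐ[ℂ] U(𝔤)ᵐᵒᵖ :=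
  UniversalEnvelopingAlgebra.lift ℂ
    { toFun := fun x => MulOpposite.op (ιU (τ.toEquiv x))
      map_add' := fun x y => by simp only [map_add, MulOpposite.op_add]
      map_smul' := fun c x => by simp only [map_smul, MulOpposite.op_smul, RingHom.id_apply]
      map_lie' := fun {x y} => by
        rw [τ.map_lie, LieHom.map_lie, LieRing.of_associative_ring_bracket,
          LieRing.of_associative_ring_bracket, MulOpposite.op_sub, MulOpposite.op_mul,
          MulOpposite.op_mul] }

/-- The transpose antiautomorphism of `U(𝔤)`. -/
def Transpose.onU {H : LieSubalgebra ℂ 𝔤} (τ : Transpose H) (u : U(𝔤)) : U(𝔤) :=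
  MulOpposite.unop (τ.toOp u)

variable {H : LieSubalgebra ℂ 𝔤} [H.IsCartanSubalgebra]

/-- The sum of the (generalised) `H`-weight spaces of `𝔤` whose weights lie in `Φ`. Only `0` and the
roots contribute; the weight space of `0` is `H`. -/
def weightSum (H : LieSubalgebra ℂ 𝔤) [H.IsCartanSubalgebra] (Φ : Set (Dual ℂ H)) :
    Submodule ℂ 𝔤 :=
  ⨆ χ ∈ Φ, (rootSpace H (χ : H → ℂ)).toSubmodule

lemma lie_mem_weightSum {Φ : Set (Dual ℂ H)} (hΦ : ∀ χ ∈ Φ, ∀ ψ ∈ Φ, χ + ψ ∈ Φ) {x y : 𝔤}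
    (hx : x ∈ weightSum H Φ) (hy : y ∈ weightSum H Φ) : ⁅x, y⁆ ∈ weightSum H Φ := by
  unfold weightSum at hx hy
  induction hx using Submodule.iSup_induction' with
  | zero => rw [zero_lie]; exact zero_mem _
  | add a c _ _ ha hc => rw [add_lie]; exact add_mem ha hc
  | mem χ a ha =>
    induction ha using Submodule.iSup_induction' with
    | zero => rw [zero_lie]; exact zero_mem _
    | add a c _ _ ha hc => rw [add_lie]; exact add_mem ha hc
    | mem hχ a ha =>
      induction hy using Submodule.iSup_induction' with
      | zero => rw [lie_zero]; exact zero_mem _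
      | add a c _ _ ha hc => rw [lie_add]; exact add_mem ha hc
      | mem ψ c hc =>
        induction hc using Submodule.iSup_induction' with
        | zero => rw [lie_zero]; exact zero_mem _
        | add a c _ _ ha hc => rw [lie_add]; exact add_mem ha hc
        | mem hψ c hc =>
          have h := lie_mem_genWeightSpace_of_mem_genWeightSpace ha hc
          exact Submodule.mem_iSup_of_mem (χ + ψ)
            (Submodule.mem_iSup_of_mem (hΦ χ hχ ψ hψ) h)

/-- `weightSum` for a set of weights closed under addition, as a Lie subalgebra. -/
def weightSubalgebra (Φ : Set (Dual ℂ H)) (hΦ : ∀ χ ∈ Φ, ∀ ψ ∈ Φ, χ + ψ ∈ Φ) :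
    LieSubalgebra ℂ 𝔤 :=
  { weightSum H Φ with lie_mem' := fun hx hy => lie_mem_weightSum hΦ hx hy }

variable [FiniteDimensional ℂ 𝔤] [LieAlgebra.IsSemisimple ℂ 𝔤]

/-- The set `Π` of simple roots. -/
def simpleRoots (b : (rootSystem H).Base) : Set (Dual ℂ H) := (rootSystem H).root '' b.support

/-- The sums of one or more simple roots; a root lies in this set if and only if it is positive. -/
def posCone (b : (rootSystem H).Base) : AddSubsemigroup (Dual ℂ H) :=
  AddSubsemigroup.closure (simpleRoots b)

/-- `𝔫`, the sum of the positive root spaces: the nilpotent radical of the Borel subalgebra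
`𝔟 = H ⊕ 𝔫` given by the choice of the base. -/
def nilp (b : (rootSystem H).Base) : LieSubalgebra ℂ 𝔤 :=
  weightSubalgebra (posCone b : Set (Dual ℂ H)) fun _ h _ h' => add_mem h h'

/-- `𝔫̄`, the sum of the negative root spaces. -/
def nilpOpp (b : (rootSystem H).Base) : LieSubalgebra ℂ 𝔤 :=
  weightSubalgebra {χ : Dual ℂ H | -χ ∈ posCone b} fun χ h ψ h' => by
    show -(χ + ψ) ∈ posCone b
    rw [neg_add]
    exact add_mem h h'

open Classical in
/-- `ρ`, the half-sum of the positive roots. -/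
def rho (b : (rootSystem H).Base) : Dual ℂ H :=
  (2⁻¹ : ℂ) • ∑ i : H.root with (rootSystem H).root i ∈ posCone b, (rootSystem H).root i

variable {b : (rootSystem H).Base}

/-- `Π_η`, the set of simple roots `α` with `η|_{𝔤_α} ≠ 0`. -/
def simpleEta (η : nilp b →ₗ⁅ℂ⁆ ℂ) : Set (Dual ℂ H) :=
  {α ∈ simpleRoots b | ∃ x : nilp b, (x : 𝔤) ∈ rootSpace H (α : H → ℂ) ∧ η x ≠ 0}

/-- The lattice spanned by `Π_η`; the roots in it are those of the root system `Σ_η` generated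
by `Π_η`. -/
def latticeEta (η : nilp b →ₗ⁅ℂ⁆ ℂ) : AddSubgroup (Dual ℂ H) := AddSubgroup.closure (simpleEta η)

open Classical in
/-- `ρ_η`, the half-sum of the positive roots in `Σ_η`. -/
def rhoEta (η : nilp b →ₗ⁅ℂ⁆ ℂ) : Dual ℂ H :=
  (2⁻¹ : ℂ) • ∑ i : H.root with
    (rootSystem H).root i ∈ posCone b ∧ (rootSystem H).root i ∈ latticeEta η, (rootSystem H).root i

/-- The Levi subalgebra `𝔩_η`, the sum of `H` and the root spaces for `Σ_η`. -/
def levi (η : nilp b →ₗ⁅ℂ⁆ ℂ) : LieSubalgebra ℂ 𝔤 :=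
  weightSubalgebra (latticeEta η : Set (Dual ℂ H)) fun _ h _ h' => add_mem h h'

/-- `𝔫^η`, the sum of the root spaces for the positive roots outside `Σ_η`. -/
def nilpUpper (η : nilp b →ₗ⁅ℂ⁆ ℂ) : Submodule ℂ 𝔤 :=
  weightSum H {χ : Dual ℂ H | χ ∈ posCone b ∧ χ ∉ latticeEta η}

lemma cartan_le_levi (η : nilp b →ₗ⁅ℂ⁆ ℂ) : H ≤ levi η := by
  intro x hx
  have h : x ∈ rootSpace H ((0 : Dual ℂ H) : H → ℂ) := by
    have h0 := LieAlgebra.toLieSubmodule_le_rootSpace_zero ℂ 𝔤 H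
    exact h0 hx
  exact Submodule.mem_iSup_of_mem (0 : Dual ℂ H)
    (Submodule.mem_iSup_of_mem (zero_mem (latticeEta η)) h)

/-! ### Characters -/

section Characters

variable {A : Type*} [CommRing A] [Algebra ℂ A]

/-- The algebra homomorphism `μ + φ : U(H) → A`, that is, the one with `x ↦ μ(x) + φ(x)` for `x` in
the Cartan subalgebra `H`. -/
def shiftedChar (φ : U(H) →ₐ[ℂ] A) (μ : Dual ℂ H) : U(H) →ₐ[ℂ] A :=
  UniversalEnvelopingAlgebra.lift ℂ
    { toFun := fun x => algebraMap ℂ A (μ x) + φ (ιU x)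
      map_add' := fun x y => by simp only [map_add]; ring
      map_smul' := fun c x => by
        have h : φ (ιU (c • x)) = c • φ (ιU x) := by rw [map_smul, map_smul]
        rw [h, LinearMap.map_smul, smul_eq_mul, map_mul, ← Algebra.smul_def, RingHom.id_apply,
          smul_add]
      map_lie' := fun {x y} => by
        rw [LieRing.of_associative_ring_bracket, mul_comm, sub_self, trivial_lie_zero]
        simp }

/-- The homomorphism `U(H) → ℂ` given by evaluation at `0 ∈ H^*`. -/
def evalZero (H : LieSubalgebra ℂ 𝔤) : U(H) →ₐ[ℂ] ℂ := UniversalEnvelopingAlgebra.lift ℂ 0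

/-- The subspace `𝔫̄_η U(𝔩_η) + U(𝔩_η) 𝔫_η` of `U(𝔩_η)`, where `𝔫_η = 𝔩_η ∩ 𝔫` and
`𝔫̄_η = 𝔩_η ∩ 𝔫̄`. -/
def hcComplement (η : nilp b →ₗ⁅ℂ⁆ ℂ) : Submodule ℂ U(levi η) :=
  Submodule.span ℂ {t | ∃ (x : levi η) (u : U(levi η)), (x : 𝔤) ∈ nilpOpp b ∧ t = ιU x * u} ⊔
  Submodule.span ℂ {t | ∃ (x : levi η) (u : U(levi η)), (x : 𝔤) ∈ nilp b ∧ t = u * ιU x}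

open Classical in
/-- The Harish-Chandra projection `p_η : U(𝔩_η) → U(H)`: the first component in the decomposition
`U(𝔩_η) = U(H) ⊕ (𝔫̄_η U(𝔩_η) + U(𝔩_η) 𝔫_η)`. -/
def harishChandra (η : nilp b →ₗ⁅ℂ⁆ ℂ) (z : U(levi η)) : U(H) :=
  if h : ∃ p : U(H), z - inclU (cartan_le_levi η) p ∈ hcComplement η then h.choose else 0

/-- The deformed infinitesimal character of `Z(𝔩_η)` with parameter `μ`, with values in `A`:
`z ↦ (μ - ρ_η + φ)(p_η(z))`. -/
def infChar (φ : U(H) →ₐ[ℂ] A) (η : nilp b →ₗ⁅ℂ⁆ ℂ) (μ : Dual ℂ H)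
    (z : Subalgebra.center ℂ U(levi η)) : A :=
  shiftedChar φ (μ - rhoEta η) (harishChandra η z)

/-- The algebra homomorphism `U(𝔫_η) → ℂ` extending the restriction of `η` to
`𝔫_η = 𝔩_η ∩ 𝔫`. -/
def etaU (η : nilp b →ₗ⁅ℂ⁆ ℂ) : U((levi η ⊓ nilp b : LieSubalgebra ℂ 𝔤)) →ₐ[ℂ] ℂ :=
  UniversalEnvelopingAlgebra.lift ℂ
    (η.comp (LieSubalgebra.inclusion (inf_le_right : levi η ⊓ nilp b ≤ nilp b)))

end Characters

/-! ### Deformed Verma modules and deformed standard and costandard Whittaker modules -/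

section Modules

variable {A : Type*} [CommRing A] [Algebra ℂ A]

/-- The deformed Verma module `M_A(lam) = U(𝔤) ⊗_{U(𝔟)} A_{lam - ρ}`. The Lie algebra `𝔟 = H ⊕ 𝔫`
acts on `A` by letting `x ∈ H` act by `(lam - ρ)(x) + φ(x)` and `𝔫` by zero. -/
abbrev Verma (b : (rootSystem H).Base) (φ : U(H) →ₐ[ℂ] A) (lam : Dual ℂ H) : Type _ :=
  BalTensor (A := A) (S := U(𝔤)) (M := A) (R := H × nilp b)
    (fun r => ιU ((r.1 : 𝔤) + (r.2 : 𝔤)))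
    (fun r => LinearMap.lsmul A A (shiftedChar φ (lam - rho b) (ιU r.1)))

/-- The generator `1 ⊗ 1` of the deformed Verma module. -/
def Verma.gen (b : (rootSystem H).Base) (φ : U(H) →ₐ[ℂ] A) (lam : Dual ℂ H) : Verma b φ lam :=
  BalTensor.tmul _ _ 1 1

/-- The `(𝔩_η, A)`-bimodule `U(𝔩_η) ⊗_{Z(𝔩_η) ⊗ U(𝔫_η)} A_{μ, η}`, where `z ⊗ u` acts on `A` by
the product of `(μ - ρ_η + φ)(p_η(z))` and `η(u)`. -/
abbrev LeviWhittaker (φ : U(H) →ₐ[ℂ] A) (η : nilp b →ₗ⁅ℂ⁆ ℂ) (μ : Dual ℂ H) : Type _ :=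
  BalTensor (A := A) (S := U(levi η)) (M := A)
    (R := Subalgebra.center ℂ U(levi η) × U((levi η ⊓ nilp b : LieSubalgebra ℂ 𝔤)))
    (fun r => (r.1 : U(levi η)) * inclU inf_le_left r.2)
    (fun r => LinearMap.lsmul A A (infChar φ η μ r.1 * algebraMap ℂ A (etaU η r.2)))

/-- The deformed standard Whittaker module
`M_A(lam, η) = U(𝔤) ⊗_{U(𝔭_η)} U(𝔩_η) ⊗_{Z(𝔩_η) ⊗ U(𝔫_η)} A_{lam - ρ + ρ_η, η}`, where
`𝔫^η` acts on the second tensor product by zero, and `𝔭_η = 𝔩_η ⊕ 𝔫^η`. -/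
abbrev StdWhittaker (φ : U(H) →ₐ[ℂ] A) (η : nilp b →ₗ⁅ℂ⁆ ℂ) (lam : Dual ℂ H) : Type _ :=
  BalTensor (A := A) (S := U(𝔤)) (M := LeviWhittaker φ η (lam - rho b + rhoEta η))
    (R := levi η × nilpUpper η)
    (fun r => ιU ((r.1 : 𝔤) + (r.2 : 𝔤)))
    (fun r => Module.toModuleEnd A (LeviWhittaker φ η (lam - rho b + rhoEta η))
      (ιU r.1 : U(levi η)))

/-- The generator `1 ⊗ 1 ⊗ 1` of the deformed standard Whittaker module. -/
def StdWhittaker.gen (φ : U(H) →ₐ[ℂ] A) (η : nilp b →ₗ⁅ℂ⁆ ℂ) (lam : Dual ℂ H) :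
    StdWhittaker φ η lam :=
  BalTensor.tmul _ _ 1 (BalTensor.tmul _ _ 1 1)

/-- The `A`-module underlying `Hom_{U(𝔟̄)}(U(𝔤), A_{lam - ρ})`; on `A_{lam - ρ}` the elements `x ∈ H`
act by `(lam - ρ)(x) + φ(x)` and those of `𝔫̄` by zero. -/
def coindSubmodule (b : (rootSystem H).Base) (φ : U(H) →ₐ[ℂ] A) (lam : Dual ℂ H) :
    Submodule A (U(𝔤) →ₗ[ℂ] A) where
  carrier := {G |
    (∀ (x : H) (u : U(𝔤)), G (ιU (x : 𝔤) * u) = shiftedChar φ (lam - rho b) (ιU x) * G u) ∧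
    (∀ (x : nilpOpp b) (u : U(𝔤)), G (ιU (x : 𝔤) * u) = 0)}
  zero_mem' := ⟨fun x u => by simp, fun x u => by simp⟩
  add_mem' := fun {F G} hF hG =>
    ⟨fun x u => by rw [LinearMap.add_apply, hF.1, hG.1, LinearMap.add_apply, mul_add],
      fun x u => by rw [LinearMap.add_apply, hF.2, hG.2, add_zero]⟩
  smul_mem' := fun a F hF =>
    ⟨fun x u => by
      rw [LinearMap.smul_apply, hF.1, LinearMap.smul_apply, smul_eq_mul, smul_eq_mul]; ring,
      fun x u => by rw [LinearMap.smul_apply, hF.2, smul_zero]⟩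

/-- `Hom_{U(𝔟̄)}(U(𝔤), A_{lam - ρ})`. -/
def Coind (b : (rootSystem H).Base) (φ : U(H) →ₐ[ℂ] A) (lam : Dual ℂ H) : Type _ :=
  coindSubmodule b φ lam

instance (φ : U(H) →ₐ[ℂ] A) (lam : Dual ℂ H) : AddCommGroup (Coind b φ lam) :=
  inferInstanceAs (AddCommGroup (coindSubmodule b φ lam))

instance (φ : U(H) →ₐ[ℂ] A) (lam : Dual ℂ H) : Module A (Coind b φ lam) :=
  inferInstanceAs (Module A (coindSubmodule b φ lam))

/-- The underlying function `U(𝔤) → A` of an element of `Hom_{U(𝔟̄)}(U(𝔤), A_{lam - ρ})`. -/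
def Coind.toLin {φ : U(H) →ₐ[ℂ] A} {lam : Dual ℂ H} (G : Coind b φ lam) : U(𝔤) →ₗ[ℂ] A :=
  (show coindSubmodule b φ lam from G).1

/-- `U(𝔤)` acts by `(x · G)(u) = G(u x)`. -/
instance (φ : U(H) →ₐ[ℂ] A) (lam : Dual ℂ H) : Module U(𝔤) (Coind b φ lam) where
  smul x G := ⟨G.toLin ∘ₗ LinearMap.mulRight ℂ x,
    fun y u => by
      rw [LinearMap.comp_apply, LinearMap.mulRight_apply, mul_assoc]
      exact G.2.1 y (u * x),
    fun y u => by
      rw [LinearMap.comp_apply, LinearMap.mulRight_apply, mul_assoc]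
      exact G.2.2 y (u * x)⟩
  one_smul G := Subtype.ext (LinearMap.ext fun u => congrArg G.toLin (mul_one u))
  mul_smul x y G := Subtype.ext (LinearMap.ext fun u => congrArg G.toLin (mul_assoc u x y).symm)
  smul_zero x := Subtype.ext (LinearMap.ext fun u => rfl)
  smul_add x F G := Subtype.ext (LinearMap.ext fun u => rfl)
  add_smul x y G := Subtype.ext (LinearMap.ext fun u =>
    (congrArg G.toLin (mul_add u x y)).trans (map_add G.toLin _ _))
  zero_smul G := Subtype.ext (LinearMap.ext fun u =>
    (congrArg G.toLin (mul_zero u)).trans (map_zero G.toLin))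

instance (φ : U(H) →ₐ[ℂ] A) (lam : Dual ℂ H) : SMulCommClass U(𝔤) A (Coind b φ lam) where
  smul_comm _ _ _ := rfl

/-- The submodule `(V)_η` of `η`-twisted `𝔫`-finite vectors: those `v` for which there is a `k` with
`(x - η(x))^k v = 0` for all `x ∈ 𝔫`. -/
def twistedFinite (A : Type*) [CommRing A] (η : nilp b →ₗ⁅ℂ⁆ ℂ) (V : Type*) [AddCommGroup V]
    [Module A V] [Module U(𝔤) V] [SMulCommClass U(𝔤) A V] : Submodule A V where
  carrier := {v | ∃ k : ℕ, ∀ x : nilp b,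
    (ιU (x : 𝔤) - algebraMap ℂ U(𝔤) (η x)) ^ k • v = 0}
  zero_mem' := ⟨0, fun x => smul_zero _⟩
  add_mem' := fun {v w} ⟨k, hk⟩ ⟨l, hl⟩ => ⟨k + l, fun x => by
    rw [smul_add, pow_add, mul_smul _ _ w, hl x, ← pow_add, add_comm k l, pow_add, mul_smul, hk x,
      smul_zero, smul_zero, add_zero]⟩
  smul_mem' := fun a v ⟨k, hk⟩ => ⟨k, fun x => by rw [smul_comm, hk x, smul_zero]⟩

/-- The deformed costandard Whittaker module
`M_A^∨(lam, η) = (Hom_{U(𝔟̄)}(U(𝔤), A_{lam - ρ}))_η`, with the actions of `U(𝔤)` and `A`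
restricted from the coinduced bimodule. -/
abbrev CostdWhittaker (φ : U(H) →ₐ[ℂ] A) (η : nilp b →ₗ⁅ℂ⁆ ℂ) (lam : Dual ℂ H) :
    Submodule A (Coind b φ lam) :=
  twistedFinite A η (Coind b φ lam)

/-- The `A`-module `Ψ_A(V, W)` of `A`-contravariant pairings between `(𝔤, A)`-bimodules:
`A`-bilinear maps with values in `A` such that `(u v, w) = (v, τ(u) w)` for `u ∈ U(𝔤)`. -/
def contravariantPairings (A : Type*) [CommRing A] (τ : Transpose H) (V W : Type*)
    [AddCommGroup V] [Module A V] [Module U(𝔤) V] [AddCommGroup W] [Module A W] [Module U(𝔤) W] :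
    Submodule A (V →ₗ[A] W →ₗ[A] A) where
  carrier := {B | ∀ (u : U(𝔤)) (v : V) (w : W), B (u • v) w = B v (τ.onU u • w)}
  zero_mem' := fun u v w => rfl
  add_mem' := fun {B C} hB hC u v w => by
    simp only [LinearMap.add_apply, hB u v w, hC u v w]
  smul_mem' := fun a B hB u v w => by
    simp only [LinearMap.smul_apply, hB u v w]

end Modules

end WhittakerPairing

end

open WhittakerPairing

noncomputable section

namespace WhittakerPairing

/-! ### Straightening and equivariant linear forms for a general enveloping algebra. -/

section Enveloping

open UniversalEnvelopingAlgebra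

variable {K : Type*} [CommRing K] {L : Type*} [LieRing L] [LieAlgebra K L]

/-! A contravariant pairing `C` is determined by the linear form `G(u) = C(w, u v)` on `U(𝔤)`, since
`C(u w, u' v) = G(τ(u) u')` and both modules are generated by `w` and `v` over `U(𝔤)` and `A`. The
relations for `v` make `G` equivariant from the right under `𝔟` (`H` through `lam - ρ + φ`, `𝔫` by
zero). Since `w` is a Whittaker vector, `G` is equivariant from the left under `𝔫̄ = τ(𝔫)`, through
the character `η ∘ τ⁻¹`. As `U(𝔤) = U(𝔫̄) U(𝔟)`, such a form is a multiple of any one normalised at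
`1` (`IsBiequivariant.eq_smul`). This gives uniqueness, freeness of rank one, and the reduction
modulo the maximal ideal, where both reduced forms obey the same equivariance.

Existence of `G` comes from `exists_biequivariant_form`: the module induced from the character of
`𝔟` is realised by an explicit action of `𝔤` on `A ⊗ U(𝔫̄)`, so that no PBW basis is needed, and `G`
is the matrix coefficient of the generator against the form `ψ`, the left character.

It remains to see that `G` respects the relations of the standard Whittaker module. The summand
`𝔫^η` acts by zero because it is normalised by `𝔩_η` and `η` vanishes on it: every non-simple
positive root space is a bracket of positive root spaces (`exists_eq_lie_of_apply_coroot_pos`). The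
relation for the centre is `IsBiequivariant.center_mul`. For central `z`, the element `τ(z)`
commutes with `𝔩_η`, so `u ↦ G(τ(z) u)` is again biequivariant, hence is `G(τ(z)) G`. To find the
scalar, `G` is compared with the form `G₀` for the zero character on the left. The difference is
right equivariant and vanishes at `1`, hence vanishes on the centraliser of `H`
(`IsRightEquivariant.eq_zero_of_commute`), and `G₀` reads off the Harish-Chandra projection.

The map to the costandard module lands in the twisted-finite vectors because on `u w` the operator
`x - η(x)` acts as the commutator `[x, u]`, and these commutators are uniformly locally nilpotent
for `x ∈ 𝔫`. -/

theorem adjoin_induction_left {S : Type*} [Ring S] [Algebra K S] {s : Set S} {p : S → Prop}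
    (one : p 1) (add : ∀ u v, p u → p v → p (u + v)) (smul : ∀ (c : K) u, p u → p (c • u))
    (mul : ∀ x ∈ s, ∀ u ∈ Algebra.adjoin K s, p u → p (x * u)) {u : S}
    (hu : u ∈ Algebra.adjoin K s) : p u := by
  have h0 : p 0 := by simpa using smul 0 1 one
  rw [← Subalgebra.mem_toSubmodule, Algebra.adjoin_eq_span] at hu
  induction hu using Submodule.span_induction with
  | zero => exact h0
  | add x y _ _ hx hy => exact add x y hx hy
  | smul c x _ hx => exact smul c x hx
  | mem x hx =>
    induction hx using Submonoid.closure_induction_left with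
    | one => exact one
    | mul_left x hx y hy h =>
      exact mul x hx y
        (Submonoid.closure_le (S := (Algebra.adjoin K s).toSubmonoid).2 Algebra.subset_adjoin hy) h

/-- By the universal property `ι` lifts to a map into this subalgebra, and followed by the inclusion
it is the identity; so the inclusion is onto. -/
theorem adjoin_range_ι : Algebra.adjoin K (Set.range (ι K : L →ₗ⁅K⁆ _)) = ⊤ := by
  set S := Algebra.adjoin K (Set.range (ι K : L →ₗ⁅K⁆ _))
  let f : L →ₗ⁅K⁆ S :=
    { toFun := fun x => ⟨ι K x, Algebra.subset_adjoin ⟨x, rfl⟩⟩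
      map_add' := fun x y => Subtype.ext (map_add (ι K) x y)
      map_smul' := fun c x => Subtype.ext (map_smul (ι K) c x)
      map_lie' := fun {x y} => Subtype.ext (LieHom.map_lie (ι K) x y) }
  have h : S.val.comp (lift K f) = AlgHom.id K _ := by
    apply hom_ext
    ext x
    exact congrArg Subtype.val (lift_ι_apply K f x)
  rw [eq_top_iff]
  intro u _
  have := DFunLike.congr_fun h u
  rw [AlgHom.comp_apply, AlgHom.id_apply] at this
  exact this ▸ (lift K f u).2

theorem envelope_induction_left {p : UniversalEnvelopingAlgebra K L → Prop}
    (one : p 1) (add : ∀ u v, p u → p v → p (u + v)) (smul : ∀ (c : K) u, p u → p (c • u))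
    (mul : ∀ (x : L) u, p u → p (ι K x * u)) (u : UniversalEnvelopingAlgebra K L) : p u := by
  refine adjoin_induction_left (s := Set.range (ι K : L →ₗ⁅K⁆ _)) one add smul ?_
    (adjoin_range_ι (K := K) (L := L) ▸ Algebra.mem_top)
  rintro _ ⟨x, rfl⟩ u _ hu
  exact mul x u hu

theorem ι_mul_ι (x y : L) : ι K x * ι K y = ι K y * ι K x + ι K ⁅x, y⁆ := by
  rw [LieHom.map_lie, LieRing.of_associative_ring_bracket]; abel

/-- If `L = a + c` as vector spaces, then `U(L)` is spanned by the products of elements of the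
subalgebras generated by `a` and by `c`. -/
theorem adjoin_mul_adjoin_eq_top {a c : Submodule K L} (h : a ⊔ c = ⊤) :
    Subalgebra.toSubmodule (Algebra.adjoin K (ι K '' (a : Set L))) *
      Subalgebra.toSubmodule (Algebra.adjoin K (ι K '' (c : Set L))) = ⊤ := by
  set P := Algebra.adjoin K (ι K '' (a : Set L))
  set Q := Algebra.adjoin K (ι K '' (c : Set L))
  set T := Subalgebra.toSubmodule P * Subalgebra.toSubmodule Q
  have hTQ : ∀ t ∈ T, ∀ q ∈ Q, t * q ∈ T := by
    intro t ht q hq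
    induction ht using Submodule.mul_induction_on' with
    | mem_mul_mem p hp q' hq' =>
      rw [mul_assoc]
      exact Submodule.mul_mem_mul hp (Q.mul_mem hq' hq)
    | add x _ y _ hx hy => rw [add_mul]; exact add_mem hx hy
  have hPT : ∀ p ∈ P, ∀ t ∈ T, p * t ∈ T := by
    intro p hp t ht
    induction ht using Submodule.mul_induction_on' with
    | mem_mul_mem p' hp' q hq =>
      rw [← mul_assoc]
      exact Submodule.mul_mem_mul (P.mul_mem hp hp') hq
    | add x _ y _ hx hy => rw [mul_add]; exact add_mem hx hy
  -- The straightening step `g (x u) = x (g u) + [g, x] u`. Quantifying over all `g` in the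
  -- induction covers `[g, x]` as well, so neither subspace has to be a subalgebra.
  have hP : ∀ p ∈ P, ∀ g : L, ι K g * p ∈ T := by
    intro p hp
    refine adjoin_induction_left (p := fun p => ∀ g : L, ι K g * p ∈ T) ?_ ?_ ?_ ?_ hp
    · intro g
      obtain ⟨x, hx, y, hy, rfl⟩ := Submodule.mem_sup.1 (h ▸ Submodule.mem_top : g ∈ a ⊔ c)
      rw [mul_one, map_add]
      refine add_mem ?_ ?_
      · rw [← mul_one (ι K x)]
        exact Submodule.mul_mem_mul (Algebra.subset_adjoin ⟨x, hx, rfl⟩) Q.one_mem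
      · rw [← one_mul (ι K y)]
        exact Submodule.mul_mem_mul P.one_mem (Algebra.subset_adjoin ⟨y, hy, rfl⟩)
    · intro u v hu hv g
      rw [mul_add]; exact add_mem (hu g) (hv g)
    · intro r u hu g
      rw [mul_smul_comm]; exact T.smul_mem r (hu g)
    · rintro _ ⟨x, hx, rfl⟩ u _ hu g
      rw [← mul_assoc, ι_mul_ι, add_mul, mul_assoc]
      exact add_mem (hPT _ (Algebra.subset_adjoin ⟨x, hx, rfl⟩) _ (hu g)) (hu _)
  rw [eq_top_iff]
  rintro u -
  refine envelope_induction_left (p := fun u => u ∈ T) ?_ (fun _ _ => add_mem)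
    (fun r _ => T.smul_mem r) ?_ u
  · rw [← one_mul (1 : UniversalEnvelopingAlgebra K L)]
    exact Submodule.mul_mem_mul P.one_mem Q.one_mem
  · intro g t ht
    induction ht using Submodule.mul_induction_on' with
    | mem_mul_mem p hp q hq =>
      rw [← mul_assoc]
      exact hTQ _ (hP p hp g) _ hq
    | add x _ y _ hx hy => rw [mul_add]; exact add_mem hx hy

/-! ### The induced module of a complementary pair of subalgebras -/

section Induced

variable {A : Type*} [CommRing A] [Algebra K A] (a : LieSubalgebra K L)

variable (A) in
/-- Left multiplication of `U(a)` on `A ⊗ U(a)`. -/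
def leftMul : UniversalEnvelopingAlgebra K a →ₐ[K]
    Module.End A (A ⊗[K] UniversalEnvelopingAlgebra K a) :=
  (Module.End.baseChangeHom K A _).comp (Algebra.lmul K _)

theorem leftMul_tmul (u v : UniversalEnvelopingAlgebra K a) (r : A) :
    leftMul A a u (r ⊗ₜ v) = r ⊗ₜ (u * v) := rfl

variable (A) in
/-- The action of `a` on `Hom(L, A ⊗ U(a))`, given by `(x f)(g) = x f(g) - f([x, g])`. -/
def homAction : a →ₗ⁅K⁆ Module.End A (L →ₗ[K] A ⊗[K] UniversalEnvelopingAlgebra K a) where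
  toFun x :=
    { toFun := fun f => (leftMul A a (ι K x)).restrictScalars K ∘ₗ f - f ∘ₗ LieAlgebra.ad K L x
      map_add' := fun f g => by ext z; simp; abel
      map_smul' := fun r f => by ext z; simp [smul_sub] }
  map_add' x y := by ext f z; simp; abel
  map_smul' r x := by ext f z; simp [smul_sub]
  map_lie' {x y} := by
    ext f z
    simp only [LieHom.map_lie, LieRing.of_associative_ring_bracket, LinearMap.coe_mk,
      AddHom.coe_mk, LinearMap.sub_apply, LinearMap.comp_apply, LinearMap.restrictScalars_apply,
      Module.End.mul_apply, LieAlgebra.ad_apply, LieSubalgebra.coe_bracket, map_sub, map_mul]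
    abel

variable {a}

theorem homAction_apply (x : a) (f : L →ₗ[K] A ⊗[K] UniversalEnvelopingAlgebra K a) (g : L) :
    homAction A a x f g = leftMul A a (ι K x) (f g) - f ⁅(x : L), g⁆ := rfl

/-- The `U(a)`-linear map from `A ⊗ U(a)` to `Hom(L, A ⊗ U(a))` with prescribed value at the
generator. -/
def inducedHom (p : L →ₗ[K] A ⊗[K] UniversalEnvelopingAlgebra K a) :
    A ⊗[K] UniversalEnvelopingAlgebra K a →ₗ[A] L →ₗ[K] A ⊗[K] UniversalEnvelopingAlgebra K a :=
  LinearMap.liftBaseChange A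
    ((LinearMap.applyₗ p).restrictScalars K ∘ₗ (lift K (homAction A a)).toLinearMap)

theorem inducedHom_one (p : L →ₗ[K] A ⊗[K] UniversalEnvelopingAlgebra K a) :
    inducedHom p (1 ⊗ₜ 1) = p := by
  simp [inducedHom]

/-- Linearity over `a`, evaluated at `g`, becomes the commutation rule `g x = x g - [x, g]` which
any action of `L` extending left multiplication must satisfy. -/
theorem inducedHom_leftMul (p : L →ₗ[K] A ⊗[K] UniversalEnvelopingAlgebra K a) (x : a)
    (v : A ⊗[K] UniversalEnvelopingAlgebra K a) (g : L) :
    inducedHom p (leftMul A a (ι K x) v) g =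
      leftMul A a (ι K x) (inducedHom p v g) - inducedHom p v ⁅(x : L), g⁆ := by
  rw [← homAction_apply]
  refine DFunLike.congr_fun ?_ g
  induction v using TensorProduct.induction_on with
  | zero => simp
  | add v w hv hw => simp only [map_add, hv, hw]
  | tmul r u =>
    rw [leftMul_tmul]
    simp only [inducedHom, LinearMap.liftBaseChange_tmul, LinearMap.comp_apply,
      LinearMap.restrictScalars_apply, AlgHom.toLinearMap_apply, map_mul, lift_ι_apply,
      LinearMap.applyₗ_apply_apply, Module.End.mul_apply, map_smul]

theorem tensor_induction_left {p : A ⊗[K] UniversalEnvelopingAlgebra K a → Prop}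
    (one : p (1 ⊗ₜ 1)) (add : ∀ v w, p v → p w → p (v + w)) (smul : ∀ (r : A) v, p v → p (r • v))
    (mul : ∀ (x : a) v, p v → p (leftMul A a (ι K x) v))
    (v : A ⊗[K] UniversalEnvelopingAlgebra K a) : p v := by
  have key : ∀ u : UniversalEnvelopingAlgebra K a, p ((1 : A) ⊗ₜ u) := by
    refine envelope_induction_left one ?_ ?_ ?_
    · intro u v hu hv
      rw [TensorProduct.tmul_add]; exact add _ _ hu hv
    · intro c u hu
      have : (1 : A) ⊗ₜ[K] (c • u) = (algebraMap K A c) • ((1 : A) ⊗ₜ[K] u) := by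
        rw [TensorProduct.tmul_smul, algebraMap_smul]
      rw [this]; exact smul _ _ hu
    · intro x u hu
      exact mul x _ hu
  induction v using TensorProduct.induction_on with
  | zero => simpa using smul 0 _ one
  | add v w hv hw => exact add _ _ hv hw
  | tmul r u =>
    have := smul r _ (key u)
    rwa [TensorProduct.smul_tmul', smul_eq_mul, mul_one] at this

/-- Let `L = a ⊕ c` be the sum of two subalgebras, `ψ` a character of `a` and `χ` a character of `c`
with values in `A`. Then there is a linear form on `U(L)` which is `ψ`-equivariant from the left
and `χ`-equivariant from the right. -/
theorem exists_biequivariant_form {a c : LieSubalgebra K L}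
    (h : IsCompl a.toSubmodule c.toSubmodule) (ψ : a →ₗ⁅K⁆ K) (χ : L →ₗ[K] A)
    (hχ : ∀ x ∈ c, ∀ y ∈ c, χ ⁅x, y⁆ = 0) (hχa : ∀ x ∈ a, χ x = 0) :
    ∃ G : UniversalEnvelopingAlgebra K L →ₗ[K] A, G 1 = 1 ∧
      (∀ (x : a) u, G (ι K (x : L) * u) = ψ x • G u) ∧
      ∀ y ∈ c, ∀ u, G (u * ι K y) = χ y * G u := by
  let π : L →ₗ[K] a := Submodule.projectionOnto a.toSubmodule _ h
  have hπa : ∀ x : a, π x = x := fun x => Submodule.projectionOnto_apply_left h x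
  have hπc : ∀ y ∈ c, π y = 0 := fun y hy => (Submodule.projectionOnto_apply_eq_zero_iff h).2 hy
  -- The action on the generator: the `a`-component multiplies, the `c`-component acts by the scalar
  -- `χ`.
  let p : L →ₗ[K] A ⊗[K] UniversalEnvelopingAlgebra K a :=
    TensorProduct.mk K A _ 1 ∘ₗ (ι K : a →ₗ⁅K⁆ _).toLinearMap ∘ₗ π +
      (TensorProduct.mk K A _).flip 1 ∘ₗ χ
  have hp : ∀ g, p g = 1 ⊗ₜ (ι K (π g)) + χ g ⊗ₜ 1 := fun g => rfl
  -- This realises the module induced from the character `χ` of `c` on `A ⊗ U(a)`. The commutation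
  -- rule with `a` forces the action once it is known on the generator.
  let ρ : L →ₗ[K] Module.End A (A ⊗[K] UniversalEnvelopingAlgebra K a) :=
    { toFun := fun g =>
        { toFun := fun v => inducedHom p v g
          map_add' := fun v w => by simp
          map_smul' := fun r v => by simp }
      map_add' := fun g g' => by ext; simp
      map_smul' := fun r g => by ext; simp }
  have hρ : ∀ g v, ρ g v = inducedHom p v g := fun g v => rfl
  have hρ1 : ∀ g, ρ g (1 ⊗ₜ 1) = p g := fun g => by rw [hρ, inducedHom_one]
  have hρmul : ∀ (x : a) g v, ρ g (leftMul A a (ι K x) v) =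
      leftMul A a (ι K x) (ρ g v) - ρ ⁅(x : L), g⁆ v := fun x g v => by
    simp only [hρ, inducedHom_leftMul]
  have hρa : ∀ (x : a) v, ρ x v = leftMul A a (ι K x) v := by
    intro x v
    revert x
    refine tensor_induction_left (p := fun v => ∀ x : a, ρ x v = leftMul A a (ι K x) v)
      ?_ ?_ ?_ ?_ v
    · intro x
      rw [hρ1, hp, hπa, hχa x x.2, TensorProduct.zero_tmul, add_zero, leftMul_tmul, mul_one]
    · intro v w hv hw x
      rw [map_add, map_add, hv, hw]
    · intro r v hv x
      rw [map_smul, map_smul, hv]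
    · intro y v hv x
      rw [hρmul, hv, ← LieSubalgebra.coe_bracket, hv, LieHom.map_lie,
        LieRing.of_associative_ring_bracket, map_sub, map_mul, map_mul]
      simp
  have hρc : ∀ y ∈ c, ρ y (1 ⊗ₜ 1) = χ y • (1 ⊗ₜ 1) := by
    intro y hy
    rw [hρ1, hp, hπc y hy]
    rw [map_zero, TensorProduct.tmul_zero, zero_add,
      TensorProduct.smul_tmul', smul_eq_mul, mul_one]
  -- On the generator the relation is checked for the components in `a` and `c` separately; the case
  -- of two elements of `c` uses that `χ` kills `[c, c]`. The Jacobi identity carries it over to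
  -- left multiples by `a`.
  have hlie : ∀ v g g', ρ ⁅g, g'⁆ v = ρ g (ρ g' v) - ρ g' (ρ g v) := by
    intro v
    refine tensor_induction_left
      (p := fun v => ∀ g g', ρ ⁅g, g'⁆ v = ρ g (ρ g' v) - ρ g' (ρ g v)) ?_ ?_ ?_ ?_ v
    · intro g g'
      obtain ⟨x, hx, y, hy, rfl⟩ := Submodule.mem_sup.1
        (h.sup_eq_top ▸ Submodule.mem_top : g ∈ a.toSubmodule ⊔ c.toSubmodule)
      obtain ⟨x', hx', y', hy', rfl⟩ := Submodule.mem_sup.1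
        (h.sup_eq_top ▸ Submodule.mem_top : g' ∈ a.toSubmodule ⊔ c.toSubmodule)
      have h1 : ∀ x ∈ a, ∀ g v, ρ ⁅x, g⁆ v = ρ x (ρ g v) - ρ g (ρ x v) := by
        intro x hx g v
        have e := hρa ⟨x, hx⟩
        simp only at e
        rw [e, e, hρmul ⟨x, hx⟩]
        abel
      have h2 : ρ ⁅y, y'⁆ (1 ⊗ₜ 1) = ρ y (ρ y' (1 ⊗ₜ 1)) - ρ y' (ρ y (1 ⊗ₜ 1)) := by
        rw [hρc _ (c.lie_mem hy hy'), hχ y hy y' hy', hρc y hy, hρc y' hy', map_smul, map_smul,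
          hρc y hy, hρc y' hy', smul_smul, smul_smul, mul_comm, zero_smul, sub_self]
      have h3 : ρ ⁅y, x'⁆ (1 ⊗ₜ 1) = ρ y (ρ x' (1 ⊗ₜ 1)) - ρ x' (ρ y (1 ⊗ₜ 1)) := by
        rw [← lie_skew, map_neg, LinearMap.neg_apply, h1 x' hx', neg_sub]
      simp only [lie_add, add_lie, map_add, LinearMap.add_apply, h1 x hx, h2, h3]
      abel
    · intro v w hv hw g g'
      simp only [map_add, hv, hw]
      abel
    · intro r v hv g g'
      simp only [map_smul, hv, smul_sub]
    · intro x v hv g g'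
      simp only [hρmul, map_sub]
      rw [leibniz_lie, map_add, LinearMap.add_apply, hv g g', hv _ g', hv g ⁅(x : L), g'⁆, map_sub]
      abel
  let T : UniversalEnvelopingAlgebra K L →ₐ[K]
      Module.End A (A ⊗[K] UniversalEnvelopingAlgebra K a) :=
    lift K { ρ with
      map_lie' := fun {g g'} => by
        refine LinearMap.ext fun v => ?_
        rw [LieRing.of_associative_ring_bracket]
        exact hlie v g g' }
  have hT : ∀ g, T (ι K g) = ρ g := fun g => lift_ι_apply K _ g
  -- The `A`-linear extension of `ψ`. The required form is the matrix coefficient `u ↦ F(u (1 ⊗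
  -- 1))`.
  let F : A ⊗[K] UniversalEnvelopingAlgebra K a →ₗ[A] A :=
    LinearMap.liftBaseChange A ((Algebra.linearMap K A) ∘ₗ (lift K ψ).toLinearMap)
  have hF : ∀ (x : a) v, F (leftMul A a (ι K x) v) = ψ x • F v := by
    intro x v
    induction v using TensorProduct.induction_on with
    | zero => simp
    | add v w hv hw => simp only [map_add, hv, hw, smul_add]
    | tmul r u =>
      simp only [F, leftMul_tmul, LinearMap.liftBaseChange_tmul, LinearMap.comp_apply,
        AlgHom.toLinearMap_apply, map_mul, lift_ι_apply, Algebra.linearMap_apply, smul_eq_mul,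
        Algebra.smul_def]
      ring
  refine ⟨(F.restrictScalars K) ∘ₗ (LinearMap.applyₗ (1 ⊗ₜ 1)).restrictScalars K ∘ₗ T.toLinearMap,
    ?_, ?_, ?_⟩
  · simp [F]
  · intro x u
    simp only [LinearMap.comp_apply, LinearMap.restrictScalars_apply, AlgHom.toLinearMap_apply,
      LinearMap.applyₗ_apply_apply, map_mul, Module.End.mul_apply, hT, hρa, hF]
  · intro y hy u
    simp only [LinearMap.comp_apply, LinearMap.restrictScalars_apply, AlgHom.toLinearMap_apply,
      LinearMap.applyₗ_apply_apply, map_mul, Module.End.mul_apply, hT, hρc y hy, map_smul,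
      smul_eq_mul]

end Induced

end Enveloping

end WhittakerPairing

/-! ### Weights, the triangular decomposition and the transpose. -/

namespace WhittakerPairing

set_option linter.unusedSectionVars false

open LieAlgebra LieAlgebra.IsKilling Module

variable {𝔤 : Type*} [LieRing 𝔤] [LieAlgebra ℂ 𝔤] {H : LieSubalgebra ℂ 𝔤} [H.IsCartanSubalgebra]

/-! ### Sums of weight spaces -/

section Weights

variable {Φ Ψ Ω : Set (Dual ℂ H)}

theorem mem_weightSum {χ : Dual ℂ H} (hχ : χ ∈ Φ) {x : 𝔤} (hx : x ∈ rootSpace H (χ : H → ℂ)) :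
    x ∈ weightSum H Φ :=
  Submodule.mem_iSup_of_mem χ (Submodule.mem_iSup_of_mem hχ hx)

theorem weightSum_induction {p : 𝔤 → Prop}
    (mem : ∀ χ ∈ Φ, ∀ x ∈ rootSpace H (χ : H → ℂ), p x)
    (zero : p 0) (add : ∀ x y, p x → p y → p (x + y)) {x : 𝔤} (hx : x ∈ weightSum H Φ) : p x := by
  unfold weightSum at hx
  induction hx using Submodule.iSup_induction' with
  | zero => exact zero
  | add x y _ _ hx hy => exact add x y hx hy
  | mem χ x hx =>
    induction hx using Submodule.iSup_induction' with
    | zero => exact zero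
    | add x y _ _ hx hy => exact add x y hx hy
    | mem hχ x hx => exact mem χ hχ x hx

/-- Index sets matter only through weights that occur, so `weight_trichotomy` can be applied to
arbitrary subsets of the dual. -/
theorem weightSum_le_of (h : ∀ χ ∈ Φ, rootSpace H (χ : H → ℂ) ≠ ⊥ → χ ∈ Ψ) :
    weightSum H Φ ≤ weightSum H Ψ := by
  intro x hx
  refine weightSum_induction (p := fun x => x ∈ weightSum H Ψ) ?_ (zero_mem _)
    (fun _ _ => add_mem) hx
  intro χ hχ y hy
  by_cases h0 : rootSpace H (χ : H → ℂ) = ⊥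
  · rw [h0] at hy
    rw [(LieSubmodule.mem_bot y).1 hy]
    exact zero_mem _
  · exact mem_weightSum (h χ hχ h0) hy

theorem weightSum_mono (h : Φ ⊆ Ψ) : weightSum H Φ ≤ weightSum H Ψ :=
  weightSum_le_of fun _ hχ _ => h hχ

theorem weightSum_union : weightSum H (Φ ∪ Ψ) = weightSum H Φ ⊔ weightSum H Ψ :=
  iSup_union

theorem lie_mem_weightSum_of
    (h : ∀ χ ∈ Φ, ∀ ψ ∈ Ψ, rootSpace H ((χ + ψ : Dual ℂ H) : H → ℂ) ≠ ⊥ → χ + ψ ∈ Ω) {x y : 𝔤}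
    (hx : x ∈ weightSum H Φ) (hy : y ∈ weightSum H Ψ) : ⁅x, y⁆ ∈ weightSum H Ω := by
  refine weightSum_induction (p := fun x => ⁅x, y⁆ ∈ weightSum H Ω) ?_ (by simp) ?_ hx
  · intro χ hχ x hx
    refine weightSum_induction (p := fun y => ⁅x, y⁆ ∈ weightSum H Ω) ?_ (by simp) ?_ hy
    · intro ψ hψ y hy
      have hxy : ⁅x, y⁆ ∈ rootSpace H ((χ + ψ : Dual ℂ H) : H → ℂ) :=
        lie_mem_genWeightSpace_of_mem_genWeightSpace hx hy
      exact weightSum_le_of (Φ := {χ + ψ}) (by rintro _ rfl; exact h χ hχ ψ hψ)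
        (mem_weightSum (Set.mem_singleton _) hxy)
    · intro y y' hy hy'
      rw [lie_add]; exact add_mem hy hy'
  · intro x x' hx hx'
    rw [add_lie]; exact add_mem hx hx'

variable [FiniteDimensional ℂ 𝔤]

theorem disjoint_weightSum (h : Disjoint Φ Ψ) : Disjoint (weightSum H Φ) (weightSum H Ψ) := by
  have h1 := LieModule.iSupIndep_genWeightSpace ℂ H 𝔤
  rw [← LieSubmodule.iSupIndep_toSubmodule] at h1
  have h2 := h1.comp (f := fun χ : Dual ℂ H => (χ : H → ℂ)) DFunLike.coe_injective
  exact h2.disjoint_biSup_biSup h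

variable [LieAlgebra.IsSemisimple ℂ 𝔤]

theorem weightSum_eq_top (h : ∀ χ : Dual ℂ H, rootSpace H (χ : H → ℂ) ≠ ⊥ → χ ∈ Φ) :
    weightSum H Φ = ⊤ := by
  have h1 := LieModule.iSup_genWeightSpace_eq_top' ℂ H 𝔤
  rw [← LieSubmodule.toSubmodule_inj, LieSubmodule.iSup_toSubmodule,
    LieSubmodule.top_toSubmodule] at h1
  rw [eq_top_iff, ← h1]
  refine iSup_le fun χ x hx => ?_
  exact mem_weightSum (h χ.toLinear χ.genWeightSpace_ne_bot) hx

theorem weightSum_zero : weightSum H {(0 : Dual ℂ H)} = H.toSubmodule := by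
  apply le_antisymm
  · intro x hx
    refine weightSum_induction (p := fun x => x ∈ H.toSubmodule) ?_ (zero_mem _)
      (fun _ _ => add_mem) hx
    rintro _ rfl y hy
    have : y ∈ rootSpace H (0 : H → ℂ) := hy
    rw [rootSpace_zero_eq] at this
    exact this
  · intro x hx
    refine mem_weightSum (Set.mem_singleton _) ?_
    exact LieAlgebra.toLieSubmodule_le_rootSpace_zero ℂ 𝔤 H hx

theorem lie_of_mem_rootSpace {χ : Dual ℂ H} {x : 𝔤} (hx : x ∈ rootSpace H (χ : H → ℂ)) (h : H) :
    ⁅(h : 𝔤), x⁆ = χ h • x :=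
  lie_eq_smul_of_mem_rootSpace hx h

end Weights

variable [FiniteDimensional ℂ 𝔤] [LieAlgebra.IsSemisimple ℂ 𝔤] {b : (rootSystem H).Base}

/-! ### The triangular decomposition -/

section Triangular

theorem mem_nilp {x : 𝔤} : x ∈ nilp b ↔ x ∈ weightSum H (posCone b : Set (Dual ℂ H)) := Iff.rfl

theorem mem_nilpOpp {x : 𝔤} :
    x ∈ nilpOpp b ↔ x ∈ weightSum H {χ : Dual ℂ H | -χ ∈ posCone b} := Iff.rfl

theorem mem_levi {η : nilp b →ₗ⁅ℂ⁆ ℂ} {x : 𝔤} :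
    x ∈ levi η ↔ x ∈ weightSum H (latticeEta η : Set (Dual ℂ H)) := Iff.rfl

theorem mem_nilpUpper {η : nilp b →ₗ⁅ℂ⁆ ℂ} {x : 𝔤} :
    x ∈ nilpUpper η ↔ x ∈ weightSum H {χ : Dual ℂ H | χ ∈ posCone b ∧ χ ∉ latticeEta η} := Iff.rfl

theorem mem_posCone_or_eq_zero_of_mem_closure {x : Dual ℂ H}
    (hx : x ∈ AddSubmonoid.closure (simpleRoots b)) : x ∈ posCone b ∨ x = 0 := by
  induction hx using AddSubmonoid.closure_induction with
  | mem x hx => exact .inl (AddSubsemigroup.subset_closure hx)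
  | zero => exact .inr rfl
  | add x y _ _ hx hy =>
    rcases hx with hx | rfl
    · rcases hy with hy | rfl
      · exact .inl (add_mem hx hy)
      · rw [add_zero]; exact .inl hx
    · rwa [zero_add]

theorem weight_trichotomy (b : (rootSystem H).Base) {χ : Dual ℂ H}
    (hχ : rootSpace H (χ : H → ℂ) ≠ ⊥) : χ = 0 ∨ χ ∈ posCone b ∨ -χ ∈ posCone b := by
  by_cases h0 : χ = 0
  · exact .inl h0
  · let w : LieModule.Weight ℂ H 𝔤 := ⟨χ, hχ⟩
    have hw : w.IsNonZero := fun h => h0 (DFunLike.coe_injective h)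
    let i : H.root := ⟨w, by simpa using hw⟩
    have hi : (rootSystem H).root i = χ := LinearMap.ext fun x => rfl
    right
    rcases b.root_mem_or_neg_mem i with h | h <;> rw [hi] at h
    · exact .inl ((mem_posCone_or_eq_zero_of_mem_closure h).resolve_right h0)
    · exact .inr ((mem_posCone_or_eq_zero_of_mem_closure h).resolve_right (neg_ne_zero.2 h0))

/-- The simple roots are a basis of the dual of `H`. Grading elements obtained in this way turn
questions about cones and lattices into arithmetic of natural numbers. -/
theorem exists_cartan_apply_simpleRoots (b : (rootSystem H).Base) (f : Dual ℂ H → ℂ) :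
    ∃ h : H, ∀ α ∈ simpleRoots b, α h = f α := by
  let g : Dual ℂ (Dual ℂ H) := b.toWeightBasis.constr ℂ fun i => f ((rootSystem H).root i)
  refine ⟨(evalEquiv ℂ H).symm g, ?_⟩
  rintro _ ⟨i, hi, rfl⟩
  rw [apply_evalEquiv_symm_apply]
  have := b.toWeightBasis.constr_basis ℂ (fun i => f ((rootSystem H).root i)) ⟨i, hi⟩
  rwa [b.toWeightBasis_apply] at this

theorem exists_height_element (b : (rootSystem H).Base) :
    ∃ h : H, (∀ α ∈ simpleRoots b, α h = 1) ∧ ∀ χ ∈ posCone b, ∃ n : ℕ, χ h = n + 1 := by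
  obtain ⟨h, hh⟩ := exists_cartan_apply_simpleRoots b fun _ => 1
  refine ⟨h, hh, fun χ hχ => ?_⟩
  induction hχ using AddSubsemigroup.closure_induction with
  | mem x hx => exact ⟨0, by simp [hh x hx]⟩
  | add x y _ _ hx hy =>
    obtain ⟨m, hm⟩ := hx
    obtain ⟨n, hn⟩ := hy
    exact ⟨m + n + 1, by rw [LinearMap.add_apply, hm, hn]; push_cast; ring⟩

theorem zero_notMem_posCone : (0 : Dual ℂ H) ∉ posCone b := by
  obtain ⟨h, -, hh⟩ := exists_height_element b
  intro h0
  obtain ⟨n, hn⟩ := hh 0 h0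
  rw [LinearMap.zero_apply] at hn
  exact Nat.cast_add_one_ne_zero n hn.symm

theorem neg_notMem_posCone {χ : Dual ℂ H} (hχ : χ ∈ posCone b) : -χ ∉ posCone b := fun h =>
  zero_notMem_posCone (b := b) (by simpa using add_mem hχ h)

variable (b) in
/-- The Borel subalgebra `H ⊕ 𝔫`. -/
def borel : LieSubalgebra ℂ 𝔤 :=
  weightSubalgebra ({0} ∪ (posCone b : Set (Dual ℂ H))) fun χ hχ ψ hψ => by
    rcases hχ with rfl | hχ
    · rwa [zero_add]
    · rcases hψ with rfl | hψ
      · rw [add_zero]; exact .inr hχ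
      · exact .inr ((posCone b).add_mem hχ hψ)

theorem borel_eq_sup : (borel b).toSubmodule = H.toSubmodule ⊔ (nilp b).toSubmodule := by
  rw [← weightSum_zero (H := H)]
  exact weightSum_union (H := H) (Φ := {0}) (Ψ := (posCone b : Set (Dual ℂ H)))

theorem mem_borel {x : 𝔤} : x ∈ borel b ↔ ∃ h ∈ H, ∃ n ∈ nilp b, h + n = x := by
  rw [← LieSubalgebra.mem_toSubmodule, borel_eq_sup, Submodule.mem_sup]
  rfl

theorem cartan_le_borel {x : 𝔤} (hx : x ∈ H) : x ∈ borel b :=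
  mem_borel.2 ⟨x, hx, 0, zero_mem _, add_zero x⟩

theorem nilp_le_borel {x : 𝔤} (hx : x ∈ nilp b) : x ∈ borel b :=
  mem_borel.2 ⟨0, zero_mem _, x, hx, zero_add x⟩

theorem isCompl_nilpOpp_borel : IsCompl (nilpOpp b).toSubmodule (borel b).toSubmodule := by
  constructor
  · refine disjoint_weightSum (Set.disjoint_left.2 ?_)
    rintro χ hχ (rfl | hχ')
    · exact zero_notMem_posCone (b := b) (by simpa using hχ)
    · exact neg_notMem_posCone hχ' hχ
  · rw [codisjoint_iff]
    refine (weightSum_union (H := H) (Φ := {χ : Dual ℂ H | -χ ∈ posCone b})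
      (Ψ := {0} ∪ (posCone b : Set (Dual ℂ H)))).symm.trans (weightSum_eq_top fun χ hχ => ?_)
    rcases weight_trichotomy b hχ with h | h | h
    · exact .inr (.inl h)
    · exact .inr (.inr h)
    · exact .inl h

theorem lie_cartan_nilp {x y : 𝔤} (hx : x ∈ H) (hy : y ∈ nilp b) : ⁅x, y⁆ ∈ nilp b := by
  refine lie_mem_weightSum_of (H := H) (Φ := {0}) (Ψ := (posCone b : Set (Dual ℂ H))) ?_
    ((weightSum_zero (H := H)).ge hx) hy
  rintro _ rfl ψ hψ -
  rwa [zero_add]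

theorem lie_cartan_cartan {x y : 𝔤} (hx : x ∈ H) (hy : y ∈ H) : ⁅x, y⁆ = 0 :=
  congrArg Subtype.val (trivial_lie_zero H H ⟨x, hx⟩ ⟨y, hy⟩)

theorem lie_borel_borel {x y : 𝔤} (hx : x ∈ borel b) (hy : y ∈ borel b) : ⁅x, y⁆ ∈ nilp b := by
  obtain ⟨h, hh, n, hn, rfl⟩ := mem_borel.1 hx
  obtain ⟨h', hh', n', hn', rfl⟩ := mem_borel.1 hy
  rw [add_lie, lie_add, lie_add, lie_cartan_cartan hh hh', zero_add]
  refine add_mem (lie_cartan_nilp hh hn') (add_mem ?_ ((nilp b).lie_mem hn hn'))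
  rw [← lie_skew]
  exact neg_mem (lie_cartan_nilp hh' hn)

theorem isCompl_cartan :
    IsCompl H.toSubmodule (weightSum H ({(0 : Dual ℂ H)}ᶜ : Set (Dual ℂ H))) := by
  rw [← weightSum_zero]
  constructor
  · exact disjoint_weightSum disjoint_compl_right
  · rw [codisjoint_iff, ← weightSum_union]
    exact weightSum_eq_top fun χ _ => by simp

variable (H) in
/-- The projection of `𝔤` to `H` along the root spaces. -/
def cartanProj : 𝔤 →ₗ[ℂ] H := Submodule.projectionOnto H.toSubmodule _ isCompl_cartan

theorem cartanProj_coe (x : H) : cartanProj H (x : 𝔤) = x :=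
  Submodule.projectionOnto_apply_left isCompl_cartan x

theorem cartanProj_nilp {x : 𝔤} (hx : x ∈ nilp b) : cartanProj H x = 0 := by
  refine (Submodule.projectionOnto_apply_eq_zero_iff isCompl_cartan).2
    (weightSum_mono (fun χ hχ h0 => ?_) (mem_nilp.1 hx))
  rw [Set.mem_singleton_iff] at h0
  exact zero_notMem_posCone (b := b) (h0 ▸ hχ)

theorem cartanProj_nilpOpp {x : 𝔤} (hx : x ∈ nilpOpp b) : cartanProj H x = 0 := by
  refine (Submodule.projectionOnto_apply_eq_zero_iff isCompl_cartan).2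
    (weightSum_mono (fun χ hχ h0 => ?_) (mem_nilpOpp.1 hx))
  rw [Set.mem_singleton_iff] at h0
  exact zero_notMem_posCone (b := b) (by simpa [h0] using hχ)

end Triangular

/-! ### The transpose -/

section TransposeLemmas

variable (τ : Transpose H)

/-- Applying `τ` to `[h, x] = χ(h) x` reverses the bracket and fixes `h`, which negates the weight.
-/
theorem Transpose.mem_weightSum {Φ : Set (Dual ℂ H)} {x : 𝔤} (hx : x ∈ weightSum H Φ) :
    τ.toEquiv x ∈ weightSum H {χ | -χ ∈ Φ} := by
  refine weightSum_induction (p := fun x => τ.toEquiv x ∈ weightSum H {χ | -χ ∈ Φ}) ?_ (by simp)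
    ?_ hx
  · intro χ hχ y hy
    refine WhittakerPairing.mem_weightSum (χ := -χ) (by simpa using hχ) ?_
    refine LieModule.weightSpace_le_genWeightSpace _ _ ?_
    rw [LieModule.mem_weightSpace]
    intro h
    have := congrArg τ.toEquiv (lie_of_mem_rootSpace hy h)
    rw [τ.map_lie, τ.map_cartan h h.2, map_smul, ← lie_skew, neg_eq_iff_eq_neg] at this
    rw [LieSubalgebra.coe_bracket_of_module, this]
    simp
  · intro x y hx hy
    rw [map_add]; exact add_mem hx hy

/-- The inverse of a transpose. -/
def Transpose.symm : Transpose H where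
  toEquiv := τ.toEquiv.symm
  map_lie x y := by
    rw [LinearEquiv.symm_apply_eq, τ.map_lie]; simp
  map_cartan x hx := by
    rw [LinearEquiv.symm_apply_eq, τ.map_cartan x hx]

theorem Transpose.nilp_mem {x : 𝔤} (hx : x ∈ nilp b) : τ.toEquiv x ∈ nilpOpp b :=
  τ.mem_weightSum (mem_nilp.1 hx)

theorem Transpose.nilpOpp_mem {x : 𝔤} (hx : x ∈ nilpOpp b) : τ.toEquiv x ∈ nilp b :=
  weightSum_mono (H := H) (fun χ hχ => by simpa using hχ) (τ.mem_weightSum (mem_nilpOpp.1 hx))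

theorem Transpose.levi_mem {η : nilp b →ₗ⁅ℂ⁆ ℂ} {x : 𝔤} (hx : x ∈ levi η) :
    τ.toEquiv x ∈ levi η :=
  weightSum_mono (H := H) (fun χ hχ => by simpa using hχ) (τ.mem_weightSum (mem_levi.1 hx))

theorem Transpose.onU_one : τ.onU 1 = 1 := by simp [Transpose.onU]

theorem Transpose.onU_ι (x : 𝔤) : τ.onU (ιU x) = ιU (τ.toEquiv x) := by
  simp only [Transpose.onU, Transpose.toOp, UniversalEnvelopingAlgebra.lift_ι_apply]
  rfl

theorem Transpose.onU_mul (u v : U(𝔤)) : τ.onU (u * v) = τ.onU v * τ.onU u := by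
  simp [Transpose.onU]

theorem Transpose.onU_add (u v : U(𝔤)) : τ.onU (u + v) = τ.onU u + τ.onU v := by
  simp [Transpose.onU]

theorem Transpose.onU_smul (c : ℂ) (u : U(𝔤)) : τ.onU (c • u) = c • τ.onU u := by
  simp [Transpose.onU]

/-- The transpose of `U(𝔤)` as a linear map. -/
def Transpose.onULin : U(𝔤) →ₗ[ℂ] U(𝔤) where
  toFun := τ.onU
  map_add' := τ.onU_add
  map_smul' := τ.onU_smul

theorem Transpose.onULin_apply (u : U(𝔤)) : τ.onULin u = τ.onU u := rfl

theorem Transpose.onU_symm_onU (u : U(𝔤)) : τ.onU (τ.symm.onU u) = u := by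
  refine envelope_induction_left (p := fun u => τ.onU (τ.symm.onU u) = u) ?_ ?_ ?_ ?_ u
  · rw [onU_one, onU_one]
  · intro u v hu hv
    rw [onU_add, onU_add, hu, hv]
  · intro c u hu
    rw [onU_smul, onU_smul, hu]
  · intro x u hu
    rw [onU_mul, onU_mul, hu, onU_ι, onU_ι]
    exact congrArg (fun y => ιU y * u) (τ.toEquiv.apply_symm_apply x)

theorem Transpose.symm_onU_onU (u : U(𝔤)) : τ.symm.onU (τ.onU u) = u :=
  τ.symm.onU_symm_onU u

end TransposeLemmas

end WhittakerPairing

/-! ### Brackets of root spaces, the Levi subalgebra, and vanishing of the character outside it. -/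

namespace WhittakerPairing

set_option linter.unusedSectionVars false

open LieAlgebra LieAlgebra.IsKilling Module

variable {𝔤 : Type*} [LieRing 𝔤] [LieAlgebra ℂ 𝔤] {H : LieSubalgebra ℂ 𝔤} [H.IsCartanSubalgebra]

variable [FiniteDimensional ℂ 𝔤] [LieAlgebra.IsSemisimple ℂ 𝔤] {b : (rootSystem H).Base}

/-! ### Brackets of root spaces -/

section Brackets

/-- If the pairing of `β` with the coroot of `α` is positive, then
`𝔤_β` is contained in `[𝔤_α, 𝔤_(β - α)]`. -/
theorem exists_eq_lie_of_apply_coroot_pos {α β : LieModule.Weight ℂ H 𝔤} (hα : α.IsNonZero)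
    (hβ : β.IsNonZero) {m : ℕ} (hm : β (coroot α) = m) (hm0 : 0 < m) {x : 𝔤}
    (hx : x ∈ rootSpace H β) :
    ∃ e ∈ rootSpace H α, ∃ y ∈ rootSpace H (-(α : H → ℂ) + β), x = ⁅e, y⁆ := by
  by_cases hx0 : x = 0
  · exact ⟨0, zero_mem _, 0, zero_mem _, by simp [hx0]⟩
  obtain ⟨h, e, f, ht, he, hf⟩ := exists_isSl2Triple_of_weight_isNonZero hα
  have hh := ht.h_eq_coroot hα he hf
  have hhx : ⁅h, x⁆ = (m : ℂ) • x := by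
    rw [hh, ← hm]; exact lie_eq_smul_of_mem_rootSpace hx _
  have hnil : ∃ n, ((LieModule.toEnd ℂ 𝔤 𝔤 e) ^ n) x = 0 := by
    obtain ⟨n, hn⟩ := LieAlgebra.isNilpotent_ad_of_mem_rootSpace (K := ℂ) H
      (χ := (α : H → ℂ)) hα he
    refine ⟨n, ?_⟩
    have : (LieModule.toEnd ℂ 𝔤 𝔤 e) ^ n = 0 := hn
    rw [this, LinearMap.zero_apply]
  -- Raise `x` to the top of its `α`-string. This gives a primitive vector of weight `m + 2 p` for
  -- the `sl₂`-triple.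
  obtain ⟨p, hp, hp'⟩ := Nat.exists_not_and_succ_of_not_zero_of_exists
    (p := fun n => ((LieModule.toEnd ℂ 𝔤 𝔤 e) ^ n) x = 0) (by simpa using hx0) hnil
  set v := ((LieModule.toEnd ℂ 𝔤 𝔤 e) ^ p) x
  have hprim : ht.HasPrimitiveVectorWith v ((m : ℂ) + 2 * p) :=
    { ne_zero := hp
      lie_h := ht.lie_h_pow_toEnd_e hhx p
      lie_e := by rw [IsSl2Triple.lie_e_pow_toEnd_e]; exact hp' }
  have hv : v ∈ rootSpace H (p • (α : H → ℂ) + β) := toEnd_pow_apply_mem he hx p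
  -- Since `p ≤ m + 2 p`, lowering `p` times gives a nonzero vector. It lies in the one-dimensional
  -- space of `β`, so `x` is a multiple of it.
  have hy0 : ((LieModule.toEnd ℂ 𝔤 𝔤 f) ^ p) v ≠ 0 :=
    hprim.pow_toEnd_f_ne_zero_of_eq_nat (n := m + 2 * p) (by push_cast; ring) (by omega)
  have hy : ((LieModule.toEnd ℂ 𝔤 𝔤 f) ^ p) v ∈ rootSpace H β := by
    have := toEnd_pow_apply_mem hf hv p
    rwa [smul_neg, neg_add_cancel_left] at this
  have hz : ((LieModule.toEnd ℂ 𝔤 𝔤 f) ^ (p + 1)) v ∈ rootSpace H (-(α : H → ℂ) + β) := by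
    have := toEnd_pow_apply_mem hf hv (p + 1)
    rwa [smul_neg, succ_nsmul', neg_add, add_assoc, neg_add_cancel_left] at this
  obtain ⟨c, hc⟩ := (finrank_eq_one_iff_of_nonzero'
    (⟨_, hy⟩ : rootSpace H β) (by simpa using hy0)).1 (finrank_rootSpace_eq_one β hβ) ⟨x, hx⟩
  replace hc := congrArg Subtype.val hc
  change c • ((LieModule.toEnd ℂ 𝔤 𝔤 f) ^ p) v = x at hc
  -- The scalar by which `e f^(p+1)` differs from `f^p` on the primitive vector. Its second factor
  -- is `m + p`, which is nonzero even for `p = 0` because `m > 0`.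
  have hd : ((p : ℂ) + 1) * ((m : ℂ) + 2 * p - p) ≠ 0 := by
    refine mul_ne_zero (Nat.cast_add_one_ne_zero p) ?_
    have : (m : ℂ) + 2 * p - p = ((m + p : ℕ) : ℂ) := by push_cast; ring
    rw [this]
    exact Nat.cast_ne_zero.2 (by omega)
  refine ⟨e, he, (c * (((p : ℂ) + 1) * ((m : ℂ) + 2 * p - p))⁻¹) •
    ((LieModule.toEnd ℂ 𝔤 𝔤 f) ^ (p + 1)) v, Submodule.smul_mem _ _ hz, ?_⟩
  rw [lie_smul, hprim.lie_e_pow_succ_toEnd_f, smul_smul, mul_assoc, inv_mul_cancel₀ hd, mul_one, hc]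

/-- The elements of `𝔫` are uniformly ad-nilpotent. -/
theorem exists_ad_pow_eq_zero (b : (rootSystem H).Base) :
    ∃ N : ℕ, ∀ x ∈ nilp b, ∀ y : 𝔤, (LieAlgebra.ad ℂ 𝔤 x ^ N) y = 0 := by
  obtain ⟨h, -, hh⟩ := exists_height_element b
  have hint : ∀ w : LieModule.Weight ℂ H 𝔤, ∃ z : ℤ, LieModule.Weight.toLinear ℂ H 𝔤 w h = z := by
    intro w
    rcases weight_trichotomy b (χ := LieModule.Weight.toLinear ℂ H 𝔤 w) w.genWeightSpace_ne_bot with h0 | h0 | h0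
    · exact ⟨0, by rw [h0]; simp⟩
    · obtain ⟨n, hn⟩ := hh _ h0
      exact ⟨n + 1, by rw [hn]; push_cast; rfl⟩
    · obtain ⟨n, hn⟩ := hh _ h0
      refine ⟨-(n + 1), ?_⟩
      rw [LinearMap.neg_apply, neg_eq_iff_eq_neg] at hn
      rw [hn]; push_cast; rfl
  choose z hz using hint
  obtain ⟨M, hM⟩ := Finite.exists_le fun w => (z w).natAbs
  have hM' : ∀ χ : Dual ℂ H, rootSpace H (χ : H → ℂ) ≠ ⊥ → ∃ k : ℤ, k.natAbs ≤ M ∧ χ h = k :=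
    fun χ hχ => ⟨z ⟨χ, hχ⟩, hM _, hz ⟨χ, hχ⟩⟩
  -- The filtration by height at least `k`; each application of `ad x` with `x ∈ 𝔫` raises it by at
  -- least one.
  let W : ℤ → Submodule ℂ 𝔤 := fun k => weightSum H {χ | ∃ l : ℤ, k ≤ l ∧ χ h = l}
  have hstep : ∀ x ∈ nilp b, ∀ y, ∀ n : ℕ, (LieAlgebra.ad ℂ 𝔤 x ^ n) y ∈ W (-M + n) := by
    intro x hx y n
    induction n with
    | zero =>
      have : W (-M + (0 : ℕ)) = ⊤ := weightSum_eq_top fun χ hχ => by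
        obtain ⟨k, hk, hk'⟩ := hM' χ hχ
        exact ⟨k, by omega, hk'⟩
      rw [this]; exact Submodule.mem_top
    | succ n ih =>
      rw [pow_succ', Module.End.mul_apply, LieAlgebra.ad_apply]
      refine lie_mem_weightSum_of ?_ (mem_nilp.1 hx) ih
      rintro χ hχ ψ ⟨l, hl, hl'⟩ -
      obtain ⟨k, hk⟩ := hh χ hχ
      refine ⟨k + 1 + l, by push_cast; omega, ?_⟩
      rw [LinearMap.add_apply, hk, hl']; push_cast; rfl
  -- All heights lie between `-M` and `M`, so `2 M + 1` steps lead from level `-M` to the empty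
  -- level `M + 1`.
  refine ⟨2 * M + 1, fun x hx y => ?_⟩
  have h1 := hstep x hx y (2 * M + 1)
  have h2 : W (-M + (2 * M + 1 : ℕ)) ≤ weightSum H ∅ := weightSum_le_of fun χ hχ h0 => by
    obtain ⟨k, hk, hk'⟩ := hM' χ h0
    obtain ⟨l, hl, hl'⟩ := hχ
    have : k = l := by exact_mod_cast hk'.symm.trans hl'
    omega
  have h3 := h2 h1
  simpa [weightSum] using h3

end Brackets

/-! ### The Levi subalgebra and the character `η` -/

section Eta

variable (η : nilp b →ₗ⁅ℂ⁆ ℂ)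

/-- Take the value `0` on `Π_η` and `1` on the other simple roots: on a sum of simple roots this
counts the summands outside `Π_η`. -/
theorem exists_levi_grading_element :
    ∃ h : H, (∀ χ ∈ latticeEta η, χ h = 0) ∧
      ∀ χ ∈ posCone b, ∃ n : ℕ, χ h = n ∧ (n = 0 → χ ∈ latticeEta η) := by
  classical
  obtain ⟨h, hh⟩ := exists_cartan_apply_simpleRoots b fun α => if α ∈ simpleEta η then 0 else 1
  refine ⟨h, fun χ hχ => ?_, fun χ hχ => ?_⟩
  · induction hχ using AddSubgroup.closure_induction with
    | mem x hx => rw [hh x hx.1, if_pos hx]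
    | zero => rfl
    | add x y _ _ hx hy => rw [LinearMap.add_apply, hx, hy, add_zero]
    | neg x _ hx => rw [LinearMap.neg_apply, hx, neg_zero]
  · induction hχ using AddSubsemigroup.closure_induction with
    | mem x hx =>
      by_cases hx' : x ∈ simpleEta η
      · exact ⟨0, by rw [hh x hx, if_pos hx', Nat.cast_zero],
          fun _ => AddSubgroup.subset_closure hx'⟩
      · exact ⟨1, by rw [hh x hx, if_neg hx', Nat.cast_one], fun h => absurd h one_ne_zero⟩
    | add x y _ _ hx hy =>
      obtain ⟨m, hm, hm'⟩ := hx
      obtain ⟨n, hn, hn'⟩ := hy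
      refine ⟨m + n, by rw [LinearMap.add_apply, hm, hn, Nat.cast_add], fun h => ?_⟩
      exact add_mem (hm' (by omega)) (hn' (by omega))

variable {η}

theorem nilpUpper_le_nilp {x : 𝔤} (hx : x ∈ nilpUpper η) : x ∈ nilp b :=
  weightSum_mono (H := H) (fun _ h => h.1) (mem_nilpUpper.1 hx)

/-- Adding an element of the lattice does not change the Levi grade. A positive weight outside the
lattice has grade at least one, so the sum can be neither zero nor negative. -/
theorem lie_nilpUpper_levi {r x : 𝔤} (hr : r ∈ nilpUpper η) (hx : x ∈ levi η) :
    ⁅r, x⁆ ∈ nilpUpper η := by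
  obtain ⟨h, h1, h2⟩ := exists_levi_grading_element η
  refine lie_mem_weightSum_of (H := H) ?_ (mem_nilpUpper.1 hr) (mem_levi.1 hx)
  rintro χ ⟨hχ, hχ'⟩ ψ hψ h0
  have hn : χ + ψ ∉ latticeEta η := fun h =>
    hχ' (by simpa using sub_mem h hψ)
  refine ⟨?_, hn⟩
  rcases weight_trichotomy b h0 with h0 | h0 | h0
  · exact absurd (h0 ▸ zero_mem _) hn
  · exact h0
  · obtain ⟨n, hn1, hn2⟩ := h2 χ hχ
    obtain ⟨k, hk1, hk2⟩ := h2 _ h0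
    rw [LinearMap.neg_apply, LinearMap.add_apply, h1 ψ hψ, add_zero, hn1,
      neg_eq_iff_add_eq_zero] at hk1
    have : n + k = 0 := by exact_mod_cast hk1
    exact absurd (hn2 (by omega)) hχ'

theorem exists_levi_add_nilpUpper {x : 𝔤} (hx : x ∈ nilp b) :
    ∃ y ∈ levi η ⊓ nilp b, ∃ r ∈ nilpUpper η, y + r = x := by
  have h : weightSum H (posCone b : Set (Dual ℂ H)) ≤
      weightSum H ({χ | χ ∈ posCone b ∧ χ ∈ latticeEta η} ∪
        {χ | χ ∈ posCone b ∧ χ ∉ latticeEta η}) :=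
    weightSum_mono fun χ hχ => by
      by_cases h : χ ∈ latticeEta η
      · exact .inl ⟨hχ, h⟩
      · exact .inr ⟨hχ, h⟩
  rw [weightSum_union] at h
  obtain ⟨y, hy, r, hr, hyr⟩ := Submodule.mem_sup.1 (h (mem_nilp.1 hx))
  exact ⟨y, ⟨weightSum_mono (H := H) (fun _ h => h.2) hy,
    weightSum_mono (H := H) (fun _ h => h.1) hy⟩, r, hr, hyr⟩

theorem exists_triangular_levi {x : 𝔤} (hx : x ∈ levi η) :
    ∃ y ∈ levi η ⊓ nilpOpp b, ∃ h ∈ H, ∃ n ∈ levi η ⊓ nilp b, y + (h + n) = x := by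
  have h : weightSum H (latticeEta η : Set (Dual ℂ H)) ≤
      weightSum H ({χ | -χ ∈ posCone b ∧ χ ∈ latticeEta η} ∪ ({0} ∪
        {χ | χ ∈ posCone b ∧ χ ∈ latticeEta η})) :=
    weightSum_le_of fun χ hχ h0 => by
      rcases weight_trichotomy b h0 with h | h | h
      · exact .inr (.inl h)
      · exact .inr (.inr ⟨h, hχ⟩)
      · exact .inl ⟨h, hχ⟩
  rw [weightSum_union, weightSum_union, weightSum_zero] at h
  obtain ⟨y, hy, z, hz, hyz⟩ := Submodule.mem_sup.1 (h (mem_levi.1 hx))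
  obtain ⟨c, hc, n, hn, rfl⟩ := Submodule.mem_sup.1 hz
  exact ⟨y, ⟨weightSum_mono (H := H) (fun _ h => h.2) hy,
    weightSum_mono (H := H) (fun _ h => h.1) hy⟩, c, hc, n,
    ⟨weightSum_mono (H := H) (fun _ h => h.2) hn,
    weightSum_mono (H := H) (fun _ h => h.1) hn⟩, hyz⟩

/-- A root is plus or minus a combination of simple roots with natural coefficients, and the height
element excludes the minus sign. -/
theorem isPos_of_root_mem_posCone {i : H.root} (hi : (rootSystem H).root i ∈ posCone b) :
    b.IsPos i := by
  obtain ⟨f, -, hf | hf⟩ := b.exists_root_eq_sum_nat_or_neg i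
  · have := RootPairing.Base.height_eq_sum (b := b) (i := i) (f := fun j => (f j : ℤ))
      (by simpa using hf)
    rw [RootPairing.Base.isPos_iff', this]
    exact Finset.sum_nonneg fun _ _ => Int.natCast_nonneg _
  · exfalso
    obtain ⟨h, -, hh⟩ := exists_height_element b
    obtain ⟨n, hn⟩ := hh _ hi
    have hs : ∀ j ∈ b.support, ∃ k : ℕ, (rootSystem H).root j h = k + 1 := fun j hj =>
      hh _ (AddSubsemigroup.subset_closure ⟨j, hj, rfl⟩)
    have hsum : ∃ k : ℕ, (∑ j ∈ b.support, f j • (rootSystem H).root j) h = k := by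
      rw [LinearMap.sum_apply]
      refine Finset.sum_induction _ (fun c : ℂ => ∃ k : ℕ, c = k) ?_ ⟨0, by simp⟩ ?_
      · rintro _ _ ⟨k, rfl⟩ ⟨l, rfl⟩
        exact ⟨k + l, by push_cast; rfl⟩
      · intro j hj
        obtain ⟨k, hk⟩ := hs j hj
        exact ⟨f j * (k + 1), by rw [LinearMap.smul_apply, hk, nsmul_eq_mul]; push_cast; rfl⟩
    obtain ⟨k, hk⟩ := hsum
    rw [hf, LinearMap.neg_apply, hk, neg_eq_iff_add_eq_zero] at hn
    have : k + (n + 1) = 0 := by exact_mod_cast hn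
    omega

/-- A simple root outside the lattice is not in `Π_η`. A positive root that is not simple pairs
positively with some simple root `α`, so its root space lies in `[𝔤_α, 𝔤_(χ-α)]`; and `η` kills
brackets because `ℂ` is abelian. -/
theorem eta_eq_zero_of_mem_rootSpace {χ : Dual ℂ H} (hχ : χ ∈ posCone b) (hχ' : χ ∉ latticeEta η)
    {x : 𝔤} (hx : x ∈ rootSpace H (χ : H → ℂ)) :
    η ⟨x, mem_nilp.2 (mem_weightSum hχ hx)⟩ = 0 := by
  by_cases h0 : rootSpace H (χ : H → ℂ) = ⊥
  · rw [h0] at hx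
    have hx0 := (LieSubmodule.mem_bot x).1 hx
    subst hx0
    exact map_zero η
  let β : LieModule.Weight ℂ H 𝔤 := ⟨χ, h0⟩
  have hβ : β.IsNonZero := fun h => zero_notMem_posCone (b := b) (by
    have : χ = 0 := DFunLike.coe_injective h
    rwa [← this])
  let i : H.root := ⟨β, by simpa using hβ⟩
  have hi : (rootSystem H).root i = χ := LinearMap.ext fun x => rfl
  obtain ⟨j, hj, hji⟩ := (isPos_of_root_mem_posCone (hi ▸ hχ)).exists_mem_support_pos_pairingIn
  have hjs : (rootSystem H).root j ∈ simpleRoots b := ⟨j, hj, rfl⟩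
  by_cases hij : χ = (rootSystem H).root j
  · by_contra hne
    exact hχ' (AddSubgroup.subset_closure ⟨hij ▸ hjs, ⟨_, mem_nilp.2 (mem_weightSum hχ hx)⟩, hx, hne⟩)
  rw [RootPairing.zero_lt_pairingIn_iff'] at hji
  have hα : (j : LieModule.Weight ℂ H 𝔤).IsNonZero := LieSubalgebra.isNonZero_coe_root j
  obtain ⟨m, hm⟩ := Int.eq_ofNat_of_zero_le hji.le
  have hpair : β (coroot (j : LieModule.Weight ℂ H 𝔤)) = m := by
    have := (rootSystem H).algebraMap_pairingIn ℤ i j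
    rw [hm, rootSystem_pairing_apply] at this
    simpa [i] using this.symm
  obtain ⟨e, he, y, hy, hxy⟩ := exists_eq_lie_of_apply_coroot_pos hα hβ hpair (by omega) hx
  set α := (rootSystem H).root j with hαdef
  have hαe : ((α : Dual ℂ H) : H → ℂ) = (j : LieModule.Weight ℂ H 𝔤) := rfl
  have hy' : y ∈ rootSpace H ((-α + χ : Dual ℂ H) : H → ℂ) := hy
  by_cases hb : rootSpace H ((-α + χ : Dual ℂ H) : H → ℂ) = ⊥
  · rw [hb] at hy'
    have hy0 := (LieSubmodule.mem_bot y).1 hy'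
    rw [hy0, lie_zero] at hxy
    subst hxy
    exact map_zero η
  -- A negative difference is impossible: `α - χ` would have positive height, while `α` has height
  -- `1` and `χ` at least `1`.
  have hpos : -α + χ ∈ posCone b := by
    rcases weight_trichotomy b hb with h | h | h
    · exact absurd (neg_add_eq_zero.1 h).symm hij
    · exact h
    · exfalso
      obtain ⟨t, ht, ht'⟩ := exists_height_element b
      obtain ⟨k, hk⟩ := ht' _ h
      obtain ⟨n, hn⟩ := ht' _ hχ
      rw [LinearMap.neg_apply, LinearMap.add_apply, LinearMap.neg_apply, ht _ hjs, hn] at hk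
      have : (k : ℂ) + 1 + n = 0 := by rw [← hk]; ring
      have : k + 1 + n = 0 := by exact_mod_cast this
      omega
  have hen : e ∈ nilp b := mem_nilp.2 (mem_weightSum (AddSubsemigroup.subset_closure hjs) he)
  have hyn : y ∈ nilp b := mem_nilp.2 (mem_weightSum hpos hy')
  have : (⟨x, mem_nilp.2 (mem_weightSum hχ hx)⟩ : nilp b) = ⁅(⟨e, hen⟩ : nilp b), ⟨y, hyn⟩⁆ :=
    Subtype.ext hxy
  rw [this, LieHom.map_lie, LieRing.of_associative_ring_bracket, mul_comm, sub_self]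

theorem eta_nilpUpper {x : 𝔤} (hx : x ∈ nilpUpper η) :
    η ⟨x, nilpUpper_le_nilp hx⟩ = 0 := by
  suffices ∃ hx : x ∈ nilp b, η ⟨x, hx⟩ = 0 by exact this.2
  refine weightSum_induction (p := fun x => ∃ hx : x ∈ nilp b, η ⟨x, hx⟩ = 0) ?_
    ⟨zero_mem _, map_zero η⟩ ?_ (mem_nilpUpper.1 hx)
  · rintro χ ⟨h1, h2⟩ x hx
    exact ⟨_, eta_eq_zero_of_mem_rootSpace h1 h2 hx⟩
  · rintro x y ⟨hx, hx'⟩ ⟨hy, hy'⟩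
    refine ⟨add_mem hx hy, ?_⟩
    have := map_add η ⟨x, hx⟩ ⟨y, hy⟩
    rw [hx', hy', add_zero] at this
    exact this

end Eta

end WhittakerPairing

/-! ### Maps out of balanced tensor products, and uniqueness of equivariant forms. -/

namespace WhittakerPairing

set_option linter.unusedSectionVars false

open LieAlgebra LieAlgebra.IsKilling Module

variable {𝔤 : Type*} [LieRing 𝔤] [LieAlgebra ℂ 𝔤] {H : LieSubalgebra ℂ 𝔤} [H.IsCartanSubalgebra]

/-! ### Universal property of the balanced tensor product -/

namespace BalTensor

attribute [local instance] RestrictScalars.moduleOrig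

variable {A : Type*} [CommRing A] [Algebra ℂ A] {S : Type*} [Ring S] [Algebra ℂ S]
  {M : Type*} [AddCommGroup M] [Module A M] {R : Type*} (j : R → S) (op : R → Module.End A M)

theorem induction_tmul {p : BalTensor j op → Prop} (tmul : ∀ s m, p (tmul j op s m))
    (add : ∀ x y, p x → p y → p (x + y)) (x : BalTensor j op) : p x := by
  obtain ⟨t, rfl⟩ := (balRel j op).mkQ_surjective x
  induction t using TensorProduct.induction_on with
  | zero =>
    have := tmul 0 0
    unfold BalTensor.tmul at this
    rwa [TensorProduct.zero_tmul] at this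
  | tmul s m => exact tmul s m
  | add x y hx hy =>
    rw [map_add]
    exact add _ _ hx hy

theorem add_tmul (s s' : S) (m : M) :
    tmul j op (s + s') m = tmul j op s m + tmul j op s' m := by
  unfold tmul
  rw [TensorProduct.add_tmul, map_add]
  rfl

theorem tmul_zero (s : S) : tmul j op s 0 = 0 := by
  have := tmul_add j op s 0 0
  rwa [add_zero, left_eq_add] at this

theorem smul_tmul (c : ℂ) (s : S) (m : M) :
    tmul j op (c • s) m = tmul j op s (algebraMap ℂ A c • m) := by
  unfold tmul
  rw [TensorProduct.smul_tmul]
  rfl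

theorem mul_tmul (s : S) (r : R) (m : M) :
    tmul j op (s * j r) m = tmul j op s (op r m) := by
  rw [← sub_eq_zero]
  have : (balRel j op).mkQ ((s * j r) ⊗ₜ[ℂ] ((RestrictScalars.addEquiv ℂ A M).symm m) -
      s ⊗ₜ[ℂ] ((RestrictScalars.addEquiv ℂ A M).symm (op r m))) = 0 := by
    rw [Submodule.mkQ_apply, Submodule.Quotient.mk_eq_zero]
    exact Submodule.subset_span ⟨s, r, m, rfl⟩
  rw [map_sub] at this
  exact this

/-- The complex scalars of `S` and of `A` agree because the tensor product was formed over `ℂ`. -/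
theorem complex_smul_smul (c : ℂ) (s : S) (x : BalTensor j op) :
    (c • s) • x = algebraMap ℂ A c • s • x := by
  refine induction_tmul j op (p := fun x => (c • s) • x = algebraMap ℂ A c • s • x) ?_ ?_ x
  · intro s' m
    rw [smul_tmul_left, smul_tmul_left, smul_tmul_right, smul_mul_assoc, smul_tmul]
  · intro x y hx hy
    rw [smul_add, hx, hy, smul_add, smul_add]

variable {N : Type*} [AddCommGroup N] [Module A N] [Module ℂ N] [IsScalarTower ℂ A N]

/-- The map `S ⊗_ℂ M → N` given by a bilinear map. -/
def preLift (f : S →ₗ[ℂ] M →ₗ[A] N) : S ⊗[ℂ] RestrictScalars ℂ A M →ₗ[ℂ] N :=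
  TensorProduct.lift <| LinearMap.mk₂ ℂ (fun s m => f s (RestrictScalars.addEquiv ℂ A M m))
    (fun s s' m => by rw [map_add, LinearMap.add_apply])
    (fun c s m => by rw [map_smul, LinearMap.smul_apply])
    (fun s m m' => by rw [map_add, map_add])
    (fun c s m => by
      rw [RestrictScalars.addEquiv_map_smul, map_smul, algebraMap_smul])

variable {j op}

theorem preLift_balRel {f : S →ₗ[ℂ] M →ₗ[A] N} (hf : ∀ s r m, f (s * j r) m = f s (op r m))
    {t : S ⊗[ℂ] RestrictScalars ℂ A M} (ht : t ∈ balRel j op) : preLift f t = 0 := by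
  -- The relations form an `S`-span, while `preLift f` is only `ℂ`-linear; hence the induction
  -- treats all `S`-multiples at once.
  have key : ∀ s : S, preLift f (s • t) = 0 := by
    induction ht using Submodule.span_induction with
    | zero => simp
    | add x y _ _ hx hy => intro s; rw [smul_add, map_add, hx, hy, add_zero]
    | smul s' x _ hx => intro s; rw [smul_smul]; exact hx _
    | mem x hx =>
      obtain ⟨s', r, m, rfl⟩ := hx
      intro s
      have := hf (s * s') r m
      rw [mul_assoc] at this
      simp only [smul_sub, TensorProduct.smul_tmul', smul_eq_mul, preLift, map_sub,
        TensorProduct.lift.tmul, LinearMap.mk₂_apply, AddEquiv.apply_symm_apply]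
      rw [this, sub_self]
  simpa using key 1

/-- The linear map from a balanced tensor product given by a balanced bilinear map. -/
def lift (f : S →ₗ[ℂ] M →ₗ[A] N) (hf : ∀ s r m, f (s * j r) m = f s (op r m)) :
    BalTensor j op →ₗ[A] N :=
  let g : BalTensor j op →+ N :=
    QuotientAddGroup.lift (balRel j op).toAddSubgroup (preLift f).toAddMonoidHom
      fun _ ht => preLift_balRel hf ht
  have hg : ∀ s m, g (tmul j op s m) = f s m := fun _ _ => rfl
  { toFun := g
    map_add' := map_add g
    map_smul' := fun a x => by
      rw [RingHom.id_apply]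
      refine induction_tmul j op (p := fun x => g (a • x) = a • g x) ?_ ?_ x
      · intro s m
        rw [smul_tmul_right, hg, hg, map_smul]
      · intro x y hx hy
        rw [smul_add, map_add, map_add, hx, hy, smul_add] }

theorem lift_tmul (f : S →ₗ[ℂ] M →ₗ[A] N) (hf : ∀ s r m, f (s * j r) m = f s (op r m))
    (s : S) (m : M) : lift f hf (tmul j op s m) = f s m := rfl

end BalTensor

variable [FiniteDimensional ℂ 𝔤] [LieAlgebra.IsSemisimple ℂ 𝔤] {b : (rootSystem H).Base}

/-! ### Equivariant linear forms on `U(𝔤)` -/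

section Forms

variable {A : Type*} [CommRing A] [Algebra ℂ A]

/-- The linear forms on `U(𝔤)` with `G(u x) = χ(x) G(u)` for `x ∈ H` and `G(u x) = 0` for
`x ∈ 𝔫`. -/
structure IsRightEquivariant (b : (rootSystem H).Base) (χ : H →ₗ[ℂ] A) (G : U(𝔤) →ₗ[ℂ] A) :
    Prop where
  cartan : ∀ (h : H) (u : U(𝔤)), G (u * ιU (h : 𝔤)) = χ h * G u
  nilp : ∀ x ∈ nilp b, ∀ u : U(𝔤), G (u * ιU x) = 0

/-- The linear forms as in `IsRightEquivariant` with `G(x u) = ψ(x) G(u)` for `x` in the opposite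
nilpotent subalgebra. -/
structure IsBiequivariant (ψ : nilpOpp b →ₗ⁅ℂ⁆ ℂ) (χ : H →ₗ[ℂ] A) (G : U(𝔤) →ₗ[ℂ] A) :
    Prop extends IsRightEquivariant b χ G where
  opp : ∀ (x : nilpOpp b) (u : U(𝔤)), G (ιU (x : 𝔤) * u) = ψ x • G u

theorem exists_isBiequivariant (ψ : nilpOpp b →ₗ⁅ℂ⁆ ℂ) (χ : H →ₗ[ℂ] A) :
    ∃ G : U(𝔤) →ₗ[ℂ] A, IsBiequivariant ψ χ G ∧ G 1 = 1 := by
  obtain ⟨G, h1, h2, h3⟩ := exists_biequivariant_form (isCompl_nilpOpp_borel (b := b)) ψ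
    (χ ∘ₗ cartanProj H)
    (fun x hx y hy => by
      rw [LinearMap.comp_apply, cartanProj_nilp (lie_borel_borel hx hy), map_zero])
    (fun x hx => by rw [LinearMap.comp_apply, cartanProj_nilpOpp hx, map_zero])
  refine ⟨G, ⟨⟨fun h u => ?_, fun x hx u => ?_⟩, h2⟩, h1⟩
  · rw [h3 _ (cartan_le_borel h.2), LinearMap.comp_apply, cartanProj_coe]
  · rw [h3 _ (nilp_le_borel hx), LinearMap.comp_apply, cartanProj_nilp hx, map_zero, zero_mul]

namespace IsRightEquivariant

variable {χ : H →ₗ[ℂ] A} {G G' : U(𝔤) →ₗ[ℂ] A}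

theorem sub (hG : IsRightEquivariant b χ G) (hG' : IsRightEquivariant b χ G') :
    IsRightEquivariant b χ (G - G') where
  cartan h u := by rw [LinearMap.sub_apply, hG.cartan, hG'.cartan, LinearMap.sub_apply, mul_sub]
  nilp x hx u := by rw [LinearMap.sub_apply, hG.nilp x hx, hG'.nilp x hx, sub_zero]

theorem const_mul (hG : IsRightEquivariant b χ G) (a : A) : IsRightEquivariant b χ (a • G) where
  cartan h u := by
    rw [LinearMap.smul_apply, hG.cartan, LinearMap.smul_apply, smul_eq_mul, smul_eq_mul]; ring
  nilp x hx u := by rw [LinearMap.smul_apply, hG.nilp x hx, smul_zero]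

theorem comp_mulLeft (hG : IsRightEquivariant b χ G) (v : U(𝔤)) :
    IsRightEquivariant b χ (G ∘ₗ LinearMap.mulLeft ℂ v) where
  cartan h u := by
    simp only [LinearMap.comp_apply, LinearMap.mulLeft_apply, ← mul_assoc, hG.cartan]
  nilp x hx u := by
    simp only [LinearMap.comp_apply, LinearMap.mulLeft_apply, ← mul_assoc, hG.nilp x hx]

theorem mul_borel_eq_zero (hG : IsRightEquivariant b χ G) {u : U(𝔤)} (hu : G u = 0) {q : U(𝔤)}
    (hq : q ∈ Algebra.adjoin ℂ (ιU '' (borel b : Set 𝔤))) : G (u * q) = 0 := by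
  revert u
  refine adjoin_induction_left (p := fun q => ∀ {u}, G u = 0 → G (u * q) = 0) ?_ ?_ ?_ ?_ hq
  · intro u hu
    rwa [mul_one]
  · intro q q' hq hq' u hu
    rw [mul_add, map_add, hq hu, hq' hu, add_zero]
  · intro c q hq u hu
    rw [mul_smul_comm, map_smul, hq hu, smul_zero]
  · rintro _ ⟨x, hx, rfl⟩ q - hq u hu
    rw [← mul_assoc]
    apply hq
    obtain ⟨h, hh, n, hn, rfl⟩ := mem_borel.1 hx
    rw [map_add, mul_add, map_add, hG.nilp n hn, add_zero]
    have := hG.cartan ⟨h, hh⟩ u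
    rw [hu, mul_zero] at this
    exact this

end IsRightEquivariant

theorem envelope_eq_mul_borel :
    Subalgebra.toSubmodule (Algebra.adjoin ℂ (ιU '' (nilpOpp b : Set 𝔤))) *
      Subalgebra.toSubmodule (Algebra.adjoin ℂ (ιU '' (borel b : Set 𝔤))) = ⊤ :=
  adjoin_mul_adjoin_eq_top (a := (nilpOpp b).toSubmodule) (c := (borel b).toSubmodule)
    isCompl_nilpOpp_borel.sup_eq_top

/-- Generators of `U(𝔫̄)` on the left and of `U(𝔟)` on the right only rescale the value of the form,
and their products span `U(𝔤)`. -/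
theorem IsBiequivariant.eq_zero {ψ : nilpOpp b →ₗ⁅ℂ⁆ ℂ} {χ : H →ₗ[ℂ] A} {G : U(𝔤) →ₗ[ℂ] A}
    (hG : IsBiequivariant ψ χ G) (h1 : G 1 = 0) : G = 0 := by
  have key : ∀ p ∈ Algebra.adjoin ℂ (ιU '' (nilpOpp b : Set 𝔤)), ∀ u, G u = 0 → G (p * u) = 0 := by
    intro p hp
    refine adjoin_induction_left (p := fun p => ∀ u, G u = 0 → G (p * u) = 0) ?_ ?_ ?_ ?_ hp
    · intro u hu
      rwa [one_mul]
    · intro q q' hq hq' u hu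
      rw [add_mul, map_add, hq u hu, hq' u hu, add_zero]
    · intro c q hq u hu
      rw [smul_mul_assoc, map_smul, hq u hu, smul_zero]
    · rintro _ ⟨x, hx, rfl⟩ q - hq u hu
      rw [mul_assoc, hG.opp ⟨x, hx⟩, hq u hu, smul_zero]
  refine LinearMap.ext fun u => ?_
  have hu : u ∈ Subalgebra.toSubmodule (Algebra.adjoin ℂ (ιU '' (nilpOpp b : Set 𝔤))) *
      Subalgebra.toSubmodule (Algebra.adjoin ℂ (ιU '' (borel b : Set 𝔤))) :=
    envelope_eq_mul_borel (b := b) ▸ Submodule.mem_top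
  rw [LinearMap.zero_apply]
  induction hu using Submodule.mul_induction_on' with
  | mem_mul_mem p hp q hq =>
    refine key p hp q ?_
    have := hG.mul_borel_eq_zero h1 hq
    rwa [one_mul] at this
  | add x _ y _ hx hy => rw [map_add, hx, hy, add_zero]

theorem IsBiequivariant.sub {ψ : nilpOpp b →ₗ⁅ℂ⁆ ℂ} {χ : H →ₗ[ℂ] A} {G G' : U(𝔤) →ₗ[ℂ] A}
    (hG : IsBiequivariant ψ χ G) (hG' : IsBiequivariant ψ χ G') : IsBiequivariant ψ χ (G - G') where
  __ := hG.toIsRightEquivariant.sub hG'.toIsRightEquivariant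
  opp x u := by rw [LinearMap.sub_apply, hG.opp, hG'.opp, LinearMap.sub_apply, smul_sub]

theorem IsBiequivariant.const_mul {ψ : nilpOpp b →ₗ⁅ℂ⁆ ℂ} {χ : H →ₗ[ℂ] A} {G : U(𝔤) →ₗ[ℂ] A}
    (hG : IsBiequivariant ψ χ G) (a : A) : IsBiequivariant ψ χ (a • G) where
  __ := hG.toIsRightEquivariant.const_mul a
  opp x u := by rw [LinearMap.smul_apply, hG.opp, LinearMap.smul_apply, smul_comm]

theorem IsBiequivariant.eq_smul {ψ : nilpOpp b →ₗ⁅ℂ⁆ ℂ} {χ : H →ₗ[ℂ] A} {G G' : U(𝔤) →ₗ[ℂ] A}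
    (hG : IsBiequivariant ψ χ G) (h1 : G 1 = 1) (hG' : IsBiequivariant ψ χ G') :
    G' = G' 1 • G := by
  rw [← sub_eq_zero]
  refine (hG'.sub (hG.const_mul (G' 1))).eq_zero ?_
  rw [LinearMap.sub_apply, LinearMap.smul_apply, h1, smul_eq_mul, mul_one, sub_self]

/-! ### Forms on the centraliser of the Cartan subalgebra -/

variable (h : H)

/-- The operator `u ↦ [h, u]` on `U(𝔤)`. -/
def cartanAd : Module.End ℂ U(𝔤) :=
  LinearMap.mulLeft ℂ (ιU (h : 𝔤)) - LinearMap.mulRight ℂ (ιU (h : 𝔤))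

theorem cartanAd_apply (u : U(𝔤)) : cartanAd h u = ιU (h : 𝔤) * u - u * ιU (h : 𝔤) := rfl

/-- The operator `∏_{i < N} (ad h + i + 1)` on `U(𝔤)`. -/
def cartanAdProd : ℕ → Module.End ℂ U(𝔤)
  | 0 => 1
  | N + 1 => (cartanAd h + ((N : ℂ) + 1) • 1) * cartanAdProd N

/-- On eigenvectors of `ad h` the scalar vanishes for the eigenvalues `-1, …, -N` and is `N!` for
the eigenvalue `0`. For large `N` this replaces a projection to weight zero. -/
theorem cartanAdProd_apply {u : U(𝔤)} {c : ℂ} (hu : cartanAd h u = c • u) (N : ℕ) :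
    cartanAdProd h N u = (∏ i ∈ Finset.range N, ((i : ℂ) + 1 + c)) • u := by
  induction N with
  | zero => simp [cartanAdProd]
  | succ N ih =>
    rw [cartanAdProd, Module.End.mul_apply, ih, map_smul, LinearMap.add_apply, hu,
      LinearMap.smul_apply, Module.End.one_apply, ← add_smul, smul_smul, Finset.prod_range_succ,
      add_comm c]

theorem IsRightEquivariant.comp_cartanAdProd {χ : H →ₗ[ℂ] A} {G : U(𝔤) →ₗ[ℂ] A}
    (hG : IsRightEquivariant b χ G) (N : ℕ) :
    IsRightEquivariant b χ (G ∘ₗ cartanAdProd h N) := by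
  induction N generalizing G with
  | zero => exact hG
  | succ N ih =>
    have h1 : IsRightEquivariant b χ (G ∘ₗ (cartanAd h + ((N : ℂ) + 1) • 1)) := by
      -- `G([h, u]) = G(h u) - χ(h) G(u)` by right equivariance, so each factor yields a combination
      -- of right equivariant forms.
      have := ((hG.comp_mulLeft (ιU (h : 𝔤))).sub (hG.const_mul (χ h))).sub
        (hG.const_mul (-algebraMap ℂ A (N + 1)))
      convert this using 1
      refine LinearMap.ext fun u => ?_
      have e : (cartanAd h + ((N : ℂ) + 1) • (1 : Module.End ℂ U(𝔤))) u =
          ιU (h : 𝔤) * u - u * ιU (h : 𝔤) + ((N : ℂ) + 1) • u := rfl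
      rw [LinearMap.comp_apply, e, LinearMap.map_add, LinearMap.map_sub, hG.cartan,
        LinearMap.map_smul, Algebra.smul_def]
      simp only [LinearMap.sub_apply, LinearMap.comp_apply, LinearMap.mulLeft_apply,
        LinearMap.smul_apply, smul_eq_mul]
      ring
    exact ih h1

/-- `U(𝔫̄)` is spanned by `1` and products of negative root vectors, whose `ad h`-eigenvalues are
negative integers. -/
theorem adjoin_nilpOpp_le {h : H} (hh : ∀ χ ∈ posCone b, ∃ n : ℕ, χ h = n + 1) {p : U(𝔤)}
    (hp : p ∈ Algebra.adjoin ℂ (ιU '' (nilpOpp b : Set 𝔤))) :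
    ∃ c : ℂ, p - c • 1 ∈ ⨆ n : ℕ, LinearMap.ker (cartanAd h + ((n : ℂ) + 1) • 1) := by
  set W := ⨆ n : ℕ, LinearMap.ker (cartanAd h + ((n : ℂ) + 1) • 1)
  have hmem : ∀ (n : ℕ) (u : U(𝔤)),
      u ∈ LinearMap.ker (cartanAd h + ((n : ℂ) + 1) • (1 : Module.End ℂ U(𝔤))) ↔
      ιU (h : 𝔤) * u - u * ιU (h : 𝔤) + ((n : ℂ) + 1) • u = 0 := fun n u => Iff.rfl
  have hW : ∀ x ∈ nilpOpp b, ιU x ∈ W ∧ ∀ u ∈ W, ιU x * u ∈ W := by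
    intro x hx
    refine weightSum_induction (p := fun x => ιU x ∈ W ∧ ∀ u ∈ W, ιU x * u ∈ W) ?_ ?_ ?_
      (mem_nilpOpp.1 hx)
    · intro χ hχ x hx
      obtain ⟨n, hn⟩ := hh _ hχ
      rw [LinearMap.neg_apply, neg_eq_iff_eq_neg] at hn
      have hb : ιU (h : 𝔤) * ιU x = ιU x * ιU (h : 𝔤) - ((n : ℂ) + 1) • ιU x := by
        rw [ι_mul_ι, lie_of_mem_rootSpace hx, hn, map_smul, neg_smul, sub_eq_add_neg]
      refine ⟨Submodule.mem_iSup_of_mem n ((hmem _ _).2 ?_), fun u hu => ?_⟩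
      · rw [hb]; abel
      · refine Submodule.iSup_induction _ (motive := fun u => ιU x * u ∈ W) hu ?_ (by simp) ?_
        · intro k u hu
          rw [hmem] at hu
          -- The eigenvalues `-(n + 1)` and `-(k + 1)` add up to `-((n + k + 1) + 1)`.
          refine Submodule.mem_iSup_of_mem (n + k + 1) ((hmem _ _).2 ?_)
          have e : ιU (h : 𝔤) * (ιU x * u) - ιU x * u * ιU (h : 𝔤) +
              (((n + k + 1 : ℕ) : ℂ) + 1) • (ιU x * u) =
              ιU x * (ιU (h : 𝔤) * u - u * ιU (h : 𝔤) + ((k : ℂ) + 1) • u) := by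
            rw [← mul_assoc, hb]
            simp only [sub_mul, mul_add, mul_sub, smul_mul_assoc, mul_smul_comm, mul_assoc]
            push_cast
            module
          rw [e, hu, mul_zero]
        · intro u v hu hv
          rw [mul_add]; exact add_mem hu hv
    · simp
    · rintro x y ⟨hx, hx'⟩ ⟨hy, hy'⟩
      refine ⟨by rw [map_add]; exact add_mem hx hy, fun u hu => ?_⟩
      rw [map_add, add_mul]; exact add_mem (hx' u hu) (hy' u hu)
  refine adjoin_induction_left (p := fun p => ∃ c : ℂ, p - c • 1 ∈ W) ?_ ?_ ?_ ?_ hp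
  · exact ⟨1, by simp⟩
  · rintro u v ⟨c, hc⟩ ⟨d, hd⟩
    refine ⟨c + d, ?_⟩
    have := add_mem hc hd
    rwa [sub_add_sub_comm, ← add_smul] at this
  · rintro r u ⟨c, hc⟩
    refine ⟨r * c, ?_⟩
    have := W.smul_mem r hc
    rwa [smul_sub, smul_smul] at this
  · rintro _ ⟨x, hx, rfl⟩ u - ⟨c, hc⟩
    refine ⟨0, ?_⟩
    obtain ⟨h1, h2⟩ := hW x hx
    have := add_mem (h2 _ hc) (W.smul_mem c h1)
    rw [mul_sub, mul_smul_comm, mul_one, sub_add_cancel] at this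
    rwa [zero_smul, sub_zero]

/-- A right equivariant form which vanishes at `1` vanishes on the centraliser of `H`. -/
theorem IsRightEquivariant.eq_zero_of_commute {χ : H →ₗ[ℂ] A} {G : U(𝔤) →ₗ[ℂ] A}
    (hG : IsRightEquivariant b χ G) (h1 : G 1 = 0) {u : U(𝔤)}
    (hu : ∀ h : H, ιU (h : 𝔤) * u = u * ιU (h : 𝔤)) : G u = 0 := by
  obtain ⟨h, -, hh⟩ := exists_height_element b
  have hone : cartanAd h (1 : U(𝔤)) = (0 : ℂ) • 1 := by
    rw [cartanAd_apply, one_mul, mul_one, sub_self, zero_smul]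
  have hW : ∀ w ∈ ⨆ n : ℕ, LinearMap.ker (cartanAd h + ((n : ℂ) + 1) • 1),
      ∃ N₀, ∀ N ≥ N₀, cartanAdProd h N w = 0 := by
    intro w hw
    refine Submodule.iSup_induction _
      (motive := fun w => ∃ N₀, ∀ N ≥ N₀, cartanAdProd h N w = 0) hw ?_ ⟨0, by simp⟩ ?_
    · intro n w hw
      refine ⟨n + 1, fun N hN => ?_⟩
      have : cartanAd h w = (-((n : ℂ) + 1)) • w := by
        rw [neg_smul]; exact eq_neg_of_add_eq_zero_left hw
      rw [cartanAdProd_apply h this, Finset.prod_eq_zero (Finset.mem_range.2 hN), zero_smul]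
      ring
    · rintro u v ⟨M, hM⟩ ⟨N, hN⟩
      refine ⟨max M N, fun K hK => ?_⟩
      rw [map_add, hM K (le_trans (le_max_left _ _) hK), hN K (le_trans (le_max_right _ _) hK),
        add_zero]
  -- In a product `p q` with `p ∈ U(𝔫̄)` and `q ∈ U(𝔟)`, the operator with large `N` kills all of
  -- `p` but its constant term, on which `G` vanishes; the factor `q` is harmless because the
  -- composite form is still right equivariant.
  have key : ∀ u : U(𝔤), ∃ N₀, ∀ N ≥ N₀, G (cartanAdProd h N u) = 0 := by
    intro u
    have hu : u ∈ Subalgebra.toSubmodule (Algebra.adjoin ℂ (ιU '' (nilpOpp b : Set 𝔤))) *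
        Subalgebra.toSubmodule (Algebra.adjoin ℂ (ιU '' (borel b : Set 𝔤))) :=
      envelope_eq_mul_borel (b := b) ▸ Submodule.mem_top
    induction hu using Submodule.mul_induction_on' with
    | mem_mul_mem p hp q hq =>
      obtain ⟨c, hc⟩ := adjoin_nilpOpp_le hh hp
      obtain ⟨N₀, hN₀⟩ := hW _ hc
      refine ⟨N₀, fun N hN => ?_⟩
      refine (hG.comp_cartanAdProd h N).mul_borel_eq_zero ?_ hq
      have := hN₀ N hN
      rw [map_sub, sub_eq_zero, map_smul, cartanAdProd_apply h hone] at this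
      rw [LinearMap.comp_apply, this, map_smul, map_smul, h1, smul_zero, smul_zero]
    | add x _ y _ hx hy =>
      obtain ⟨M, hM⟩ := hx
      obtain ⟨N, hN⟩ := hy
      refine ⟨max M N, fun K hK => ?_⟩
      rw [map_add, map_add, hM K (le_trans (le_max_left _ _) hK),
        hN K (le_trans (le_max_right _ _) hK), add_zero]
  obtain ⟨N, hN⟩ := key u
  have := hN N le_rfl
  -- On an element commuting with `h` the operator is the nonzero scalar `N!`.
  have hu' : cartanAd h u = (0 : ℂ) • u := by
    rw [cartanAd_apply, hu, sub_self, zero_smul]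
  rw [cartanAdProd_apply h hu', map_smul] at this
  have hne : (∏ i ∈ Finset.range N, ((i : ℂ) + 1 + 0)) ≠ 0 :=
    Finset.prod_ne_zero_iff.2 fun i _ => by rw [add_zero]; exact Nat.cast_add_one_ne_zero i
  exact (smul_eq_zero_iff_right hne).1 this

end Forms

end WhittakerPairing

/-! ### The Harish-Chandra projection and the action of the centre on Whittaker forms. -/

namespace WhittakerPairing

set_option linter.unusedSectionVars false

open LieAlgebra LieAlgebra.IsKilling Module

variable {𝔤 : Type*} [LieRing 𝔤] [LieAlgebra ℂ 𝔤] {H : LieSubalgebra ℂ 𝔤} [H.IsCartanSubalgebra]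

variable [FiniteDimensional ℂ 𝔤] [LieAlgebra.IsSemisimple ℂ 𝔤] {b : (rootSystem H).Base}

/-! ### Enveloping algebras of subalgebras -/

section Subalgebras

/-- The map `U(𝔞) → U(𝔤)` induced by the inclusion of a subalgebra. -/
def toU (𝔞 : LieSubalgebra ℂ 𝔤) : U(𝔞) →ₐ[ℂ] U(𝔤) :=
  UniversalEnvelopingAlgebra.lift ℂ ((ιU : 𝔤 →ₗ⁅ℂ⁆ U(𝔤)).comp 𝔞.incl)

theorem toU_ι {𝔞 : LieSubalgebra ℂ 𝔤} (x : 𝔞) : toU 𝔞 (ιU x) = ιU (x : 𝔤) :=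
  UniversalEnvelopingAlgebra.lift_ι_apply ℂ _ x

theorem inclU_ι {𝔞 𝔠 : LieSubalgebra ℂ 𝔤} (h : 𝔞 ≤ 𝔠) (x : 𝔞) :
    inclU h (ιU x) = ιU (LieSubalgebra.inclusion h x) :=
  UniversalEnvelopingAlgebra.lift_ι_apply ℂ _ x

theorem toU_inclU {𝔞 𝔠 : LieSubalgebra ℂ 𝔤} (h : 𝔞 ≤ 𝔠) (u : U(𝔞)) :
    toU 𝔠 (inclU h u) = toU 𝔞 u := by
  have : (toU 𝔠).comp (inclU h) = toU 𝔞 := by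
    apply UniversalEnvelopingAlgebra.hom_ext
    ext x
    change toU 𝔠 (inclU h (ιU x)) = toU 𝔞 (ιU x)
    rw [inclU_ι, toU_ι, toU_ι]
    rfl
  exact DFunLike.congr_fun this u

end Subalgebras

/-! ### The Harish-Chandra projection -/

section HarishChandra

variable {A : Type*} [CommRing A] [Algebra ℂ A]

/-- The weight `μ + φ` of `H` with values in `A`. -/
def cartanWeight (φ : U(H) →ₐ[ℂ] A) (μ : Dual ℂ H) : H →ₗ[ℂ] A :=
  (shiftedChar φ μ).toLinearMap ∘ₗ (ιU : H →ₗ⁅ℂ⁆ U(H)).toLinearMap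

theorem cartanWeight_apply (φ : U(H) →ₐ[ℂ] A) (μ : Dual ℂ H) (h : H) :
    cartanWeight φ μ h = shiftedChar φ μ (ιU h) := rfl

theorem shiftedChar_ι (φ : U(H) →ₐ[ℂ] A) (μ : Dual ℂ H) (h : H) :
    shiftedChar φ μ (ιU h) = algebraMap ℂ A (μ h) + φ (ιU h) :=
  UniversalEnvelopingAlgebra.lift_ι_apply ℂ _ h

variable {φ : U(H) →ₐ[ℂ] A} {μ : Dual ℂ H} {G : U(𝔤) →ₗ[ℂ] A}

theorem IsRightEquivariant.mul_toU (hG : IsRightEquivariant b (cartanWeight φ μ) G) (p : U(H))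
    (u : U(𝔤)) : G (u * toU H p) = shiftedChar φ μ p * G u := by
  revert u
  refine envelope_induction_left
    (p := fun p => ∀ u, G (u * toU H p) = shiftedChar φ μ p * G u) ?_ ?_ ?_ ?_ p
  · intro u
    rw [map_one, map_one, mul_one, one_mul]
  · intro p q hp hq u
    rw [map_add, map_add, mul_add, map_add, hp, hq, add_mul]
  · intro c p hp u
    rw [map_smul, map_smul, mul_smul_comm, map_smul, hp, smul_mul_assoc]
  · intro h p hp u
    rw [map_mul (toU H), map_mul (shiftedChar φ μ), ← mul_assoc, hp, toU_ι, hG.cartan, cartanWeight_apply]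
    ring

theorem mul_mem_span_nilp {η : nilp b →ₗ⁅ℂ⁆ ℂ} (u : U(levi η)) {t : U(levi η)}
    (ht : t ∈ Submodule.span ℂ
      {t | ∃ (x : levi η) (u : U(levi η)), (x : 𝔤) ∈ nilp b ∧ t = u * ιU x}) :
    u * t ∈ Submodule.span ℂ
      {t | ∃ (x : levi η) (u : U(levi η)), (x : 𝔤) ∈ nilp b ∧ t = u * ιU x} := by
  induction ht using Submodule.span_induction with
  | zero => simp
  | add x y _ _ hx hy => rw [mul_add]; exact add_mem hx hy
  | smul c x _ hx => rw [mul_smul_comm]; exact Submodule.smul_mem _ c hx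
  | mem t ht =>
    obtain ⟨x, v, hx, rfl⟩ := ht
    exact Submodule.subset_span ⟨x, u * v, hx, (mul_assoc _ _ _).symm⟩

/-- Elements of `𝔫` can be moved to the right past `U(H)` because `H` normalises `𝔫`. -/
theorem ι_mul_inclU_mem (η : nilp b →ₗ⁅ℂ⁆ ℂ) (p : U(H)) {n : levi η} (hn : (n : 𝔤) ∈ nilp b) :
    ιU n * inclU (cartan_le_levi η) p ∈ Submodule.span ℂ
      {t | ∃ (x : levi η) (u : U(levi η)), (x : 𝔤) ∈ nilp b ∧ t = u * ιU x} := by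
  set N := Submodule.span ℂ
      {t | ∃ (x : levi η) (u : U(levi η)), (x : 𝔤) ∈ nilp b ∧ t = u * ιU x}
  revert n
  refine envelope_induction_left (p := fun p => ∀ {n : levi η}, (n : 𝔤) ∈ nilp b →
    ιU n * inclU (cartan_le_levi η) p ∈ N) ?_ ?_ ?_ ?_ p
  · intro n hn
    rw [map_one, mul_one]
    exact Submodule.subset_span ⟨n, 1, hn, (one_mul _).symm⟩
  · intro p q hp hq n hn
    rw [map_add, mul_add]; exact add_mem (hp hn) (hq hn)
  · intro c p hp n hn
    rw [map_smul, mul_smul_comm]; exact N.smul_mem c (hp hn)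
  · intro h p hp n hn
    rw [map_mul, inclU_ι, ← mul_assoc, ι_mul_ι, add_mul, mul_assoc]
    refine add_mem (mul_mem_span_nilp _ (hp hn)) (hp ?_)
    rw [LieSubalgebra.coe_bracket, ← lie_skew]
    exact neg_mem (lie_cartan_nilp h.2 hn)

/-- Only the spanning half of the Harish-Chandra decomposition. Directness is never needed, as the
forms with zero left character give the same value for every admissible choice of component. -/
theorem exists_sub_inclU_mem_hcComplement (η : nilp b →ₗ⁅ℂ⁆ ℂ) (z : U(levi η)) :
    ∃ p : U(H), z - inclU (cartan_le_levi η) p ∈ hcComplement η := by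
  let a : Submodule ℂ (levi η) := (nilpOpp b).toSubmodule.comap (levi η).incl.toLinearMap
  let c : Submodule ℂ (levi η) := (borel b).toSubmodule.comap (levi η).incl.toLinearMap
  have hac : a ⊔ c = ⊤ := by
    rw [eq_top_iff]
    rintro x -
    obtain ⟨y, hy, h, hh, n, hn, e⟩ := exists_triangular_levi x.2
    have e' : (⟨y, hy.1⟩ : levi η) + (⟨h, cartan_le_levi η hh⟩ + ⟨n, hn.1⟩) = x := Subtype.ext e
    rw [← e']
    refine add_mem (Submodule.mem_sup_left hy.2) (Submodule.mem_sup_right ?_)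
    exact mem_borel.2 ⟨h, hh, n, hn.2, rfl⟩
  set N := Submodule.span ℂ
      {t | ∃ (x : levi η) (u : U(levi η)), (x : 𝔤) ∈ nilp b ∧ t = u * ιU x}
  have hc : ∀ q ∈ Algebra.adjoin ℂ (ιU '' (c : Set (levi η))),
      ∃ p : U(H), q - inclU (cartan_le_levi η) p ∈ N := by
    intro q hq
    refine adjoin_induction_left
      (p := fun q => ∃ p : U(H), q - inclU (cartan_le_levi η) p ∈ N) ?_ ?_ ?_ ?_ hq
    · exact ⟨1, by rw [map_one, sub_self]; exact zero_mem _⟩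
    · rintro u v ⟨p, hp⟩ ⟨q, hq⟩
      refine ⟨p + q, ?_⟩
      rw [map_add, ← sub_add_sub_comm]; exact add_mem hp hq
    · rintro r u ⟨p, hp⟩
      refine ⟨r • p, ?_⟩
      rw [map_smul, ← smul_sub]; exact N.smul_mem r hp
    · rintro _ ⟨x, hx, rfl⟩ u - ⟨p, hp⟩
      obtain ⟨h, hh, n, hn, e⟩ := mem_borel.1 hx
      have hnl : n ∈ levi η := by
        rw [← add_sub_cancel_left h n, e]
        exact sub_mem x.2 (cartan_le_levi η hh)
      have e' : x = LieSubalgebra.inclusion (cartan_le_levi η) ⟨h, hh⟩ + ⟨n, hnl⟩ :=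
        Subtype.ext e.symm
      refine ⟨ιU (⟨h, hh⟩ : H) * p, ?_⟩
      have : ιU x * u - inclU (cartan_le_levi η) (ιU (⟨h, hh⟩ : H) * p) =
          ιU x * (u - inclU (cartan_le_levi η) p) +
            ιU (⟨n, hnl⟩ : levi η) * inclU (cartan_le_levi η) p := by
        rw [map_mul, inclU_ι, e', map_add]
        noncomm_ring
      rw [this]
      exact add_mem (mul_mem_span_nilp _ hp) (ι_mul_inclU_mem η p hn)
  have ha : ∀ q ∈ Algebra.adjoin ℂ (ιU '' (a : Set (levi η))), ∀ t : U(levi η),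
      (∃ p : U(H), t - inclU (cartan_le_levi η) p ∈ hcComplement η) →
      ∃ p : U(H), q * t - inclU (cartan_le_levi η) p ∈ hcComplement η := by
    intro q hq t ht
    refine adjoin_induction_left
      (p := fun q => ∃ p : U(H), q * t - inclU (cartan_le_levi η) p ∈ hcComplement η)
      ?_ ?_ ?_ ?_ hq
    · rwa [one_mul]
    · rintro u v ⟨p, hp⟩ ⟨q, hq⟩
      refine ⟨p + q, ?_⟩
      rw [map_add, add_mul, ← sub_add_sub_comm]; exact add_mem hp hq
    · rintro r u ⟨p, hp⟩
      refine ⟨r • p, ?_⟩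
      rw [map_smul, smul_mul_assoc, ← smul_sub]; exact (hcComplement η).smul_mem r hp
    -- A leading factor from `𝔫̄_η` puts the whole product into the complement, so its component is
    -- `0`.
    · rintro _ ⟨x, hx, rfl⟩ u - -
      refine ⟨0, Submodule.mem_sup_left (Submodule.subset_span ⟨x, u * t, hx, ?_⟩)⟩
      rw [map_zero, sub_zero, mul_assoc]
  have hz := adjoin_mul_adjoin_eq_top hac ▸ (Submodule.mem_top : z ∈ ⊤)
  induction hz using Submodule.mul_induction_on' with
  | mem_mul_mem p hp q hq =>
    refine ha p hp q ?_
    obtain ⟨r, hr⟩ := hc q hq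
    exact ⟨r, Submodule.mem_sup_right hr⟩
  | add x _ y _ hx hy =>
    obtain ⟨p, hp⟩ := hx
    obtain ⟨q, hq⟩ := hy
    refine ⟨p + q, ?_⟩
    rw [map_add, ← sub_add_sub_comm]; exact add_mem hp hq

variable {η : nilp b →ₗ⁅ℂ⁆ ℂ}

theorem sub_inclU_harishChandra_mem (z : U(levi η)) :
    z - inclU (cartan_le_levi η) (harishChandra η z) ∈ hcComplement η := by
  have h := exists_sub_inclU_mem_hcComplement η z
  unfold harishChandra
  rw [dif_pos h]
  exact h.choose_spec

theorem IsBiequivariant.hcComplement_eq_zero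
    (hG : IsBiequivariant (b := b) 0 (cartanWeight φ μ) G) {c : U(levi η)}
    (hc : c ∈ hcComplement η) : G (toU _ c) = 0 := by
  suffices hcComplement η ≤ LinearMap.ker (G ∘ₗ (toU (levi η)).toLinearMap) from this hc
  refine sup_le (Submodule.span_le.2 ?_) (Submodule.span_le.2 ?_)
  · rintro _ ⟨x, u, hx, rfl⟩
    change G (toU _ (ιU x * u)) = 0
    rw [map_mul, toU_ι]
    have := hG.opp ⟨x, hx⟩ (toU _ u)
    rwa [LieHom.zero_apply, zero_smul] at this
  · rintro _ ⟨x, u, hx, rfl⟩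
    change G (toU _ (u * ιU x)) = 0
    rw [map_mul, toU_ι, hG.nilp x hx]

/-- The transpose interchanges the two summands of the complement, and the form kills both. -/
theorem IsBiequivariant.onU_hcComplement_eq_zero
    (hG : IsBiequivariant (b := b) 0 (cartanWeight φ μ) G) (τ : Transpose H) {c : U(levi η)}
    (hc : c ∈ hcComplement η) : G (τ.onU (toU _ c)) = 0 := by
  suffices hcComplement η ≤ LinearMap.ker (G ∘ₗ τ.onULin ∘ₗ (toU (levi η)).toLinearMap) from this hc
  refine sup_le (Submodule.span_le.2 ?_) (Submodule.span_le.2 ?_)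
  · rintro _ ⟨x, u, hx, rfl⟩
    change G (τ.onU (toU _ (ιU x * u))) = 0
    rw [map_mul, toU_ι, τ.onU_mul, τ.onU_ι, hG.nilp _ (τ.nilpOpp_mem hx)]
  · rintro _ ⟨x, u, hx, rfl⟩
    change G (τ.onU (toU _ (u * ιU x))) = 0
    rw [map_mul, toU_ι, τ.onU_mul, τ.onU_ι]
    have := hG.opp ⟨_, τ.nilp_mem hx⟩ (τ.onU (toU _ u))
    rwa [LieHom.zero_apply, zero_smul] at this

theorem cartan_mul_toU_comm (h : H) (p : U(H)) :
    ιU (h : 𝔤) * toU H p = toU H p * ιU (h : 𝔤) := by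
  refine envelope_induction_left
    (p := fun p => ιU (h : 𝔤) * toU H p = toU H p * ιU (h : 𝔤)) ?_ ?_ ?_ ?_ p
  · simp
  · intro p q hp hq
    rw [map_add, mul_add, add_mul, hp, hq]
  · intro c p hp
    rw [map_smul, mul_smul_comm, smul_mul_assoc, hp]
  · intro x p hp
    rw [map_mul, toU_ι, ← mul_assoc, ι_mul_ι, lie_cartan_cartan h.2 x.2, map_zero, add_zero,
      mul_assoc, hp, mul_assoc]

theorem Transpose.onU_toU_cartan (τ : Transpose H) (p : U(H)) :
    τ.onU (toU H p) = toU H p := by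
  refine envelope_induction_left (p := fun p => τ.onU (toU H p) = toU H p) ?_ ?_ ?_ ?_ p
  · rw [map_one, τ.onU_one]
  · intro p q hp hq
    rw [map_add, τ.onU_add, hp, hq]
  · intro c p hp
    rw [map_smul, τ.onU_smul, hp]
  · intro x p hp
    rw [map_mul, toU_ι, τ.onU_mul, hp, τ.onU_ι, τ.map_cartan x x.2, cartan_mul_toU_comm]

theorem IsBiequivariant.apply_toU (hG : IsBiequivariant (b := b) 0 (cartanWeight φ μ) G)
    (h1 : G 1 = 1) (z : U(levi η)) :
    G (toU _ z) = shiftedChar φ μ (harishChandra η z) := by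
  have h := hG.hcComplement_eq_zero (sub_inclU_harishChandra_mem z)
  have h2 := hG.mul_toU (harishChandra η z) 1
  rw [one_mul, h1, mul_one] at h2
  rwa [map_sub, map_sub, toU_inclU, h2, sub_eq_zero] at h

theorem IsBiequivariant.apply_onU_toU (hG : IsBiequivariant (b := b) 0 (cartanWeight φ μ) G)
    (h1 : G 1 = 1) (τ : Transpose H) (z : U(levi η)) :
    G (τ.onU (toU _ z)) = shiftedChar φ μ (harishChandra η z) := by
  have h := hG.onU_hcComplement_eq_zero τ (sub_inclU_harishChandra_mem z)
  have h2 := hG.mul_toU (harishChandra η z) 1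
  rw [one_mul, h1, mul_one] at h2
  rw [← τ.onULin_apply, map_sub, map_sub, map_sub, toU_inclU, τ.onULin_apply, τ.onULin_apply,
    τ.onU_toU_cartan, h2, sub_eq_zero] at h
  exact h

/-- The component chosen for `1` is not known to be `1`, but its value under the character can be
read off from a form. -/
theorem shiftedChar_harishChandra_one (φ : U(H) →ₐ[ℂ] A) (μ : Dual ℂ H) :
    shiftedChar φ μ (harishChandra η 1) = 1 := by
  obtain ⟨G, hG, h1⟩ := exists_isBiequivariant (b := b) 0 (cartanWeight φ μ)
  rw [← hG.apply_toU h1, map_one, h1]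

end HarishChandra

/-! ### Whittaker forms on `U(𝔤)` -/

section Whittaker

variable {A : Type*} [CommRing A] [Algebra ℂ A]

/-- The character of `𝔫̄` corresponding to `η` under the transpose. -/
def etaOpp (τ : Transpose H) (η : nilp b →ₗ⁅ℂ⁆ ℂ) : nilpOpp b →ₗ⁅ℂ⁆ ℂ where
  toFun x := η ⟨τ.symm.toEquiv x, τ.symm.nilpOpp_mem x.2⟩
  map_add' x y := by
    rw [← map_add]
    exact congrArg η (Subtype.ext (map_add τ.symm.toEquiv (x : 𝔤) y))
  map_smul' c x := by
    rw [RingHom.id_apply, ← map_smul]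
    exact congrArg η (Subtype.ext (map_smul τ.symm.toEquiv c (x : 𝔤)))
  map_lie' {x y} := by
    rw [LieRing.of_associative_ring_bracket, mul_comm, sub_self]
    have : (⟨τ.symm.toEquiv (⁅x, y⁆ : nilpOpp b), τ.symm.nilpOpp_mem ⁅x, y⁆.2⟩ : nilp b) =
        ⁅(⟨_, τ.symm.nilpOpp_mem y.2⟩ : nilp b), ⟨_, τ.symm.nilpOpp_mem x.2⟩⁆ :=
      Subtype.ext (τ.symm.map_lie x y)
    rw [this, LieHom.map_lie, LieRing.of_associative_ring_bracket, mul_comm, sub_self]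

theorem etaOpp_apply (τ : Transpose H) (η : nilp b →ₗ⁅ℂ⁆ ℂ) (x : nilp b) :
    etaOpp τ η ⟨τ.toEquiv x, τ.nilp_mem x.2⟩ = η x :=
  congrArg η (Subtype.ext (τ.toEquiv.symm_apply_apply (x : 𝔤)))

variable {τ : Transpose H} {η : nilp b →ₗ⁅ℂ⁆ ℂ} {χ : H →ₗ[ℂ] A} {G : U(𝔤) →ₗ[ℂ] A}

theorem IsBiequivariant.transpose_mul (hG : IsBiequivariant (etaOpp τ η) χ G) {x : 𝔤}
    (hx : x ∈ nilp b) (u : U(𝔤)) : G (ιU (τ.toEquiv x) * u) = η ⟨x, hx⟩ • G u := by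
  rw [← etaOpp_apply τ η ⟨x, hx⟩]
  exact hG.opp ⟨τ.toEquiv x, τ.nilp_mem hx⟩ u

/-- Move `r` past the factors of `s` by `r x = x r + [r, x]`; the bracket stays in `𝔫^η`, where `η`
vanishes. -/
theorem IsBiequivariant.nilpUpper_mul (hG : IsBiequivariant (etaOpp τ η) χ G) {r : 𝔤}
    (hr : r ∈ nilpUpper η) (s : U(levi η)) (u : U(𝔤)) :
    G (τ.onU (ιU r * toU _ s) * u) = 0 := by
  revert r u
  refine envelope_induction_left (p := fun s => ∀ {r : 𝔤}, r ∈ nilpUpper η → ∀ u,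
    G (τ.onU (ιU r * toU _ s) * u) = 0) ?_ ?_ ?_ ?_ s
  · intro r hr u
    rw [map_one, mul_one, τ.onU_ι, hG.transpose_mul (nilpUpper_le_nilp hr), eta_nilpUpper hr,
      zero_smul]
  · intro s t hs ht r hr u
    rw [map_add, mul_add, τ.onU_add, add_mul, map_add, hs hr, ht hr, add_zero]
  · intro c s hs r hr u
    rw [map_smul, mul_smul_comm, τ.onU_smul, smul_mul_assoc, map_smul, hs hr, smul_zero]
  · intro x s hs r hr u
    rw [map_mul (toU _), toU_ι, ← mul_assoc, ι_mul_ι, add_mul, τ.onU_add, add_mul, map_add,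
      hs (lie_nilpUpper_levi hr x.2), add_zero, mul_assoc, τ.onU_mul, mul_assoc, hs hr]

/-- The transpose preserves `𝔩_η`, hence also the property of commuting with it. -/
theorem onU_toU_center_comm (τ : Transpose H) (z : Subalgebra.center ℂ U(levi η)) {y : 𝔤}
    (hy : y ∈ levi η) : ιU y * τ.onU (toU _ (z : U(levi η))) =
      τ.onU (toU _ (z : U(levi η))) * ιU y := by
  have h := Subalgebra.mem_center_iff.1 z.2 (ιU (⟨_, τ.symm.levi_mem hy⟩ : levi η))
  have h2 := congrArg (fun u => τ.onU (toU _ u)) h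
  simp only [map_mul, toU_ι, τ.onU_mul, τ.onU_ι] at h2
  have : τ.toEquiv (τ.symm.toEquiv y) = y := τ.toEquiv.apply_symm_apply y
  rw [this] at h2
  exact h2.symm

/-- The centre of `U(𝔩_η)` acts on a Whittaker form through the Harish-Chandra projection. -/
theorem IsBiequivariant.center_mul {φ : U(H) →ₐ[ℂ] A} {μ : Dual ℂ H}
    (hG : IsBiequivariant (etaOpp τ η) (cartanWeight φ μ) G) (h1 : G 1 = 1)
    (z : Subalgebra.center ℂ U(levi η)) (u : U(𝔤)) :
    G (τ.onU (toU _ (z : U(levi η))) * u) = shiftedChar φ μ (harishChandra η z) * G u := by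
  set z' := τ.onU (toU _ (z : U(levi η)))
  have hcomm : ∀ y ∈ levi η, ιU y * z' = z' * ιU y := fun y hy => onU_toU_center_comm τ z hy
  -- Split an element of `𝔫̄` as `τ(y) + τ(r)`. The Levi part `τ(y)` commutes with `z'`; the part
  -- `τ(r)` contributes nothing, and `η(r) = 0`.
  have hG2 : IsBiequivariant (etaOpp τ η) (cartanWeight φ μ) (G ∘ₗ LinearMap.mulLeft ℂ z') :=
    { hG.toIsRightEquivariant.comp_mulLeft z' with
      opp := by
        intro x u
        simp only [LinearMap.comp_apply, LinearMap.mulLeft_apply]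
        obtain ⟨y, hy, r, hr, hyr⟩ := exists_levi_add_nilpUpper (η := η)
          (τ.symm.nilpOpp_mem x.2)
        have hx : (x : 𝔤) = τ.toEquiv y + τ.toEquiv r := by
          rw [← map_add, hyr]; exact (τ.toEquiv.apply_symm_apply (x : 𝔤)).symm
        have hx2 : etaOpp τ η x = η ⟨y, hy.2⟩ := by
          have : (⟨y, hy.2⟩ : nilp b) + ⟨r, nilpUpper_le_nilp hr⟩ =
            ⟨τ.symm.toEquiv x, τ.symm.nilpOpp_mem x.2⟩ := Subtype.ext hyr
          change η ⟨τ.symm.toEquiv x, τ.symm.nilpOpp_mem x.2⟩ = _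
          rw [← this, map_add, eta_nilpUpper hr, add_zero]
        have hr0 : G (z' * (ιU (τ.toEquiv r) * u)) = 0 := by
          have := hG.nilpUpper_mul hr (z : U(levi η)) u
          rwa [τ.onU_mul, τ.onU_ι, mul_assoc] at this
        rw [hx2, hx, map_add, add_mul, mul_add, map_add, hr0, add_zero, ← mul_assoc,
          ← hcomm _ (τ.levi_mem hy.1), mul_assoc, hG.transpose_mul hy.2] }
  have h2 := DFunLike.congr_fun (hG.eq_smul h1 hG2) u
  simp only [LinearMap.comp_apply, LinearMap.mulLeft_apply, LinearMap.smul_apply, smul_eq_mul,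
    mul_one] at h2
  rw [h2]
  congr 1
  -- The scalar `G(z')` does not depend on the left character: `z'` commutes with `H`, so the form
  -- with zero left character takes the same value there.
  obtain ⟨G₀, hG₀, h₀⟩ := exists_isBiequivariant (b := b) 0 (cartanWeight φ μ)
  rw [← hG₀.apply_onU_toU h₀ τ, ← sub_eq_zero, ← LinearMap.sub_apply]
  refine (hG.toIsRightEquivariant.sub hG₀.toIsRightEquivariant).eq_zero_of_commute ?_
    fun h => hcomm _ (cartan_le_levi η h.2)
  rw [LinearMap.sub_apply, h1, h₀, sub_self]

end Whittaker

end WhittakerPairing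

/-! ### Verma and Whittaker modules, construction of the pairing, reduction to the residue field. -/

namespace WhittakerPairing

set_option linter.unusedSectionVars false

open LieAlgebra LieAlgebra.IsKilling Module

variable {𝔤 : Type*} [LieRing 𝔤] [LieAlgebra ℂ 𝔤] {H : LieSubalgebra ℂ 𝔤} [H.IsCartanSubalgebra]

variable [FiniteDimensional ℂ 𝔤] [LieAlgebra.IsSemisimple ℂ 𝔤] {b : (rootSystem H).Base}

variable {A : Type*} [CommRing A] [Algebra ℂ A] {φ : U(H) →ₐ[ℂ] A} {lam : Dual ℂ H}

/-! ### Deformed Verma modules and coinduced modules -/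

section VermaModule

namespace Verma

theorem tmul_eq (u : U(𝔤)) (a : A) :
    (BalTensor.tmul _ _ u a : Verma b φ lam) = a • u • gen b φ lam := by
  unfold gen
  rw [BalTensor.smul_tmul_left, BalTensor.smul_tmul_right, mul_one, smul_eq_mul, mul_one]

theorem hom_ext {N : Type*} [AddCommGroup N] [Module A N] {F F' : Verma b φ lam →ₗ[A] N}
    (h : ∀ u : U(𝔤), F (u • gen b φ lam) = F' (u • gen b φ lam)) : F = F' := by
  refine LinearMap.ext fun x => ?_
  refine BalTensor.induction_tmul _ _ (p := fun x => F x = F' x) ?_ ?_ x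
  · intro u a
    rw [tmul_eq, LinearMap.map_smul F, LinearMap.map_smul F', h]
  · intro x y hx hy
    rw [map_add, map_add, hx, hy]

theorem cartan_smul_gen (h : H) :
    ιU (h : 𝔤) • gen b φ lam = cartanWeight φ (lam - rho b) h • gen b φ lam := by
  have := BalTensor.mul_tmul (A := A) (S := U(𝔤)) (M := A) (R := H × nilp b)
    (fun r => ιU ((r.1 : 𝔤) + (r.2 : 𝔤)))
    (fun r => LinearMap.lsmul A A (shiftedChar φ (lam - rho b) (ιU r.1))) 1 (h, 0) 1
  simp only [ZeroMemClass.coe_zero, add_zero, one_mul, LinearMap.lsmul_apply] at this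
  rw [cartanWeight_apply]
  unfold gen
  rw [BalTensor.smul_tmul_left, BalTensor.smul_tmul_right, mul_one]
  exact this

theorem nilp_smul_gen {x : 𝔤} (hx : x ∈ nilp b) : ιU x • gen b φ lam = 0 := by
  have := BalTensor.mul_tmul (A := A) (S := U(𝔤)) (M := A) (R := H × nilp b)
    (fun r => ιU ((r.1 : 𝔤) + (r.2 : 𝔤)))
    (fun r => LinearMap.lsmul A A (shiftedChar φ (lam - rho b) (ιU r.1))) 1 (0, ⟨x, hx⟩) 1
  simp only [ZeroMemClass.coe_zero, zero_add, one_mul, map_zero, LinearMap.zero_apply,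
    BalTensor.tmul_zero] at this
  unfold gen
  rw [BalTensor.smul_tmul_left, mul_one]
  exact this

/-- The linear form `u ↦ F(u v)` on `U(𝔤)`, where `v` generates the Verma module. -/
def form (F : Verma b φ lam →ₗ[A] A) : U(𝔤) →ₗ[ℂ] A where
  toFun u := F (u • gen b φ lam)
  map_add' u v := by rw [add_smul, map_add]
  map_smul' c u := by
    rw [BalTensor.complex_smul_smul, map_smul, RingHom.id_apply, algebraMap_smul]

theorem form_apply (F : Verma b φ lam →ₗ[A] A) (u : U(𝔤)) :
    form F u = F (u • gen b φ lam) := rfl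

theorem isRightEquivariant_form (F : Verma b φ lam →ₗ[A] A) :
    IsRightEquivariant b (cartanWeight φ (lam - rho b)) (form F) where
  cartan h u := by
    rw [form_apply, mul_smul, cartan_smul_gen, smul_comm, map_smul, smul_eq_mul, form_apply]
  nilp x hx u := by
    rw [form_apply, mul_smul, nilp_smul_gen hx, smul_zero, map_zero]

/-- The linear form on the Verma module given by a right equivariant form on `U(𝔤)`. -/
def lift (G : U(𝔤) →ₗ[ℂ] A) (hG : IsRightEquivariant b (cartanWeight φ (lam - rho b)) G) :
    Verma b φ lam →ₗ[A] A :=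
  BalTensor.lift ((LinearMap.mul A A).restrictScalars ℂ ∘ₗ G) fun u r a => by
    change G (u * ιU ((r.1 : 𝔤) + (r.2 : 𝔤))) * a =
      G u * (shiftedChar φ (lam - rho b) (ιU r.1) * a)
    rw [map_add, mul_add, map_add, hG.nilp _ r.2.2, hG.cartan, add_zero, cartanWeight_apply]
    ring

theorem lift_smul_gen (G : U(𝔤) →ₗ[ℂ] A)
    (hG : IsRightEquivariant b (cartanWeight φ (lam - rho b)) G) (u : U(𝔤)) :
    lift G hG (u • gen b φ lam) = G u := by
  unfold gen lift
  rw [BalTensor.smul_tmul_left, BalTensor.lift_tmul, mul_one]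
  exact mul_one _

end Verma

theorem Coind.ext {F G : Coind b φ lam} (h : ∀ u, F.toLin u = G.toLin u) : F = G :=
  Subtype.ext (LinearMap.ext h)

theorem Coind.isRightEquivariant (G : Coind b φ lam) (τ : Transpose H) :
    IsRightEquivariant b (cartanWeight φ (lam - rho b)) (G.toLin ∘ₗ τ.symm.onULin) where
  cartan h u := by
    simp only [LinearMap.comp_apply, Transpose.onULin_apply, Transpose.onU_mul,
      Transpose.onU_ι, τ.symm.map_cartan _ h.2]
    exact G.2.1 h _
  nilp x hx u := by
    simp only [LinearMap.comp_apply, Transpose.onULin_apply, Transpose.onU_mul,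
      Transpose.onU_ι]
    exact G.2.2 ⟨_, τ.symm.nilp_mem hx⟩ _

/-- The isomorphism `F ↦ (u ↦ F(τ(u) v))` from the dual of the Verma module to the coinduced
module. -/
def vermaDualEquiv (b : (rootSystem H).Base) (φ : U(H) →ₐ[ℂ] A) (lam : Dual ℂ H)
    (τ : Transpose H) : (Verma b φ lam →ₗ[A] A) ≃ₗ[A] Coind b φ lam where
  toFun F := ⟨Verma.form F ∘ₗ τ.onULin,
    fun h u => by
      simp only [LinearMap.comp_apply, τ.onULin_apply, τ.onU_mul, τ.onU_ι, τ.map_cartan _ h.2]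
      exact (Verma.isRightEquivariant_form F).cartan h _,
    fun x u => by
      simp only [LinearMap.comp_apply, τ.onULin_apply, τ.onU_mul, τ.onU_ι]
      exact (Verma.isRightEquivariant_form F).nilp _ (τ.nilpOpp_mem x.2) _⟩
  map_add' F G := Coind.ext fun u => rfl
  map_smul' a F := Coind.ext fun u => rfl
  invFun G := Verma.lift _ (G.isRightEquivariant τ)
  left_inv F := Verma.hom_ext fun u => by
    rw [Verma.lift_smul_gen]
    change F (τ.onU (τ.symm.onU u) • Verma.gen b φ lam) = _
    rw [τ.onU_symm_onU]
  right_inv G := Coind.ext fun u => by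
    refine (Verma.lift_smul_gen _ (G.isRightEquivariant τ) (τ.onU u)).trans ?_
    change G.toLin (τ.symm.onU (τ.onU u)) = _
    rw [τ.symm_onU_onU]

theorem vermaDualEquiv_toLin (τ : Transpose H) (F : Verma b φ lam →ₗ[A] A) (u : U(𝔤)) :
    (vermaDualEquiv b φ lam τ F).toLin u = F (τ.onU u • Verma.gen b φ lam) := rfl

theorem Coind.smul_toLin (x : U(𝔤)) (G : Coind b φ lam) (u : U(𝔤)) :
    (x • G).toLin u = G.toLin (u * x) := rfl

end VermaModule

/-! ### Deformed standard Whittaker modules -/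

section StdModule

variable {η : nilp b →ₗ⁅ℂ⁆ ℂ}

variable {μ : Dual ℂ H}

namespace LeviWhittaker

/-- The element `s ⊗ a` of the Whittaker module of the Levi subalgebra. -/
def mk (s : U(levi η)) (a : A) : LeviWhittaker φ η μ := BalTensor.tmul _ _ s a

theorem smul_mk (t s : U(levi η)) (a : A) :
    t • (mk s a : LeviWhittaker φ η μ) = mk (t * s) a :=
  BalTensor.smul_tmul_left _ _ t s a

theorem smul_mk_right (c : A) (s : U(levi η)) (a : A) :
    c • (mk s a : LeviWhittaker φ η μ) = mk s (c * a) :=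
  BalTensor.smul_tmul_right _ _ c s a

theorem mk_eq (s : U(levi η)) (a : A) :
    (mk s a : LeviWhittaker φ η μ) = a • s • mk 1 1 := by
  rw [smul_mk, smul_mk_right, mul_one, mul_one]

theorem induction {p : LeviWhittaker φ η μ → Prop} (mk : ∀ s a, p (mk s a))
    (add : ∀ x y, p x → p y → p (x + y)) (x : LeviWhittaker φ η μ) : p x :=
  BalTensor.induction_tmul _ _ mk add x

/-- The balancing relations are indexed by pairs `(z, u)`. Isolating `𝔫_η` means taking `z = 1`,
which requires its character value to be `1`. -/
theorem levi_smul_mk {y : 𝔤} (hy : y ∈ levi η ⊓ nilp b) :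
    ιU (⟨y, hy.1⟩ : levi η) • (mk 1 1 : LeviWhittaker φ η (lam - rho b + rhoEta η)) =
      algebraMap ℂ A (η ⟨y, hy.2⟩) • mk 1 1 := by
  rw [smul_mk, smul_mk_right, mul_one, mul_one]
  have h1 : infChar φ η (lam - rho b + rhoEta η) 1 = 1 := shiftedChar_harishChandra_one _ _
  have h2 : etaU η (ιU (⟨y, hy⟩ : (levi η ⊓ nilp b : LieSubalgebra ℂ 𝔤))) = η ⟨y, hy.2⟩ :=
    UniversalEnvelopingAlgebra.lift_ι_apply ℂ _ _
  have h3 := BalTensor.mul_tmul (A := A) (S := U(levi η)) (M := A)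
    (R := Subalgebra.center ℂ U(levi η) × U((levi η ⊓ nilp b : LieSubalgebra ℂ 𝔤)))
    (fun r => (r.1 : U(levi η)) * inclU inf_le_left r.2)
    (fun r => LinearMap.lsmul A A (infChar φ η (lam - rho b + rhoEta η) r.1 *
      algebraMap ℂ A (etaU η r.2))) 1 (1, ιU (⟨y, hy⟩ : (levi η ⊓ nilp b : LieSubalgebra ℂ 𝔤))) 1
  simp only [OneMemClass.coe_one, one_mul, inclU_ι, h1, h2, LinearMap.lsmul_apply, smul_eq_mul,
    mul_one] at h3
  exact h3

end LeviWhittaker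

namespace StdWhittaker

/-- The element `u ⊗ l` of the standard Whittaker module. -/
def mk (u : U(𝔤)) (l : LeviWhittaker φ η (lam - rho b + rhoEta η)) : StdWhittaker φ η lam :=
  BalTensor.tmul _ _ u l

variable (u v : U(𝔤)) (l l' : LeviWhittaker φ η (lam - rho b + rhoEta η))

theorem gen_eq : gen φ η lam = mk 1 (LeviWhittaker.mk 1 1) := rfl

theorem smul_mk : v • (mk u l : StdWhittaker φ η lam) = mk (v * u) l :=
  BalTensor.smul_tmul_left _ _ v u l

theorem smul_mk_right (a : A) : a • (mk u l : StdWhittaker φ η lam) = mk u (a • l) :=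
  BalTensor.smul_tmul_right _ _ a u l

theorem mk_add : (mk u (l + l') : StdWhittaker φ η lam) = mk u l + mk u l' :=
  BalTensor.tmul_add _ _ u l l'

theorem add_mk : (mk (u + v) l : StdWhittaker φ η lam) = mk u l + mk v l :=
  BalTensor.add_tmul _ _ u v l

theorem complex_smul_mk (c : ℂ) :
    (mk (c • u) l : StdWhittaker φ η lam) = mk u (algebraMap ℂ A c • l) :=
  BalTensor.smul_tmul _ _ c u l

theorem complex_smul_smul (c : ℂ) (x : StdWhittaker φ η lam) :
    (c • u) • x = algebraMap ℂ A c • u • x :=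
  BalTensor.complex_smul_smul _ _ c u x

theorem mk_levi_smul (x : levi η) :
    (mk (u * ιU (x : 𝔤)) l : StdWhittaker φ η lam) = mk u ((ιU x : U(levi η)) • l) := by
  have h := BalTensor.mul_tmul (A := A) (S := U(𝔤)) (R := levi η × nilpUpper η)
    (fun r => ιU ((r.1 : 𝔤) + (r.2 : 𝔤)))
    (fun r => Module.toModuleEnd A (LeviWhittaker φ η (lam - rho b + rhoEta η))
      (ιU r.1 : U(levi η))) u (x, 0) l
  simp only [ZeroMemClass.coe_zero, add_zero] at h
  exact h

theorem mk_nilpUpper {r : 𝔤} (hr : r ∈ nilpUpper η) :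
    (mk (u * ιU r) l : StdWhittaker φ η lam) = 0 := by
  have h := BalTensor.mul_tmul (A := A) (S := U(𝔤)) (R := levi η × nilpUpper η)
    (fun r => ιU ((r.1 : 𝔤) + (r.2 : 𝔤)))
    (fun r => Module.toModuleEnd A (LeviWhittaker φ η (lam - rho b + rhoEta η))
      (ιU r.1 : U(levi η))) u (0, ⟨r, hr⟩) l
  simp only [ZeroMemClass.coe_zero, zero_add, map_zero, LinearMap.zero_apply,
    BalTensor.tmul_zero] at h
  exact h

theorem induction_mk {p : StdWhittaker φ η lam → Prop} (mk : ∀ u l, p (mk u l))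
    (add : ∀ x y, p x → p y → p (x + y)) (x : StdWhittaker φ η lam) : p x :=
  BalTensor.induction_tmul _ _ mk add x

/-- Balancing was imposed for Lie algebra elements only; induction on `s` extends it to `U(𝔩_η)`. -/
theorem mk_smul (s : U(levi η)) :
    (mk u (s • l) : StdWhittaker φ η lam) = mk (u * toU _ s) l := by
  revert u l
  refine envelope_induction_left (p := fun s => ∀ u l,
    (mk u (s • l) : StdWhittaker φ η lam) = mk (u * toU _ s) l) ?_ ?_ ?_ ?_ s
  · intro u l
    rw [one_smul, map_one, mul_one]
  · intro s t hs ht u l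
    rw [add_smul, mk_add, hs, ht, map_add, mul_add, add_mk]
  · intro c s hs u l
    have h : (c • s) • l = algebraMap ℂ A c • s • l := BalTensor.complex_smul_smul _ _ c s l
    rw [h, ← smul_mk_right, hs, map_smul, mul_smul_comm, complex_smul_mk, smul_mk_right]
  · intro x s hs u l
    rw [mul_smul, ← mk_levi_smul, hs, map_mul, toU_ι, mul_assoc]

theorem induction_gen {p : StdWhittaker φ η lam → Prop} (gen : ∀ u : U(𝔤), p (u • gen φ η lam))
    (add : ∀ x y, p x → p y → p (x + y)) (smul : ∀ (a : A) x, p x → p (a • x))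
    (x : StdWhittaker φ η lam) : p x := by
  refine induction_mk ?_ add x
  intro u l
  refine LeviWhittaker.induction (p := fun l => p (mk u l)) ?_ ?_ l
  · intro s a
    rw [LeviWhittaker.mk_eq, ← smul_mk_right, mk_smul]
    refine smul a _ ?_
    have h := gen (u * toU _ s)
    rwa [gen_eq, smul_mk, mul_one] at h
  · intro l l' hl hl'
    rw [mk_add]
    exact add _ _ hl hl'

/-- On `𝔫_η` this is the Levi relation; on `𝔫^η` both the action and `η` are zero. -/
theorem nilp_smul_gen (x : nilp b) :
    ιU (x : 𝔤) • gen φ η lam = algebraMap ℂ A (η x) • gen φ η lam := by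
  obtain ⟨y, hy, r, hr, hyr⟩ := exists_levi_add_nilpUpper (η := η) x.2
  have hx : η x = η ⟨y, hy.2⟩ := by
    have : (⟨y, hy.2⟩ : nilp b) + ⟨r, nilpUpper_le_nilp hr⟩ = x := Subtype.ext hyr
    rw [← this, map_add, eta_nilpUpper hr, add_zero]
  have h1 := mk_nilpUpper (φ := φ) (lam := lam) 1 (LeviWhittaker.mk 1 1) hr
  have h2 := mk_levi_smul (φ := φ) (lam := lam) 1 (LeviWhittaker.mk 1 1) ⟨y, hy.1⟩
  rw [one_mul] at h1 h2
  rw [LeviWhittaker.levi_smul_mk hy, ← hx, ← smul_mk_right] at h2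
  have h3 := smul_mk (φ := φ) (lam := lam) (η := η) 1 (ιU (x : 𝔤)) (LeviWhittaker.mk 1 1)
  rw [mul_one, ← hyr, map_add, add_mk, h1, h2, add_zero, ← map_add, hyr] at h3
  exact h3

end StdWhittaker

/-- Operators of the form `u ↦ [x, u]` with `x ∈ 𝔫` are uniformly locally nilpotent on `U(𝔤)`. -/
theorem exists_commutator_pow_eq_zero (b : (rootSystem H).Base) (u : U(𝔤)) :
    ∃ N : ℕ, ∀ x ∈ nilp b,
      ((LinearMap.mulLeft ℂ (ιU x) - LinearMap.mulRight ℂ (ιU x)) ^ N) u = 0 := by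
  let D : 𝔤 → Module.End ℂ U(𝔤) := fun x =>
    LinearMap.mulLeft ℂ (ιU x) - LinearMap.mulRight ℂ (ιU x)
  have hD : ∀ x u, D x u = ιU x * u - u * ιU x := fun x u => rfl
  have hmul : ∀ x u v, D x (u * v) = D x u * v + u * D x v := fun x u v => by
    simp only [hD]; noncomm_ring
  -- Commutators are derivations, so nilpotency exponents add under products. The sum does not
  -- depend on `x`, as `twistedFinite` demands.
  have hleib : ∀ x n k u v, (D x ^ n) u = 0 → (D x ^ k) v = 0 → (D x ^ (n + k)) (u * v) = 0 := by
    intro x n k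
    induction h : n + k generalizing n k with
    | zero =>
      intro u v hu hv
      obtain rfl : n = 0 := by omega
      rw [pow_zero, Module.End.one_apply] at hu ⊢
      rw [hu, zero_mul]
    | succ m ih =>
      intro u v hu hv
      rw [pow_succ, Module.End.mul_apply, hmul, map_add]
      have e1 : (D x ^ m) (D x u * v) = 0 := by
        rcases n with _ | n
        · rw [pow_zero, Module.End.one_apply] at hu
          rw [hu, map_zero, zero_mul, map_zero]
        · exact ih n k (by omega) _ _ (by rwa [pow_succ, Module.End.mul_apply] at hu) hv
      have e2 : (D x ^ m) (u * D x v) = 0 := by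
        rcases k with _ | k
        · rw [pow_zero, Module.End.one_apply] at hv
          rw [hv, map_zero, mul_zero, map_zero]
        · exact ih n k (by omega) _ _ hu (by rwa [pow_succ, Module.End.mul_apply] at hv)
      rw [e1, e2, add_zero]
  obtain ⟨N, hN⟩ := exists_ad_pow_eq_zero b
  have hι : ∀ x ∈ nilp b, ∀ y : 𝔤, (D x ^ N) (ιU y) = 0 := by
    intro x hx y
    have : ∀ k, (D x ^ k) (ιU y) = ιU ((LieAlgebra.ad ℂ 𝔤 x ^ k) y) := by
      intro k
      induction k with
      | zero => rfl
      | succ k ih =>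
        rw [pow_succ', Module.End.mul_apply, ih, hD, pow_succ', Module.End.mul_apply,
          LieAlgebra.ad_apply, LieHom.map_lie, LieRing.of_associative_ring_bracket]
    rw [this, hN x hx, map_zero]
  refine envelope_induction_left (p := fun u => ∃ N : ℕ, ∀ x ∈ nilp b, (D x ^ N) u = 0)
    ?_ ?_ ?_ ?_ u
  · exact ⟨1, fun x _ => by rw [pow_one, hD, mul_one, one_mul, sub_self]⟩
  · rintro u v ⟨n, hn⟩ ⟨k, hk⟩
    refine ⟨n + k, fun x hx => ?_⟩
    rw [map_add, pow_add, Module.End.mul_apply, Module.End.mul_apply, hk x hx, map_zero, add_zero,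
      ← Module.End.mul_apply, ← pow_add, add_comm, pow_add, Module.End.mul_apply, hn x hx, map_zero]
  · rintro c u ⟨n, hn⟩
    exact ⟨n, fun x hx => by rw [map_smul, hn x hx, smul_zero]⟩
  · rintro y u ⟨n, hn⟩
    exact ⟨N + n, fun x hx => hleib x N n _ _ (hι x hx y) (hn x hx)⟩

/-- Because `x w = c w`, one has `(x - c) u w = (x u - u x) w`, and this iterates. -/
theorem sub_algebraMap_pow_smul {V : Type*} [AddCommGroup V] [Module A V] [Module U(𝔤) V]
    [SMulCommClass U(𝔤) A V] {x : 𝔤} {c : ℂ} {w : V}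
    (hc : ∀ v : V, algebraMap ℂ U(𝔤) c • v = algebraMap ℂ A c • v)
    (hw : ιU x • w = algebraMap ℂ A c • w) (u : U(𝔤)) (k : ℕ) :
    (ιU x - algebraMap ℂ U(𝔤) c) ^ k • u • w =
      ((LinearMap.mulLeft ℂ (ιU x) - LinearMap.mulRight ℂ (ιU x)) ^ k) u • w := by
  induction k with
  | zero => rw [pow_zero, one_smul, pow_zero, Module.End.one_apply]
  | succ k ih =>
    rw [pow_succ', mul_smul, ih, pow_succ', Module.End.mul_apply, LinearMap.sub_apply,
      LinearMap.mulLeft_apply, LinearMap.mulRight_apply, sub_smul, sub_smul, hc, mul_smul,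
      mul_smul, hw, smul_comm _ (algebraMap ℂ A c)]

theorem mem_twistedFinite_stdWhittaker (m : StdWhittaker φ η lam) :
    m ∈ twistedFinite A η (StdWhittaker φ η lam) := by
  refine StdWhittaker.induction_gen (p := fun m => m ∈ twistedFinite A η (StdWhittaker φ η lam))
    ?_ (fun _ _ => add_mem) (fun a _ h => Submodule.smul_mem _ a h) m
  intro u
  obtain ⟨N, hN⟩ := exists_commutator_pow_eq_zero b u
  refine ⟨N, fun x => ?_⟩
  have hc : ∀ v : StdWhittaker φ η lam,
      algebraMap ℂ U(𝔤) (η x) • v = algebraMap ℂ A (η x) • v := fun v => by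
    have h := StdWhittaker.complex_smul_smul 1 (η x) v
    rwa [one_smul, ← Algebra.algebraMap_eq_smul_one] at h
  refine (sub_algebraMap_pow_smul hc (StdWhittaker.nilp_smul_gen x) u N).trans ?_
  rw [hN x x.2]
  exact zero_smul _ _

end StdModule

/-! ### The contravariant pairing -/

section Pairing

variable {η : nilp b →ₗ⁅ℂ⁆ ℂ} {τ : Transpose H}

/-- The contragredient action of `U(𝔤)` on linear forms on the Verma module. -/
def dualAct (τ : Transpose H) :
    U(𝔤) →ₗ[ℂ] (Verma b φ lam →ₗ[A] A) →ₗ[A] (Verma b φ lam →ₗ[A] A) where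
  toFun u := LinearMap.lcomp A A (Module.toModuleEnd A (Verma b φ lam) (τ.onU u))
  map_add' u v := by
    refine LinearMap.ext fun F => LinearMap.ext fun y => ?_
    change F (τ.onU (u + v) • y) = F (τ.onU u • y) + F (τ.onU v • y)
    rw [τ.onU_add, add_smul, map_add]
  map_smul' c u := by
    refine LinearMap.ext fun F => LinearMap.ext fun y => ?_
    change F (τ.onU (c • u) • y) = c • F (τ.onU u • y)
    rw [τ.onU_smul, BalTensor.complex_smul_smul, map_smul, algebraMap_smul]

theorem IsBiequivariant.toU_nilp_mul {χ : H →ₗ[ℂ] A} {G : U(𝔤) →ₗ[ℂ] A}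
    (hG : IsBiequivariant (etaOpp τ η) χ G) (n : U((levi η ⊓ nilp b : LieSubalgebra ℂ 𝔤)))
    (v : U(𝔤)) : G (τ.onU (toU _ n) * v) = algebraMap ℂ A (etaU η n) * G v := by
  revert v
  refine envelope_induction_left (p := fun n => ∀ v : U(𝔤),
    G (τ.onU (toU _ n) * v) = algebraMap ℂ A (etaU η n) * G v) ?_ ?_ ?_ ?_ n
  · intro v
    rw [map_one, τ.onU_one, one_mul, map_one, map_one, one_mul]
  · intro m n hm hn v
    rw [map_add, τ.onU_add, add_mul, map_add, hm, hn, map_add, map_add, add_mul]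
  · intro c n hn v
    rw [map_smul, τ.onU_smul, smul_mul_assoc, map_smul, hn, map_smul, smul_eq_mul, map_mul,
      Algebra.smul_def, mul_assoc]
  · intro x n hn v
    have : etaU η (ιU x) = η ⟨x, x.2.2⟩ := UniversalEnvelopingAlgebra.lift_ι_apply ℂ _ _
    rw [map_mul (toU _), toU_ι, τ.onU_mul, mul_assoc, hn, τ.onU_ι, hG.transpose_mul x.2.2,
      map_mul (etaU η), this, map_mul, Algebra.smul_def]
    ring

variable {G : U(𝔤) →ₗ[ℂ] A}

/-- The balancing relation over `Z(𝔩_η) ⊗ U(𝔫_η)`. The shift by `ρ_η` in the parameter cancels the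
one inside `infChar`, leaving the weight `lam - ρ + φ`. -/
theorem IsBiequivariant.levi_mul
    (hG : IsBiequivariant (etaOpp τ η) (cartanWeight φ (lam - rho b)) G) (h1 : G 1 = 1)
    (s : U(levi η)) (z : Subalgebra.center ℂ U(levi η))
    (n : U((levi η ⊓ nilp b : LieSubalgebra ℂ 𝔤))) (u : U(𝔤)) :
    G (τ.onU (toU _ (s * ((z : U(levi η)) * inclU inf_le_left n))) * u) =
      infChar φ η (lam - rho b + rhoEta η) z * algebraMap ℂ A (etaU η n) *
        G (τ.onU (toU _ s) * u) := by
  rw [map_mul (toU _), map_mul (toU _), toU_inclU, τ.onU_mul, τ.onU_mul, mul_assoc, mul_assoc, hG.toU_nilp_mul,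
    hG.center_mul h1]
  simp only [infChar, add_sub_cancel_right]
  ring

/-- The map from the Whittaker module of the Levi subalgebra to the dual of the Verma module given
by a biequivariant form on `U(𝔤)`. -/
def leviPairing (hG : IsBiequivariant (etaOpp τ η) (cartanWeight φ (lam - rho b)) G)
    (h1 : G 1 = 1) :
    LeviWhittaker φ η (lam - rho b + rhoEta η) →ₗ[A] Verma b φ lam →ₗ[A] A :=
  BalTensor.lift
    ((LinearMap.lsmul A (Verma b φ lam →ₗ[A] A)).flip.restrictScalars ℂ ∘ₗ
      (LinearMap.applyₗ (Verma.lift G hG.toIsRightEquivariant)).restrictScalars ℂ ∘ₗ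
      dualAct τ ∘ₗ (toU (levi η)).toLinearMap) fun s r a => by
    refine Verma.hom_ext fun u => ?_
    change a * Verma.lift G hG.toIsRightEquivariant
        (τ.onU (toU _ (s * ((r.1 : U(levi η)) * inclU inf_le_left r.2))) •
          u • Verma.gen b φ lam) =
      (infChar φ η (lam - rho b + rhoEta η) r.1 * algebraMap ℂ A (etaU η r.2) * a) *
        Verma.lift G hG.toIsRightEquivariant (τ.onU (toU _ s) • u • Verma.gen b φ lam)
    rw [smul_smul, smul_smul, Verma.lift_smul_gen, Verma.lift_smul_gen, hG.levi_mul h1]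
    ring

variable (hG : IsBiequivariant (etaOpp τ η) (cartanWeight φ (lam - rho b)) G) (h1 : G 1 = 1)

theorem leviPairing_mk (s : U(levi η)) (a : A) (y : Verma b φ lam) :
    leviPairing hG h1 (LeviWhittaker.mk s a) y =
      a * Verma.lift G hG.toIsRightEquivariant (τ.onU (toU _ s) • y) := rfl

theorem leviPairing_smul
    (x : levi η) (l : LeviWhittaker φ η (lam - rho b + rhoEta η)) (y : Verma b φ lam) :
    leviPairing hG h1 ((ιU x : U(levi η)) • l) y =
      leviPairing hG h1 l (ιU (τ.toEquiv (x : 𝔤)) • y) := by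
  refine LeviWhittaker.induction (p := fun l =>
    leviPairing hG h1 ((ιU x : U(levi η)) • l) y =
      leviPairing hG h1 l (ιU (τ.toEquiv (x : 𝔤)) • y)) ?_ ?_ l
  · intro s a
    rw [LeviWhittaker.smul_mk, leviPairing_mk, leviPairing_mk, map_mul, toU_ι, τ.onU_mul,
      τ.onU_ι, mul_smul]
  · intro l l' hl hl'
    rw [smul_add, LinearMap.map_add, LinearMap.add_apply, hl, hl', LinearMap.map_add,
      LinearMap.add_apply]

theorem leviPairing_nilpUpper
    {r : 𝔤} (hr : r ∈ nilpUpper η) (l : LeviWhittaker φ η (lam - rho b + rhoEta η))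
    (u : U(𝔤)) :
    leviPairing hG h1 l (ιU (τ.toEquiv r) • u • Verma.gen b φ lam) = 0 := by
  refine LeviWhittaker.induction (p := fun l =>
    leviPairing hG h1 l (ιU (τ.toEquiv r) • u • Verma.gen b φ lam) = 0) ?_ ?_ l
  · intro s a
    rw [leviPairing_mk, smul_smul, smul_smul, Verma.lift_smul_gen, ← τ.onU_ι, ← τ.onU_mul,
      hG.nilpUpper_mul hr, mul_zero]
  · intro l l' hl hl'
    rw [LinearMap.map_add, LinearMap.add_apply, hl, hl', add_zero]

/-- The pairing of the standard Whittaker module with the Verma module given by a biequivariant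
form on `U(𝔤)`. -/
def stdPairing : StdWhittaker φ η lam →ₗ[A] Verma b φ lam →ₗ[A] A :=
  BalTensor.lift
    ((LinearMap.lcomp A (Verma b φ lam →ₗ[A] A) (leviPairing hG h1)).restrictScalars ℂ ∘ₗ
      dualAct τ) fun u r l => by
    refine Verma.hom_ext fun v => ?_
    change leviPairing hG h1 l (τ.onU (u * ιU ((r.1 : 𝔤) + (r.2 : 𝔤))) • v • Verma.gen b φ lam) =
      leviPairing hG h1 ((ιU r.1 : U(levi η)) • l) (τ.onU u • v • Verma.gen b φ lam)
    rw [leviPairing_smul, τ.onU_mul, τ.onU_ι, map_add, map_add, add_mul, add_smul,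
      LinearMap.map_add, mul_smul, mul_smul, smul_smul _ v, leviPairing_nilpUpper hG h1 r.2.2,
      add_zero]

theorem stdPairing_mk
    (u : U(𝔤)) (l : LeviWhittaker φ η (lam - rho b + rhoEta η)) (y : Verma b φ lam) :
    stdPairing hG h1 (StdWhittaker.mk u l) y = leviPairing hG h1 l (τ.onU u • y) := rfl

set_option maxHeartbeats 1000000 in
theorem stdPairing_mem :
    stdPairing hG h1 ∈ contravariantPairings A τ (StdWhittaker φ η lam) (Verma b φ lam) := by
  intro u m y
  refine StdWhittaker.induction_mk (p := fun m =>
    stdPairing hG h1 (u • m) y = stdPairing hG h1 m (τ.onU u • y)) ?_ ?_ m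
  · intro v l
    rw [StdWhittaker.smul_mk, stdPairing_mk, stdPairing_mk, τ.onU_mul, mul_smul]
  · intro m m' hm hm'
    have h2 := (stdPairing hG h1).map_add (u • m) (u • m')
    rw [← smul_add u m m'] at h2
    rw [h2, LinearMap.add_apply, hm, hm', (stdPairing hG h1).map_add m m', LinearMap.add_apply]

theorem stdPairing_gen (u : U(𝔤)) :
    stdPairing hG h1 (StdWhittaker.gen φ η lam) (u • Verma.gen b φ lam) = G u := by
  rw [StdWhittaker.gen_eq, stdPairing_mk, leviPairing_mk, map_one, τ.onU_one, one_smul, one_smul,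
    Verma.lift_smul_gen, one_mul]


/-- The form `u ↦ C(w, u v)` given by a contravariant pairing. -/
theorem isBiequivariant_form {C : StdWhittaker φ η lam →ₗ[A] Verma b φ lam →ₗ[A] A}
    (hC : C ∈ contravariantPairings A τ (StdWhittaker φ η lam) (Verma b φ lam)) :
    IsBiequivariant (etaOpp τ η) (cartanWeight φ (lam - rho b))
      (Verma.form (C (StdWhittaker.gen φ η lam))) where
  __ := Verma.isRightEquivariant_form _
  opp x u := by
    have h1 := hC (ιU (τ.symm.toEquiv (x : 𝔤))) (StdWhittaker.gen φ η lam)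
      (u • Verma.gen b φ lam)
    have h2 : τ.toEquiv (τ.symm.toEquiv (x : 𝔤)) = x := τ.toEquiv.apply_symm_apply (x : 𝔤)
    have h3 := StdWhittaker.nilp_smul_gen (φ := φ) (lam := lam) (η := η)
      ⟨_, τ.symm.nilpOpp_mem x.2⟩
    simp only at h3
    rw [τ.onU_ι, h2, h3, LinearMap.map_smul, LinearMap.smul_apply, smul_smul,
      algebraMap_smul] at h1
    exact h1.symm

set_option maxHeartbeats 1000000 in
-- Contravariance reduces `C(u w, u' v)` to the form of `C` at `τ(u) u'`, and the forms of `B` and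
-- `C` are proportional.
theorem eq_smul_of_mem_contravariantPairings
    {B C : StdWhittaker φ η lam →ₗ[A] Verma b φ lam →ₗ[A] A}
    (hB : B ∈ contravariantPairings A τ (StdWhittaker φ η lam) (Verma b φ lam))
    (hC : C ∈ contravariantPairings A τ (StdWhittaker φ η lam) (Verma b φ lam))
    (h1 : B (StdWhittaker.gen φ η lam) (Verma.gen b φ lam) = 1) :
    C = C (StdWhittaker.gen φ η lam) (Verma.gen b φ lam) • B := by
  have key := (isBiequivariant_form hB).eq_smul (by rwa [Verma.form_apply, one_smul])
    (isBiequivariant_form hC)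
  refine LinearMap.ext fun m => ?_
  refine StdWhittaker.induction_gen (p := fun m => C m = (C (StdWhittaker.gen φ η lam)
    (Verma.gen b φ lam) • B) m) ?_ ?_ ?_ m
  · intro u
    refine Verma.hom_ext fun v => ?_
    have := DFunLike.congr_fun key (τ.onU u * v)
    rw [LinearMap.smul_apply, Verma.form_apply, Verma.form_apply, Verma.form_apply, one_smul,
      mul_smul] at this
    rw [LinearMap.smul_apply, LinearMap.smul_apply, hC u, hB u]
    exact this
  · intro x y hx hy
    exact (C.map_add x y).trans ((congrArg₂ _ hx hy).trans (LinearMap.map_add _ x y).symm)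
  · intro a x hx
    exact (C.map_smul a x).trans ((congrArg _ hx).trans (LinearMap.map_smul _ a x).symm)

end Pairing

/-! ### Reduction modulo the maximal ideal -/

section Reduction

theorem IsBiequivariant.map {A' : Type*} [CommRing A'] [Algebra ℂ A'] (f : A →ₐ[ℂ] A')
    {ψ : nilpOpp b →ₗ⁅ℂ⁆ ℂ} {χ : H →ₗ[ℂ] A} {G : U(𝔤) →ₗ[ℂ] A} (hG : IsBiequivariant ψ χ G) :
    IsBiequivariant ψ (f.toLinearMap ∘ₗ χ) (f.toLinearMap ∘ₗ G) where
  cartan h u := by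
    simp only [LinearMap.comp_apply, AlgHom.toLinearMap_apply, hG.cartan, map_mul]
  nilp x hx u := by
    simp only [LinearMap.comp_apply, hG.nilp x hx, map_zero]
  opp x u := by
    simp only [LinearMap.comp_apply, hG.opp, map_smul]

/-- The deformation `φ` maps `H` to the maximal ideal, so it disappears in the residue field. -/
theorem residue_cartanWeight [IsLocalRing A]
    (hφ : ∀ x : H, φ (ιU x) ∈ IsLocalRing.maximalIdeal A) (μ : Dual ℂ H) :
    (IsScalarTower.toAlgHom ℂ A (IsLocalRing.ResidueField A)).toLinearMap ∘ₗ cartanWeight φ μ =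
      (Algebra.ofId ℂ (IsLocalRing.ResidueField A)).toLinearMap ∘ₗ
        cartanWeight (evalZero H) μ := by
  refine LinearMap.ext fun h => ?_
  have h0 : evalZero H (ιU h) = 0 := UniversalEnvelopingAlgebra.lift_ι_apply ℂ _ h
  have h1 : algebraMap A (IsLocalRing.ResidueField A) (φ (ιU h)) = 0 :=
    (IsLocalRing.residue_eq_zero_iff _).2 (hφ h)
  simp only [LinearMap.comp_apply, AlgHom.toLinearMap_apply, cartanWeight_apply, shiftedChar_ι,
    h0, map_add, Algebra.ofId_apply, IsScalarTower.coe_toAlgHom', h1, map_zero,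
    ← IsScalarTower.algebraMap_apply, Algebra.algebraMap_self, RingHom.id_apply]

/-- On `U(𝔫̄)` the value is computed from the complex character `ψ` alone; the right characters `χ`
and `χ₀` play no role. -/
theorem IsBiequivariant.apply_adjoin_nilpOpp {ψ : nilpOpp b →ₗ⁅ℂ⁆ ℂ} {χ : H →ₗ[ℂ] A}
    {χ₀ : H →ₗ[ℂ] ℂ} {G : U(𝔤) →ₗ[ℂ] A} {G₀ : U(𝔤) →ₗ[ℂ] ℂ} (hG : IsBiequivariant ψ χ G)
    (h1 : G 1 = 1) (hG₀ : IsBiequivariant ψ χ₀ G₀) (h₀ : G₀ 1 = 1) {u : U(𝔤)}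
    (hu : u ∈ Algebra.adjoin ℂ (ιU '' (nilpOpp b : Set 𝔤))) : G u = algebraMap ℂ A (G₀ u) := by
  refine adjoin_induction_left (p := fun u => G u = algebraMap ℂ A (G₀ u)) ?_ ?_ ?_ ?_ hu
  · rw [h1, h₀, map_one]
  · intro u v hu hv
    rw [map_add, hu, hv, map_add, map_add]
  · intro c u hu
    rw [map_smul, hu, map_smul, smul_eq_mul, map_mul, Algebra.smul_def]
  · rintro _ ⟨x, hx, rfl⟩ u - hu
    rw [hG.opp ⟨x, hx⟩, hG₀.opp ⟨x, hx⟩, hu, smul_eq_mul, map_mul, Algebra.smul_def]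

end Reduction

end WhittakerPairing

end

/-! ### Assembly of the theorem. -/

set_option maxHeartbeats 1000000

theorem mainTheorem4 {𝔤 : Type*} [LieRing 𝔤] [LieAlgebra ℂ 𝔤] [FiniteDimensional ℂ 𝔤]
    [LieAlgebra.IsSemisimple ℂ 𝔤] (H : LieSubalgebra ℂ 𝔤) [H.IsCartanSubalgebra]
    (b : (LieAlgebra.IsKilling.rootSystem H).Base) (τ : Transpose H)
    (lam : Module.Dual ℂ H) (η : nilp b →ₗ⁅ℂ⁆ ℂ)
    {A : Type*} [CommRing A] [Algebra ℂ A] [IsLocalRing A] (φ : U(H) →ₐ[ℂ] A)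
    (hφ : ∀ x : H, φ (ιU x) ∈ IsLocalRing.maximalIdeal A) :
    ∃ (B₀ : StdWhittaker (evalZero H) η lam →ₗ[ℂ]
          Verma b (evalZero H) lam →ₗ[ℂ] ℂ)
      (B : StdWhittaker φ η lam →ₗ[A] Verma b φ lam →ₗ[A] A),
      -- `B₀` is the unique normalised complex contravariant pairing
      (B₀ ∈ contravariantPairings ℂ τ _ _ ∧
        B₀ (StdWhittaker.gen _ η lam) (Verma.gen b _ lam) = 1 ∧
        ∀ C ∈ contravariantPairings ℂ τ
            (StdWhittaker (evalZero H) η lam)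
            (Verma b (evalZero H) lam),
          ∃ c : ℂ, C = c • B₀) ∧
      -- `B` is the unique normalised `A`-contravariant pairing
      (B ∈ contravariantPairings A τ _ _ ∧
        B (StdWhittaker.gen _ η lam) (Verma.gen b _ lam) = 1 ∧
        ∀ C ∈ contravariantPairings A τ
            (StdWhittaker φ η lam) (Verma b φ lam),
          C (StdWhittaker.gen _ η lam) (Verma.gen b _ lam) = 1 →
            C = B) ∧
      -- `B` lifts `B₀`: it reduces to `B₀` modulo the maximal ideal, and it has the same values as `B₀`
      -- on the generator and `U(𝔫̄)`-multiples of the generator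
      (∀ u u' : U(𝔤), IsLocalRing.residue A
          (B (u • StdWhittaker.gen _ η lam)
            (u' • Verma.gen b _ lam)) =
        algebraMap ℂ (IsLocalRing.ResidueField A)
          (B₀ (u • StdWhittaker.gen _ η lam)
            (u' • Verma.gen b _ lam))) ∧
      (∀ u' ∈ Algebra.adjoin ℂ (ιU '' (nilpOpp b : Set 𝔤)),
        B (StdWhittaker.gen _ η lam) (u' • Verma.gen b _ lam) =
        algebraMap ℂ A
          (B₀ (StdWhittaker.gen _ η lam)
            (u' • Verma.gen b _ lam))) ∧
      -- `Ψ_A` is free of rank one with basis `B`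
      (∃ e : A ≃ₗ[A] contravariantPairings A τ
          (StdWhittaker φ η lam) (Verma b φ lam),
        (e 1 : StdWhittaker φ η lam →ₗ[A]
          Verma b φ lam →ₗ[A] A) = B) ∧
      -- the identification `Θ` of `Hom_A(M_A(lam), A)` with the coinduced bimodule, and the canonical
      -- bimodule homomorphism `ψ : m ↦ ⟨m, ·⟩_A` to the costandard module
      ∃ Θ : (Verma b φ lam →ₗ[A] A) ≃ₗ[A] Coind b φ lam,
        (∀ F u, (Θ F).toLin u = F (τ.onU u • Verma.gen b φ lam)) ∧
        (∀ F (x : U(𝔤)), Θ (F ∘ₗ Module.toModuleEnd A (Verma b φ lam) (τ.onU x)) =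
          x • Θ F) ∧
        ∃ ψ : StdWhittaker φ η lam →ₗ[A] CostdWhittaker φ η lam,
          (∀ (x : U(𝔤)) m, (ψ (x • m) : Coind b φ lam) =
            x • (ψ m : Coind b φ lam)) ∧
          ∀ m, (ψ m : Coind b φ lam) = Θ (B m) := by
  refine (exists_isBiequivariant (etaOpp τ η) (cartanWeight (evalZero H) (lam - rho b))).elim
    fun G₀ ⟨hG₀, h₀⟩ => ?_
  refine (exists_isBiequivariant (etaOpp τ η) (cartanWeight φ (lam - rho b))).elim
    fun G ⟨hG, h1⟩ => ?_
  have hB₀ := stdPairing_mem hG₀ h₀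
  have hB := stdPairing_mem hG h1
  have hn₀ : stdPairing hG₀ h₀ (StdWhittaker.gen _ η lam) (Verma.gen b _ lam) = 1 := by
    have := stdPairing_gen hG₀ h₀ 1
    rwa [one_smul, h₀] at this
  have hn : stdPairing hG h1 (StdWhittaker.gen _ η lam) (Verma.gen b _ lam) = 1 := by
    have := stdPairing_gen hG h1 1
    rwa [one_smul, h1] at this
  have huniq := fun C hC => eq_smul_of_mem_contravariantPairings hB (C := C) hC hn
  refine ⟨stdPairing hG₀ h₀, stdPairing hG h1, ⟨hB₀, hn₀, fun C hC => ?_⟩,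
    ⟨hB, hn, fun C hC hC1 => ?_⟩, fun u u' => ?_, fun u' hu' => ?_, ?_, vermaDualEquiv b φ lam τ,
    vermaDualEquiv_toLin τ, ?_, ?_⟩
  · exact ⟨_, eq_smul_of_mem_contravariantPairings hB₀ hC hn₀⟩
  · rw [huniq C hC, hC1, one_smul]
  -- After contravariance both sides are values at `τ(u) u'` of forms over the residue field with
  -- the same characters and the same value at `1`; uniqueness identifies them.
  · rw [hB u, hB₀ u, smul_smul, smul_smul, stdPairing_gen, stdPairing_gen]
    have e1 := hG.map (IsScalarTower.toAlgHom ℂ A (IsLocalRing.ResidueField A))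
    have e2 := hG₀.map (Algebra.ofId ℂ (IsLocalRing.ResidueField A))
    rw [residue_cartanWeight hφ] at e1
    have e3 := e2.eq_smul (by simp [h₀]) e1
    have e4 := DFunLike.congr_fun e3 (τ.onU u * u')
    simpa [h1, Algebra.ofId_apply] using e4
  · rw [stdPairing_gen, stdPairing_gen]
    exact hG.apply_adjoin_nilpOpp h1 hG₀ h₀ hu'
  · let B : contravariantPairings A τ (StdWhittaker φ η lam) (Verma b φ lam) :=
      ⟨stdPairing hG h1, hB⟩
    -- Evaluation at the pair of generators recovers the coefficient, which gives both injectivity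
    -- and the preimage of a given pairing.
    refine ⟨LinearEquiv.ofBijective (LinearMap.toSpanSingleton A _ B) ⟨fun a a' h => ?_,
      fun C => ⟨C.1 (StdWhittaker.gen φ η lam) (Verma.gen b φ lam),
        Subtype.ext (huniq C.1 C.2).symm⟩⟩, ?_⟩
    · have h2 : a * stdPairing hG h1 (StdWhittaker.gen φ η lam) (Verma.gen b φ lam) =
          a' * stdPairing hG h1 (StdWhittaker.gen φ η lam) (Verma.gen b φ lam) :=
        congrArg (fun C => C.1 (StdWhittaker.gen φ η lam) (Verma.gen b φ lam)) h
      rwa [hn, mul_one, mul_one] at h2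
    · exact one_smul A (stdPairing hG h1)
  · intro F x
    refine Coind.ext fun u => ?_
    rw [Coind.smul_toLin, vermaDualEquiv_toLin, vermaDualEquiv_toLin, τ.onU_mul, mul_smul]
    rfl
  · have hequiv : ∀ (x : U(𝔤)) m, vermaDualEquiv b φ lam τ (stdPairing hG h1 (x • m)) =
        x • vermaDualEquiv b φ lam τ (stdPairing hG h1 m) := by
      intro x m
      refine Coind.ext fun u => ?_
      rw [Coind.smul_toLin, vermaDualEquiv_toLin, vermaDualEquiv_toLin, hB x, τ.onU_mul, mul_smul]
    refine ⟨((vermaDualEquiv b φ lam τ).toLinearMap ∘ₗ stdPairing hG h1).codRestrict _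
      fun m => ?_, fun x m => hequiv x m, fun m => rfl⟩
    -- Every vector of the standard module is twisted finite, and equivariance transports its
    -- exponent to the image.
    obtain ⟨k, hk⟩ := mem_twistedFinite_stdWhittaker m
    refine ⟨k, fun x => ?_⟩
    have := hequiv ((UniversalEnvelopingAlgebra.ι ℂ (x : 𝔤) -
      algebraMap ℂ U(𝔤) (η x)) ^ k) m
    rw [hk x, map_zero, map_zero] at this
    exact this.symm
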